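/- Let $\mathbb K$ be a field of characteristic $0$, $\mathbb N=\{1,2,\dots\}$. **Sums.** The cyclotomic alphabet $A_c$ is the set of all $(a,b,c,z)$ with $a,c\in\mathbb N$, $b\in\mathbb N_0$, $b<a$, $\gcd(a,b)=1$, $z\in\{1,-1\}$; for $k\in\mathbb N_0$ let $A_{c(M_k)}$ be the subset of letters with $a\in M_k=\{1,\dots,k\}$. For $l=(a,b,c,z)$ put $|l|=c$ and $\lambda(l,i)=z^i/(ai+b)^c$. Words in these letters define nested sums $S_\epsilon(n)=1$, $S_{l w}(n)=\sum_{i=1}^n\lambda(l,i)S_w(i)$; the weight of $S_w$ (and of $w$) is the sum of the $|l|$ over the letters $l$ of $w$. **Difference rings.** Let $R=\mathbb K(n)[x]$ with $x^2=1$, with the automorphism $\sigma(n)=n+1$, $\sigma(x)=-x$, $\sigma|_{\mathbb K}=\mathrm{id}$. Let $\mathbb A$ be the polynomial ring over $R$ in variables $\bar S_w$, one for each nonempty word $w$ over $A_c$ (and $\bar S_\epsilon=1$), with $\sigma(\bar S_{lw})=\bar S_{lw}+\sigma(\bar\lambda(l))\,\sigma(\bar S_w)$, where $\bar\lambda(a,b,c,z)=x^{(1-z)/2}/(an+b)^c$.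 Let $[l_1,l_2]$ be the rational linear combination $\sum_j r_jm_j$ of letters with $\lambda(l_1,i)\lambda(l_2,i)=\sum_j r_j\lambda(m_j,i)$ for all $i\in\mathbb N$ (partial fractions), and let $*$ be the quasi-shuffle product on the free $R$-module $R\langle A_c\rangle$ on all words: it is bilinear, the empty word is its unit, and $l_1u*l_2v=l_1(u*l_2v)+l_2(l_1u*v)-[l_1,l_2](u*v)$. Let $L:\mathbb A\to R\langle A_c\rangle$ be the $R$-linear map with $L(\bar S_{w_1}\cdots\bar S_{w_r})=w_1*\cdots*w_r$ (and $L(1)=\epsilon$), and $I=\{f: L(f)=0\}$. For $k\in\mathbb N_0$ let $\mathbb A_k\subset\mathbb A$ be the polynomial subring over $R$ in the $\bar S_w$ with $w$ over $A_{c(M_k)}$ of weight $\le k$, let $\mathbb E_k=\mathbb A_k/(I\cap\mathbb A_k)$, and let $\mathbb E^{A_c}=\bigcup_k\mathbb E_k$ be the direct limit of the chain $\mathbb E_0\to\mathbb E_1\to\cdots$. **Sequences.** Let $\mathcal S(\mathbb K)$ be the ring of sequences $\langle a_n\rangle_{n\ge0}$ over $\mathbb K$, two sequences being identified if they agree for all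 large $n$, with the shift automorphism $\mathcal S:\langle a_n\rangle\mapsto\langle a_{n+1}\rangle$. **Basis sums.** For given $k$ and $d$, consider the matrix whose columns are the words of weight $d$ over $A_{c(M_k)}$ and whose rows are the weight-$d$ parts of $w_1*\cdots*w_r$ for all products of $r\ge2$ nonempty words over $A_{c(M_k)}$ of total weight $d$. A set $B^{(d)}_k$ of words is a set of basis words (indexing sums that cannot be reduced further by the quasi-shuffle algebra) if it is the set of non-pivot columns of the reduced row echelon form of this matrix for some order of the columns; equivalently, if the vector space on the columns is the direct sum of the row space and the span of $B^{(d)}_k$. A compatible choice is a family of such sets with $B^{(d)}_k\subseteq B^{(d)}_{k+1}$ for all $k,d$. Put $U_k=\bigcup_{d\le k}B^{(d)}_k$, and $G_k=U_k\setminus U_{k-1}$ for $k\ge1$. **Statement.** Compatible choices of basis words exist. The automorphism $\sigma$ induces automorphisms $\sigma_k$ of the rings $\mathbb E_k$; the maps $\mathbb E_k\to\mathbb E^{A_c}$ are injective, and there is an automorphism $\sigma$ of $\mathbb E^{A_c}$ that extends all $\sigma_k$. Moreover $\{f\in\mathbb E^{A_c}:\sigma(f)=f\}=\mathbb K$, and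 there is an injective ring homomorphism $\tau:\mathbb E^{A_c}\to\mathcal S(\mathbb K)$ with $\tau(\sigma(f))=\mathcal S(\tau(f))$ for all $f$, such that $\tau(f)=\langle f(n)\rangle_{n\ge0}$ for $f\in\mathbb K(n)$ (with value $0$ at poles), $\tau(x)=\langle(-1)^n\rangle_{n\ge0}$, and the class of $\bar S_w$ is mapped to $\langle S_w(n)\rangle_{n\ge0}$ for every nonempty word $w$ over $A_c$. For every compatible choice of basis words, each $G_k$ is finite, and $\tau(\mathbb E^{A_c})$ is a polynomial ring over $\tau(\mathbb K(n)[x])$ whose generators are the sequences $\langle S_w(n)\rangle_{n\ge0}$ with $w\in G_k$, $k\ge1$: these sequences are algebraically independent over $\tau(\mathbb K(n)[x])$ and, together with $\tau(\mathbb K(n)[x])$, generate $\tau(\mathbb E^{A_c})$ as a ring. -/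

import Mathlib

noncomputable section

namespace CycSums

/-- A letter `(a, b, c, z)` of the full cyclotomic alphabet: `a, c` are positive integers,
`0 ≤ b < a` (so `a` is positive), `gcd (a, b) = 1` and `z = 1` or `z = -1`. -/
structure Letter where
  a : ℕ
  b : ℕ
  c : ℕ
  z : ℤˣ
  b_lt : b < a
  coprime : Nat.Coprime a b
  c_pos : 0 < c

/-- The letter `(a, b, c, z)`, where `a, b` are those of the letter `l`. -/
def Letter.withExp (l : Letter) (c : ℕ) (z : ℤˣ) (hc : 0 < c) : Letter :=
  ⟨l.a, l.b, c, z, l.b_lt, l.coprime, hc⟩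

/-- The coefficients of the partial fraction decomposition of
`z ^ i / ((a₁ i + b₁) ^ c₁ (a₂ i + b₂) ^ c₂)`, where `(a₁, b₁) ≠ (a₂, b₂)` are those of `l₁, l₂`,
through `1 / (P Q) = (a₁ / P - a₂ / Q) / (a₁ b₂ - a₂ b₁)` for `P = a₁ i + b₁`, `Q = a₂ i + b₂`.
The value at `c₁ = c₂ = 0` is never used. -/
def partialFractions (l₁ l₂ : Letter) (z : ℤˣ) : ℕ → ℕ → (Letter →₀ ℚ)
  | 0, 0 => 0
  | c₁ + 1, 0 => Finsupp.single (l₁.withExp (c₁ + 1) z c₁.succ_pos) 1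
  | 0, c₂ + 1 => Finsupp.single (l₂.withExp (c₂ + 1) z c₂.succ_pos) 1
  | c₁ + 1, c₂ + 1 =>
      ((l₁.a : ℚ) * l₂.b - l₂.a * l₁.b)⁻¹ •
        ((l₁.a : ℚ) • partialFractions l₁ l₂ z (c₁ + 1) c₂
          - (l₂.a : ℚ) • partialFractions l₁ l₂ z c₁ (c₂ + 1))
termination_by c₁ c₂ => c₁ + c₂

open Classical in
/-- The bracket `[l₁, l₂]`: the rational linear combination of letters with
`λ(l₁, i) λ(l₂, i) = ∑ r_j λ(l_j, i)`. -/
def bracket (l₁ l₂ : Letter) : Letter →₀ ℚ :=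
  if l₁.a = l₂.a ∧ l₁.b = l₂.b then
    Finsupp.single (l₁.withExp (l₁.c + l₂.c) (l₁.z * l₂.z) (Nat.add_pos_left l₁.c_pos _)) 1
  else partialFractions l₁ l₂ (l₁.z * l₂.z) l₁.c l₂.c

/-! ### The bracket is commutative and associative -/

/-- The function `1 / (a t + b) ^ c` on irrational points, graded by the sign `z`; used only to
prove that the bracket is commutative and associative. -/
def letterFun (l : Letter) : MonoidAlgebra ({t : ℝ // Irrational t} → ℝ) ℤˣ :=
  MonoidAlgebra.single l.z (fun t => ((l.a * t.1 + l.b) ^ l.c)⁻¹)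

/-- The linear extension of `letterFun`. -/
def letterFunL : (Letter →₀ ℚ) →ₗ[ℚ] MonoidAlgebra ({t : ℝ // Irrational t} → ℝ) ℤˣ :=
  Finsupp.linearCombination ℚ letterFun

theorem lin_ne (l : Letter) (t : ℝ) (ht : Irrational t) : (l.a * t + l.b : ℝ) ≠ 0 := by
  have : Irrational (l.a * t + l.b) :=
    (ht.natCast_mul (by have := l.b_lt; omega)).add_natCast _
  exact this.ne_zero

theorem det_ne {l₁ l₂ : Letter} (h : ¬ (l₁.a = l₂.a ∧ l₁.b = l₂.b)) :
    ((l₁.a : ℚ) * l₂.b - l₂.a * l₁.b) ≠ 0 := by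
  intro h0
  apply h
  have h1 : l₁.a * l₂.b = l₂.a * l₁.b := by
    have : ((l₁.a * l₂.b : ℕ) : ℚ) = ((l₂.a * l₁.b : ℕ) : ℚ) := by push_cast; linarith
    exact_mod_cast this
  have d1 : l₁.a ∣ l₂.a := l₁.coprime.dvd_of_dvd_mul_right (Dvd.intro _ h1)
  have d2 : l₂.a ∣ l₁.a := l₂.coprime.dvd_of_dvd_mul_right (Dvd.intro _ h1.symm)
  have e := Nat.dvd_antisymm d1 d2
  refine ⟨e, ?_⟩
  rw [e] at h1
  exact (Nat.eq_of_mul_eq_mul_left (by have := l₂.b_lt; omega) h1).symm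

theorem letterFunL_pf {l₁ l₂ : Letter} (h : ¬ (l₁.a = l₂.a ∧ l₁.b = l₂.b)) (z : ℤˣ) :
    ∀ (n c₁ c₂ : ℕ), c₁ + c₂ ≤ n → 0 < c₁ + c₂ →
      letterFunL (partialFractions l₁ l₂ z c₁ c₂) = MonoidAlgebra.single z
        (fun t : {t : ℝ // Irrational t} =>
          ((l₁.a * t.1 + l₁.b) ^ c₁)⁻¹ * ((l₂.a * t.1 + l₂.b) ^ c₂)⁻¹) := by
  intro n
  induction n with
  | zero => intro c₁ c₂ h1 h2; omega
  | succ n ih =>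
    intro c₁ c₂ h1 h2
    match c₁, c₂ with
    | 0, 0 => omega
    | c₁ + 1, 0 =>
      simp [partialFractions, letterFunL, letterFun, Letter.withExp]
    | 0, c₂ + 1 =>
      simp [partialFractions, letterFunL, letterFun, Letter.withExp]
    | c₁ + 1, c₂ + 1 =>
      rw [partialFractions, map_smul, map_sub, map_smul, map_smul,
        ih (c₁ + 1) c₂ (by omega) (by omega), ih c₁ (c₂ + 1) (by omega) (by omega)]
      simp only [MonoidAlgebra.smul_single, ← MonoidAlgebra.single_sub]
      congr 1
      funext t
      have e1 := lin_ne l₁ t.1 t.2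
      have e2 := lin_ne l₂ t.1 t.2
      have e3 : ((l₁.a : ℝ) * l₂.b - l₂.a * l₁.b) ≠ 0 := by exact_mod_cast det_ne h
      simp only [Pi.smul_apply, Pi.sub_apply, Rat.smul_def]
      push_cast
      field_simp
      ring

theorem letterFunL_bracket (l₁ l₂ : Letter) :
    letterFunL (bracket l₁ l₂) = letterFun l₁ * letterFun l₂ := by
  unfold bracket
  split_ifs with h
  · rw [letterFunL, Finsupp.linearCombination_single, one_smul]
    simp only [letterFun, Letter.withExp, MonoidAlgebra.single_mul_single]
    congr 1
    funext t
    simp [h.1, h.2, pow_add, mul_comm]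
  · rw [letterFunL_pf h _ _ _ _ le_rfl (Nat.add_pos_left l₁.c_pos _)]
    simp only [letterFun, MonoidAlgebra.single_mul_single]
    rfl

theorem letterFunL_injective : Function.Injective letterFunL := by
  classical
  rw [← LinearMap.ker_eq_bot, LinearMap.ker_eq_bot']
  intro f hf
  by_contra hne
  -- choose a letter of maximal exponent in the support
  obtain ⟨l, hl, hmax⟩ := Finset.exists_max_image f.support (fun l => l.c)
    (Finsupp.support_nonempty_iff.2 hne)
  have hpos : (l.a : ℝ) ≠ 0 := by have := l.b_lt; exact_mod_cast (by omega : l.a ≠ 0)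
  set α : ℝ := -l.b / l.a with hα
  have hroot : (l.a : ℝ) * α + l.b = 0 := by rw [hα]; field_simp; ring
  -- the sum over letters of the same sign vanishes at irrational points
  have key : ∀ t : ℝ, Irrational t →
      ∑ m ∈ f.support with m.z = l.z, (f m : ℝ) * ((m.a * t + m.b) ^ m.c)⁻¹ = 0 := by
    intro t ht
    have h1 := congrArg (fun g : MonoidAlgebra ({t : ℝ // Irrational t} → ℝ) ℤˣ =>
      g.coeff l.z ⟨t, ht⟩) hf
    simp only [letterFunL, Finsupp.linearCombination_apply, Finsupp.sum,
      MonoidAlgebra.coeff_sum, Finsupp.finsetSum_apply, Finset.sum_apply] at h1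
    rw [Finset.sum_filter]
    refine Eq.trans ?_ h1
    refine Finset.sum_congr rfl fun m _ => ?_
    by_cases h : m.z = l.z
    · simp [letterFun, h, Rat.smul_def]
    · simp [letterFun, h]
  let G : Letter → ℝ → ℝ := fun m t =>
    if m.a = l.a ∧ m.b = l.b then (f m : ℝ) * (l.a * t + l.b) ^ (l.c - m.c)
    else (f m : ℝ) * ((m.a * t + m.b) ^ m.c)⁻¹ * (l.a * t + l.b) ^ l.c
  have hG : ∀ t : ℝ, Irrational t → ∑ m ∈ f.support with m.z = l.z, G m t = 0 := by
    intro t ht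
    have := congrArg (fun y => y * (l.a * t + l.b) ^ l.c) (key t ht)
    simp only [zero_mul, Finset.sum_mul] at this
    rw [← this]
    refine Finset.sum_congr rfl fun m hm => ?_
    simp only [G]
    split_ifs with h
    · have hle : m.c ≤ l.c := hmax m (Finset.mem_filter.1 hm).1
      rw [h.1, h.2, mul_assoc, ← pow_sub_mul_pow (a := (l.a * t + l.b : ℝ)) hle]
      have := pow_ne_zero m.c (lin_ne l t ht)
      field_simp
    · rfl
  have hcont : ∀ m ∈ f.support.filter (fun m => m.z = l.z), ContinuousAt (G m) α := by
    intro m _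
    simp only [G]
    by_cases h : m.a = l.a ∧ m.b = l.b
    · simp only [h, and_self, if_true]
      fun_prop
    · simp only [h, if_false]
      have hd : (m.a * α + m.b : ℝ) ≠ 0 := by
        have h3 : ((m.a : ℝ) * l.b - l.a * m.b) ≠ 0 := by exact_mod_cast det_ne h
        intro h4
        apply h3
        linear_combination (m.a : ℝ) * hroot - (l.a : ℝ) * h4
      have : (m.a * α + m.b : ℝ) ^ m.c ≠ 0 := pow_ne_zero _ hd
      fun_prop (disch := assumption)
  have hsum : ContinuousAt (fun t => ∑ m ∈ f.support with m.z = l.z, G m t) α :=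
    tendsto_finsetSum _ hcont
  have hzero : (fun t => ∑ m ∈ f.support with m.z = l.z, G m t) α = 0 := by
    have hmem : α ∈ closure {t : ℝ | Irrational t} := dense_irrational α
    have hne' : (nhdsWithin α {t : ℝ | Irrational t}).NeBot :=
      mem_closure_iff_nhdsWithin_neBot.1 hmem
    refine tendsto_nhds_unique (l := nhdsWithin α {t : ℝ | Irrational t}) (hsum.tendsto.mono_left nhdsWithin_le_nhds)
      (tendsto_const_nhds.congr' ?_)
    filter_upwards [self_mem_nhdsWithin] with t ht
    exact (hG t ht).symm
  have hval : ∑ m ∈ f.support with m.z = l.z, G m α = f l := by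
    rw [Finset.sum_eq_single_of_mem l (by simpa using hl)]
    · simp [G]
    · intro m hm hml
      obtain ⟨hm1, hm2⟩ := Finset.mem_filter.1 hm
      simp only [G]
      split_ifs with h
      · rw [hroot, zero_pow, mul_zero]
        have hle : m.c ≤ l.c := hmax m hm1
        intro h0
        apply hml
        have hc : m.c = l.c := by omega
        cases m; cases l
        simp_all
      · rw [hroot, zero_pow l.c_pos.ne', mul_zero]
  have : (f l : ℝ) = 0 := hval.symm.trans hzero
  exact Finsupp.mem_support_iff.1 hl (by exact_mod_cast this)

theorem bracket_comm (l₁ l₂ : Letter) : bracket l₁ l₂ = bracket l₂ l₁ :=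
  letterFunL_injective (by rw [letterFunL_bracket, letterFunL_bracket, mul_comm])

theorem bracket_assoc (l₁ l₂ l₃ : Letter) :
    Finsupp.linearCombination ℚ (fun l => bracket l l₃) (bracket l₁ l₂)
      = Finsupp.linearCombination ℚ (fun l => bracket l₁ l) (bracket l₂ l₃) := by
  apply letterFunL_injective
  have h1 : ∀ f : Letter →₀ ℚ, letterFunL (Finsupp.linearCombination ℚ (fun l => bracket l l₃) f)
      = letterFunL f * letterFun l₃ := by
    intro f
    induction f using Finsupp.induction_linear with
    | zero => simp
    | add f g hf hg => simp [hf, hg, add_mul]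
    | single l r => simp [letterFunL_bracket]; simp [letterFunL]
  have h2 : ∀ f : Letter →₀ ℚ, letterFunL (Finsupp.linearCombination ℚ (fun l => bracket l₁ l) f)
      = letterFun l₁ * letterFunL f := by
    intro f
    induction f using Finsupp.induction_linear with
    | zero => simp
    | add f g hf hg => simp [hf, hg, mul_add]
    | single l r => simp [letterFunL_bracket]; simp [letterFunL]
  rw [h1, h2, letterFunL_bracket, letterFunL_bracket, mul_assoc]


/-! ### The quasi-shuffle algebra -/

/-- The module `F⟨G⟩` of noncommutative polynomials over `F`, with the set of all words over the
alphabet `G` of cyclotomic letters as a basis. It carries the quasi-shuffle product below. -/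
def QuasiShuffle (F : Type*) [CommRing F] : Type _ := List Letter →₀ F

section
variable (F : Type*) [CommRing F]

instance : AddCommGroup (QuasiShuffle F) := (inferInstance : AddCommGroup (List Letter →₀ F))

instance {S : Type*} [Semiring S] [Module S F] : Module S (QuasiShuffle F) :=
  (inferInstance : Module S (List Letter →₀ F))

instance {S T : Type*} [Semiring S] [Semiring T] [Module S F] [Module T F] [SMulCommClass S T F] :
    SMulCommClass S T (QuasiShuffle F) :=
  (inferInstance : SMulCommClass S T (List Letter →₀ F))

/-- The basis of all words. -/
def wordBasis : Module.Basis (List Letter) F (QuasiShuffle F) :=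
  Module.Basis.ofRepr (LinearEquiv.refl F (List Letter →₀ F))

/-- A word as an element of the quasi-shuffle algebra. -/
def word (w : List Letter) : QuasiShuffle F := wordBasis F w

/-- Prefixing all words with the letter `l`, extended linearly. -/
def cons (l : Letter) : QuasiShuffle F →ₗ[F] QuasiShuffle F :=
  (wordBasis F).constr F fun w => word F (l :: w)

theorem hom_ext_word {F : Type*} [CommRing F] {N : Type*} [AddCommGroup N] [Module F N] {f g : QuasiShuffle F →ₗ[F] N}
    (h : ∀ w, f (word F w) = g (word F w)) : f = g :=
  (wordBasis F).ext h

theorem cons_word {F : Type*} [CommRing F] (l : Letter) (w : List Letter) : cons F l (word F w) = word F (l :: w) := by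
  simp only [cons, word, Module.Basis.constr_basis]

variable [Algebra ℚ F]

/-- Prefixing all words with a rational linear combination of letters, extended bilinearly. -/
def consComb : (Letter →₀ ℚ) →ₗ[ℚ] (QuasiShuffle F →ₗ[F] QuasiShuffle F) :=
  Finsupp.linearCombination ℚ (cons F)

/-- The quasi-shuffle product of two words:
`(l₁ u) * (l₂ v) = l₁ (u * l₂ v) + l₂ (l₁ u * v) - [l₁, l₂] (u * v)`. -/
def mulWord : List Letter → List Letter → QuasiShuffle F
  | [], v => word F v
  | l₁ :: u, [] => word F (l₁ :: u)
  | l₁ :: u, l₂ :: v =>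
      cons F l₁ (mulWord u (l₂ :: v)) + cons F l₂ (mulWord (l₁ :: u) v)
        - consComb F (bracket l₁ l₂) (mulWord u v)
termination_by u v => u.length + v.length

/-- The quasi-shuffle product, extended bilinearly from words. -/
def mulLin : QuasiShuffle F →ₗ[F] QuasiShuffle F →ₗ[F] QuasiShuffle F :=
  (wordBasis F).constr F fun u => (wordBasis F).constr F fun v => mulWord F u v

variable {F}

theorem mulLin_word (u v : List Letter) : mulLin F (word F u) (word F v) = mulWord F u v := by
  simp only [mulLin, word, Module.Basis.constr_basis]

theorem consComb_single (l : Letter) (q : ℚ) : consComb F (Finsupp.single l q) = q • cons F l := by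
  simp [consComb]

theorem mul_cons_cons (l₁ l₂ : Letter) (x y : QuasiShuffle F) :
    mulLin F (cons F l₁ x) (cons F l₂ y) = cons F l₁ (mulLin F x (cons F l₂ y))
      + cons F l₂ (mulLin F (cons F l₁ x) y) - consComb F (bracket l₁ l₂) (mulLin F x y) := by
  have h : (mulLin F).compl₁₂ (cons F l₁) (cons F l₂)
      = ((mulLin F).compl₂ (cons F l₂)).compr₂ (cons F l₁)
        + ((mulLin F).comp (cons F l₁)).compr₂ (cons F l₂)
        - (mulLin F).compr₂ (consComb F (bracket l₁ l₂)) := by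
    refine hom_ext_word fun u => hom_ext_word fun v => ?_
    simp only [LinearMap.compl₁₂_apply, LinearMap.sub_apply, LinearMap.add_apply,
      LinearMap.compr₂_apply, LinearMap.compl₂_apply, LinearMap.comp_apply, cons_word, mulLin_word]
    rw [mulWord]
  exact LinearMap.congr_fun (LinearMap.congr_fun h x) y

theorem mulWord_comm (u v : List Letter) : mulWord F u v = mulWord F v u := by
  match u, v with
  | [], [] => rfl
  | [], l :: v => rw [mulWord, mulWord]
  | l :: u, [] => rw [mulWord, mulWord]
  | l₁ :: u, l₂ :: v =>
    rw [mulWord, mulWord, mulWord_comm u (l₂ :: v), mulWord_comm (l₁ :: u) v, mulWord_comm u v,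
      bracket_comm l₁ l₂, add_comm (cons F l₁ _)]
termination_by u.length + v.length

theorem mulLin_comm (x y : QuasiShuffle F) : mulLin F x y = mulLin F y x := by
  have h : mulLin F = (mulLin F).flip :=
    hom_ext_word fun u => hom_ext_word fun v => by
      rw [LinearMap.flip_apply, mulLin_word, mulLin_word, mulWord_comm]
  exact LinearMap.congr_fun (LinearMap.congr_fun h x) y

theorem nil_mulLin (x : QuasiShuffle F) : mulLin F (word F []) x = x := by
  have h : mulLin F (word F []) = LinearMap.id :=
    hom_ext_word fun v => by rw [mulLin_word, mulWord, LinearMap.id_apply]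
  exact LinearMap.congr_fun h x

theorem mul_consComb_cons (f : Letter →₀ ℚ) (l : Letter) (x y : QuasiShuffle F) :
    mulLin F (consComb F f x) (cons F l y) = consComb F f (mulLin F x (cons F l y))
      + cons F l (mulLin F (consComb F f x) y)
      - consComb F (Finsupp.linearCombination ℚ (fun m => bracket m l) f) (mulLin F x y) := by
  induction f using Finsupp.induction_linear with
  | zero => simp
  | add f g hf hg => simp only [map_add, LinearMap.add_apply, hf, hg]; abel
  | single m q =>
    have hq : ∀ z : QuasiShuffle F, q • z = (algebraMap ℚ F q) • z := fun z =>
      (algebraMap_smul F q z).symm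
    simp only [consComb_single, LinearMap.smul_apply, Finsupp.linearCombination_single, map_smul]
    simp only [hq, map_smul, LinearMap.smul_apply, mul_cons_cons, smul_add, smul_sub]

theorem mul_cons_consComb (f : Letter →₀ ℚ) (l : Letter) (x y : QuasiShuffle F) :
    mulLin F (cons F l x) (consComb F f y) = cons F l (mulLin F x (consComb F f y))
      + consComb F f (mulLin F (cons F l x) y)
      - consComb F (Finsupp.linearCombination ℚ (fun m => bracket l m) f) (mulLin F x y) := by
  rw [mulLin_comm, mul_consComb_cons, mulLin_comm y (cons F l x), mulLin_comm _ x, mulLin_comm y x]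
  simp only [bracket_comm _ l]
  abel

theorem mulLin_assoc_word (u v w : List Letter) :
    mulLin F (mulLin F (word F u) (word F v)) (word F w)
      = mulLin F (word F u) (mulLin F (word F v) (word F w)) := by
  match u, v, w with
  | [], v, w => simp only [nil_mulLin]
  | u, [], w => rw [mulLin_comm (word F u) (word F []), nil_mulLin, nil_mulLin]
  | u, v, [] => rw [mulLin_comm _ (word F []), nil_mulLin, mulLin_comm _ (word F []), nil_mulLin]
  | a :: u, b :: v, c :: w =>
    have i1 := mulLin_assoc_word u (b :: v) (c :: w)
    have i2 := mulLin_assoc_word (a :: u) v (c :: w)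
    have i3 := mulLin_assoc_word (a :: u) (b :: v) w
    have i4 := mulLin_assoc_word u v (c :: w)
    have i5 := mulLin_assoc_word u (b :: v) w
    have i6 := mulLin_assoc_word (a :: u) v w
    have i7 := mulLin_assoc_word u v w
    simp only [← cons_word] at i1 i2 i3 i4 i5 i6 i7 ⊢
    generalize word F u = u at *
    generalize word F v = v at *
    generalize word F w = w at *
    have e1 : mulLin F (mulLin F (cons F a u) (cons F b v)) (cons F c w)
        = cons F a (mulLin F (mulLin F u (cons F b v)) (cons F c w))
          + cons F b (mulLin F (mulLin F (cons F a u) v) (cons F c w))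
          - consComb F (bracket a b) (mulLin F (mulLin F u v) (cons F c w))
          + cons F c (mulLin F (mulLin F (cons F a u) (cons F b v)) w)
          - consComb F (bracket a c) (mulLin F (mulLin F u (cons F b v)) w)
          - consComb F (bracket b c) (mulLin F (mulLin F (cons F a u) v) w)
          + consComb F (Finsupp.linearCombination ℚ (fun m => bracket m c) (bracket a b))
              (mulLin F (mulLin F u v) w) := by
      rw [mul_cons_cons a b]
      simp only [map_add, map_sub, LinearMap.add_apply, LinearMap.sub_apply]
      rw [mul_cons_cons a c, mul_cons_cons b c, mul_consComb_cons]
      abel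
    have e2 : mulLin F (cons F a u) (mulLin F (cons F b v) (cons F c w))
        = cons F a (mulLin F u (mulLin F (cons F b v) (cons F c w)))
          + cons F b (mulLin F (cons F a u) (mulLin F v (cons F c w)))
          - consComb F (bracket a b) (mulLin F u (mulLin F v (cons F c w)))
          + cons F c (mulLin F (cons F a u) (mulLin F (cons F b v) w))
          - consComb F (bracket a c) (mulLin F u (mulLin F (cons F b v) w))
          - consComb F (bracket b c) (mulLin F (cons F a u) (mulLin F v w))
          + consComb F (Finsupp.linearCombination ℚ (fun m => bracket a m) (bracket b c))
              (mulLin F u (mulLin F v w)) := by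
      rw [mul_cons_cons b c]
      simp only [map_add, map_sub]
      rw [mul_cons_cons a b, mul_cons_cons a c, mul_cons_consComb]
      abel
    rw [e1, e2, i1, i2, i3, i4, i5, i6, i7, bracket_assoc]
termination_by u.length + v.length + w.length

theorem mulLin_assoc (x y z : QuasiShuffle F) :
    mulLin F (mulLin F x y) z = mulLin F x (mulLin F y z) := by
  have h1 : ∀ v w, ((mulLin F).flip (word F w)).comp ((mulLin F).flip (word F v))
      = (mulLin F).flip (mulLin F (word F v) (word F w)) := fun v w =>
    hom_ext_word fun u => by
      simp only [LinearMap.comp_apply, LinearMap.flip_apply]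
      exact mulLin_assoc_word u v w
  have h2 : ∀ w, ((mulLin F).flip (word F w)).comp (mulLin F x)
      = (mulLin F x).comp ((mulLin F).flip (word F w)) := fun w =>
    hom_ext_word fun v => by
      have h := LinearMap.congr_fun (h1 v w) x
      simp only [LinearMap.comp_apply, LinearMap.flip_apply] at h ⊢
      exact h
  have h3 : mulLin F (mulLin F x y) = (mulLin F x).comp (mulLin F y) :=
    hom_ext_word fun w => by
      have h := LinearMap.congr_fun (h2 w) y
      simp only [LinearMap.comp_apply, LinearMap.flip_apply] at h ⊢
      exact h
  exact LinearMap.congr_fun h3 z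

variable (F)

instance : CommRing (QuasiShuffle F) where
  __ := (inferInstance : AddCommGroup (QuasiShuffle F))
  mul x y := mulLin F x y
  one := word F []
  left_distrib x y z := map_add (mulLin F x) y z
  right_distrib x y z := LinearMap.map_add₂ (mulLin F) x y z
  zero_mul x := LinearMap.map_zero₂ (mulLin F) x
  mul_zero x := map_zero (mulLin F x)
  mul_assoc := mulLin_assoc
  one_mul := nil_mulLin
  mul_one x := (mulLin_comm x _).trans (nil_mulLin x)
  mul_comm := mulLin_comm

instance : Algebra F (QuasiShuffle F) :=
  Algebra.ofModule (fun r x y => LinearMap.map_smul₂ (mulLin F) r x y)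
    (fun r x y => map_smul (mulLin F x) r y)

end

/-! ### The difference ring `K(n)[x]` -/

section
variable (K : Type*) [Field K]

/-- The ring `K(n)[x]` subject to the relation `x ^ 2 = 1`. The variable `n` is `RatFunc.X`. -/
abbrev BaseRing : Type _ := AdjoinRoot (Polynomial.X ^ 2 - 1 : Polynomial (RatFunc K))

/-- The element `x` of `K(n)[x]`. -/
def altSign : BaseRing K := AdjoinRoot.root _

/-- The inclusion of `K(n)` into `K(n)[x]`. -/
def ofRat : RatFunc K →+* BaseRing K := AdjoinRoot.of _

/-- The shift `f(n) ↦ f(n + 1)` on `K(n)`. -/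
def ratShift : RatFunc K →+* RatFunc K :=
  RatFunc.mapRingHom (Polynomial.compRingHom (Polynomial.X + 1 : Polynomial K)) (by
    intro p hp
    rw [mem_nonZeroDivisors_iff_ne_zero] at hp
    rw [Submonoid.mem_comap, mem_nonZeroDivisors_iff_ne_zero]
    intro h
    apply hp
    have h' : p.comp (Polynomial.X + Polynomial.C 1) = 0 := by simpa using h
    exact (Polynomial.comp_X_add_C_eq_zero_iff).1 h')

theorem altSign_mul_self : altSign K * altSign K = 1 := by
  have h := AdjoinRoot.eval₂_root (Polynomial.X ^ 2 - 1 : Polynomial (RatFunc K))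
  simp only [Polynomial.eval₂_sub, Polynomial.eval₂_pow, Polynomial.eval₂_X,
    Polynomial.eval₂_one] at h
  rw [← pow_two]
  exact sub_eq_zero.1 h

/-- The shift `σ` on `K(n)[x]`: `σ(n) = n + 1` and `σ(x) = -x`. -/
def baseShift : BaseRing K →+* BaseRing K :=
  AdjoinRoot.lift ((ofRat K).comp (ratShift K)) (-altSign K) (by
    simp [pow_two, altSign_mul_self])

open Classical in
/-- `λ(a, b, c, z) = x ^ ((1 - z) / 2) / (a n + b) ^ c` in `K(n)[x]`. -/
def lambdaBar (l : Letter) : BaseRing K :=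
  (if l.z = 1 then 1 else altSign K) *
    ofRat K (((l.a : RatFunc K) * RatFunc.X + (l.b : RatFunc K)) ^ l.c)⁻¹

/-! ### The difference ring of all sums -/

/-- A nonempty word over the alphabet; it indexes a nested sum. -/
abbrev Word : Type := {w : List Letter // w ≠ []}

/-- The weight of a word: the sum of the exponents `c` of its letters. -/
def weight (w : List Letter) : ℕ := (w.map Letter.c).sum

/-- The polynomial ring over `K(n)[x]` with one variable for each nonempty word. -/
abbrev SumRing : Type _ := MvPolynomial Word (BaseRing K)

/-- The image under `σ` of the variable of a word (of `1` for the empty word):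
`σ(S_{l w}) = S_{l w} + σ(λ(l)) σ(S_w)`. -/
def shiftWord : List Letter → SumRing K
  | [] => 1
  | l :: w => MvPolynomial.X ⟨l :: w, List.cons_ne_nil l w⟩
      + MvPolynomial.C (baseShift K (lambdaBar K l)) * shiftWord w

/-- The shift `σ` on the ring of all sums. -/
def sumShift : SumRing K →+* SumRing K :=
  MvPolynomial.eval₂Hom (MvPolynomial.C.comp (baseShift K)) fun w => shiftWord K w.1

/-- The words over the letters `(a, b, c, z)` with `a ∈ M`, of weight at most `d`. -/
def wordsLE (M : Set ℕ) (d : ℕ) : Set Word := {w | (∀ l ∈ w.1, l.a ∈ M) ∧ weight w.1 ≤ d}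

/-- The polynomial ring over `K(n)[x]` in the variables of weight at most `d` over the letters with
`a ∈ M`, as a subring of the ring of all sums. -/
def sumRingLE (M : Set ℕ) (d : ℕ) : Subalgebra (BaseRing K) (SumRing K) :=
  MvPolynomial.supported (BaseRing K) (wordsLE M d)

theorem sumRingLE_mono {M N : Set ℕ} (hMN : M ⊆ N) {d e : ℕ} (hde : d ≤ e) :
    sumRingLE K M d ≤ sumRingLE K N e :=
  MvPolynomial.supported_mono fun _ hw => ⟨fun l hl => hMN (hw.1 l hl), hw.2.trans hde⟩

theorem shiftWord_mem (M : Set ℕ) (d : ℕ) : ∀ w : List Letter, (∀ l ∈ w, l.a ∈ M) → weight w ≤ d →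
    shiftWord K w ∈ sumRingLE K M d := by
  intro w
  induction w with
  | nil => intro _ _; exact one_mem _
  | cons l w ih =>
    intro h1 h2
    rw [shiftWord]
    have h3 : weight w ≤ d := by
      simp only [weight, List.map_cons, List.sum_cons] at h2 ⊢
      omega
    refine add_mem (Algebra.subset_adjoin ⟨⟨l :: w, List.cons_ne_nil l w⟩, ⟨h1, h2⟩, rfl⟩)
      (mul_mem ((sumRingLE K M d).algebraMap_mem _) (ih (fun m hm => h1 m (by simp [hm])) h3))

theorem sumShift_mem (M : Set ℕ) (d : ℕ) {f : SumRing K} (hf : f ∈ sumRingLE K M d) :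
    sumShift K f ∈ sumRingLE K M d := by
  refine Algebra.adjoin_induction (p := fun f _ => sumShift K f ∈ sumRingLE K M d)
    ?_ ?_ ?_ ?_ hf
  · rintro _ ⟨w, hw, rfl⟩
    simpa [sumShift] using shiftWord_mem K M d w.1 hw.1 hw.2
  · intro r
    simpa [sumShift, MvPolynomial.algebraMap_eq] using (sumRingLE K M d).algebraMap_mem _
  · intro x y _ _ hx hy; simpa using add_mem hx hy
  · intro x y _ _ hx hy; simpa using mul_mem hx hy

/-- The shift `σ` on the ring in the variables of weight at most `d`. -/
def sumShiftLE (M : Set ℕ) (d : ℕ) : sumRingLE K M d →+* sumRingLE K M d :=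
  ((sumShift K).comp (sumRingLE K M d).val.toRingHom).codRestrict (sumRingLE K M d) fun f =>
    sumShift_mem K M d f.2

/-! ### The reduced difference rings -/

variable [CharZero K]

/-- The linearization `L`: the `K(n)[x]`-linear map that sends a product of sum variables to the
quasi-shuffle product of the corresponding words. -/
def linearize : SumRing K →ₐ[BaseRing K] QuasiShuffle (BaseRing K) :=
  MvPolynomial.aeval fun w : Word => word (BaseRing K) w.1

/-- The ideal of all `f` with `L(f) = 0`. -/
def relIdeal : Ideal (SumRing K) := RingHom.ker (linearize K)

/-- The part of this ideal in the variables of weight at most `d` over the letters with `a ∈ M`. -/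
def relIdealLE (M : Set ℕ) (d : ℕ) : Ideal (sumRingLE K M d) :=
  (relIdeal K).comap (sumRingLE K M d).val

/-- The reduced ring `E_d` of the alphabet of letters with `a ∈ M`. -/
abbrev ReducedLE (M : Set ℕ) (d : ℕ) : Type _ := sumRingLE K M d ⧸ relIdealLE K M d

/-- The inclusion of reduced rings when alphabet and weight increase. -/
def ReducedLE.incl {M N : Set ℕ} (hMN : M ⊆ N) {d e : ℕ} (hde : d ≤ e) :
    ReducedLE K M d →+* ReducedLE K N e :=
  Ideal.quotientMap (relIdealLE K N e)
    (Subalgebra.inclusion (sumRingLE_mono K hMN hde)).toRingHom le_rfl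

/-- The reduced ring of weight at most `k` for the alphabet with `a ∈ {1, …, k}`. -/
abbrev Stage (k : ℕ) : Type _ := ReducedLE K (Set.Icc 1 k) k

/-- The ring `E` of the full cyclotomic alphabet: the union of the chain of the rings `Stage K k`
along their inclusions. -/
abbrev CycRing : Type _ :=
  Ring.DirectLimit (Stage K) fun _ _ h =>
    ReducedLE.incl K (Set.Icc_subset_Icc_right h) h

/-- The embedding of `K(n)[x]` into the ring `CycRing K`. -/
def ofBase : BaseRing K →+* CycRing K :=
  (Ring.DirectLimit.of (Stage K) _ 0).comp (algebraMap (BaseRing K) (Stage K 0))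

end

/-! ### Sequences -/

section
variable (K : Type*) [Field K]

/-- The ring of sequences over `K`, two sequences being equal if they agree from some point on. -/
abbrev SeqRing : Type _ := Filter.Germ (Filter.atTop : Filter ℕ) K

/-- The shift `⟨a₀, a₁, a₂, …⟩ ↦ ⟨a₁, a₂, a₃, …⟩` on the ring of sequences. -/
def seqShift : SeqRing K ≃+* SeqRing K where
  toFun s := s.compTendsto (fun n => n + 1) (Filter.tendsto_add_atTop_nat 1)
  invFun s := s.compTendsto (fun n => n - 1) (Filter.tendsto_sub_atTop_nat 1)
  left_inv s := by
    refine Filter.Germ.inductionOn s fun f => ?_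
    refine Filter.Germ.coe_eq.2 ?_
    filter_upwards [Filter.eventually_ge_atTop 1] with n hn
    simp [Function.comp, Nat.sub_add_cancel hn]
  right_inv s := by
    refine Filter.Germ.inductionOn s fun f => ?_
    refine Filter.Germ.coe_eq.2 (Filter.Eventually.of_forall fun n => ?_)
    simp [Function.comp]
  map_mul' s t := Filter.Germ.inductionOn₂ s t fun _ _ => rfl
  map_add' s t := Filter.Germ.inductionOn₂ s t fun _ _ => rfl

/-- `λ(a, b, c, z; i) = z ^ i / (a i + b) ^ c`. -/
def lambda (l : Letter) (i : ℕ) : K := ((l.z : ℤ) : K) ^ i / ((l.a : K) * i + l.b) ^ l.c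

/-- The nested sum `S_{l₁ l₂ …}(n) = ∑_{i = 1}^n λ(l₁, i) S_{l₂ …}(i)`; it is `1` for the empty
word. -/
def nestedSum : List Letter → ℕ → K
  | [], _ => 1
  | l :: w, n => ∑ i ∈ Finset.Icc 1 n, lambda K l i * nestedSum w i

/-- The class of a sequence. -/
def seqClass (f : ℕ → K) : SeqRing K := (f : Filter.Germ (Filter.atTop : Filter ℕ) K)

end

/-! ### The basis sums -/

/-- The words of weight `d` over the letters with `a ∈ M`. -/
def wordsEq (M : Set ℕ) (d : ℕ) : Set Word := {w | (∀ l ∈ w.1, l.a ∈ M) ∧ weight w.1 = d}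

open Classical in
/-- The part of weight `d` of a linear combination of words. -/
def weightPart (d : ℕ) : QuasiShuffle ℚ →ₗ[ℚ] QuasiShuffle ℚ :=
  (wordBasis ℚ).constr ℚ fun w => if weight w = d then word ℚ w else 0

/-- The row space of the matrix of all quasi-shuffle relations of weight `d`, whose columns are the
words of weight `d` over the letters with `a ∈ M`: there is one row for each product `p` of at
least two sums over these letters with total weight `d`, namely the part of weight `d` of `L(p)`
(the difference `L(p) - p` otherwise involves sums of smaller weight only). -/
def relationRows (M : Set ℕ) (d : ℕ) : Submodule ℚ (QuasiShuffle ℚ) :=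
  Submodule.span ℚ {f | ∃ p : Multiset Word, 2 ≤ p.card ∧ (∀ w ∈ p, ∀ l ∈ w.1, l.a ∈ M) ∧
    (p.map fun w => weight w.1).sum = d ∧
    f = weightPart d (p.map fun w => word ℚ w.1).prod}

/-- `B` is a set of sums of weight `d` that remain after all reductions by the quasi-shuffle
relations: the words of `B` index the non-pivot columns of the reduced row echelon form of the
matrix of relations of weight `d`, for some order of the columns. Equivalently, the coordinate
space of the columns is the direct sum of the row space and of the span of `B`. -/
structure IsBasisSums (M : Set ℕ) (d : ℕ) (B : Set Word) : Prop where
  subset : B ⊆ wordsEq M d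
  disjoint : Disjoint (Submodule.span ℚ ((fun w : Word => word ℚ w.1) '' B)) (relationRows M d)
  sup_eq : Submodule.span ℚ ((fun w : Word => word ℚ w.1) '' B) ⊔ relationRows M d
    = Submodule.span ℚ ((fun w : Word => word ℚ w.1) '' wordsEq M d)

/-- `B k d` is a set of basis sums of weight `d` for the alphabet with `a ∈ {1, …, k}`, and these
sets grow with the alphabet. -/
structure IsBasisChoice (B : ℕ → ℕ → Set Word) : Prop where
  isBasisSums : ∀ k d, IsBasisSums (Set.Icc 1 k) d (B k d)
  mono : ∀ k d, B k d ⊆ B (k + 1) d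

/-- The generators of `Stage K k`: the basis sums of weight at most `k` with `a ∈ {1, …, k}`. -/
def stageGens (B : ℕ → ℕ → Set Word) (k : ℕ) : Set Word := ⋃ d ≤ k, B k d

/-- The generators that are new in step `k` (there are none for `k = 0`). -/
def newGens (B : ℕ → ℕ → Set Word) (k : ℕ) : Set Word := stageGens B k \ stageGens B (k - 1)

end CycSums

end

noncomputable section

/-! ### Weight filtration and the top-weight part of the quasi-shuffle product -/

namespace CycSums

/-! ### The weight filtration -/

/-! Everything is transported to sequences. Put R = K(n)[x]. Sending a word to its nested sum
extends to an R-linear map from the quasi-shuffle algebra to the ring of sequences, and it is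
multiplicative because each bracket is a partial fraction identity (`wordsToSeq_mul`). The analytic
core is that this map is injective (`wordsToSeq_injective`). Hence the ideal I is exactly the kernel
of evaluation on sequences (`mem_relIdeal_iff`), every E_k embeds compatibly with the shift, and the
injections into the limit, the automorphism, the embedding τ and the constants (a shift-invariant
germ is constant) follow.

Injectivity is shown by a minimality argument. R is not a field, but it is a simple difference ring:
from a nonzero r one obtains 1 as s r + σ(s r). So a relation f can be normalized to have
coefficient 1 at a word of maximal length; then σ(f) - f has fewer words of that length, so it
vanishes by induction and f is invariant. Its top coefficients are then constants, and the next
lower coefficients express a nonzero K-linear combination of letters as a telescoping difference in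
R. This is impossible by a pole argument (`not_telescoping`): the poles -b/a lie in (-1, 0], so no
two of them differ by a nonzero integer.

Freeness is proved over ℚ and then extended to R. In top weight only letters with the same (a, b)
merge, and the resulting graded product has a faithful model by functions on lists of points
(`gradedEval_injective`, `gradedEval_gradedMul`). Prepending a point acts on polynomials in the
basis words by a substitution that is the identity up to lower weight. A relation P of minimal
weighted degree is invariant under all of these substitutions, hence so is its derivative by a
generator of maximal weight among those in P; by minimality that derivative is constant. The linear
coefficients vanish because the span of the basis words meets the row space in 0, so in
characteristic 0 there is no such P (`algebraicIndependent_gradedSum`). Taking leading components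
carries this to the filtered algebra (`algebraicIndependent_word`), and induction on the weight
shows that the basis words generate (`exists_polynomial`).

Compatible choices exist because enlarging the alphabet creates no new relation between old words
(`mem_relationRows_of_mem_wordSpan`): deleting the points with a outside M from the lists gives a
multiplicative projection onto the words over M. -/

theorem weight_nil : weight [] = 0 := rfl

theorem weight_cons (l : Letter) (w : List Letter) : weight (l :: w) = l.c + weight w := by
  simp [weight]

theorem weight_pos (w : Word) : 0 < weight w.1 := by
  obtain ⟨w, hw⟩ := w
  cases w with
  | nil => exact absurd rfl hw
  | cons l w => rw [weight_cons]; exact Nat.add_pos_left l.c_pos _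

section
variable (F : Type*) [CommRing F]

/-- The span of all words of weight at most `d`. -/
def weightLE (d : ℕ) : Submodule F (QuasiShuffle F) :=
  Submodule.span F (word F '' {w | weight w ≤ d})

variable {F}

theorem word_mem_weightLE {w : List Letter} {d : ℕ} (h : weight w ≤ d) : word F w ∈ weightLE F d :=
  Submodule.subset_span ⟨w, h, rfl⟩

theorem weightLE_mono {d e : ℕ} (h : d ≤ e) : weightLE F d ≤ weightLE F e :=
  Submodule.span_mono (Set.image_mono fun _ hw => le_trans hw h)

theorem weightLE_le_of_words {d : ℕ} {N : Submodule F (QuasiShuffle F)}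
    (h : ∀ w, weight w ≤ d → word F w ∈ N) : weightLE F d ≤ N := by
  rw [weightLE, Submodule.span_le]
  rintro _ ⟨w, hw, rfl⟩
  exact h w hw

theorem cons_mem_weightLE (l : Letter) {x : QuasiShuffle F} {d e : ℕ} (hx : x ∈ weightLE F d)
    (h : l.c + d ≤ e) : cons F l x ∈ weightLE F e := by
  have : weightLE F d ≤ (weightLE F e).comap (cons F l) :=
    weightLE_le_of_words fun w hw => by
      rw [Submodule.mem_comap, cons_word]
      exact word_mem_weightLE (by rw [weight_cons]; omega)
  exact this hx

theorem consComb_eq_sum [Algebra ℚ F] (f : Letter →₀ ℚ) (x : QuasiShuffle F) :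
    consComb F f x = f.sum fun l q => q • cons F l x := by
  simp only [consComb, Finsupp.linearCombination_apply, Finsupp.sum, LinearMap.sum_apply,
    LinearMap.smul_apply]

theorem consComb_mem_weightLE [Algebra ℚ F] {f : Letter →₀ ℚ} {c d e : ℕ}
    (hf : ∀ m ∈ f.support, m.c ≤ c) {x : QuasiShuffle F} (hx : x ∈ weightLE F d) (h : c + d ≤ e) :
    consComb F f x ∈ weightLE F e := by
  rw [consComb_eq_sum]
  refine Submodule.sum_mem _ fun m hm => ?_
  change f m • cons F m x ∈ weightLE F e
  rw [← algebraMap_smul F]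
  refine Submodule.smul_mem _ _ (cons_mem_weightLE m hx ?_)
  have := hf m hm
  omega

/-- Each step of the recursion lowers one of the two exponents, so they never add up. For distinct
linear factors the bracket therefore has exponents strictly below the sum of the two, and it
disappears in top weight. -/
theorem partialFractions_support (l₁ l₂ : Letter) (z : ℤˣ) : ∀ (n c₁ c₂ : ℕ), c₁ + c₂ ≤ n →
    ∀ m ∈ (partialFractions l₁ l₂ z c₁ c₂).support, m.c ≤ max c₁ c₂ := by
  classical
  intro n
  induction n with
  | zero =>
    intro c₁ c₂ h m hm
    obtain ⟨rfl, rfl⟩ : c₁ = 0 ∧ c₂ = 0 := by omega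
    simp [partialFractions] at hm
  | succ n ih =>
    intro c₁ c₂ h m hm
    match c₁, c₂ with
    | 0, 0 => simp [partialFractions] at hm
    | c₁ + 1, 0 =>
      rw [partialFractions] at hm
      have := Finset.mem_singleton.1 (Finsupp.support_single_subset hm)
      simp [this, Letter.withExp]
    | 0, c₂ + 1 =>
      rw [partialFractions] at hm
      have := Finset.mem_singleton.1 (Finsupp.support_single_subset hm)
      simp [this, Letter.withExp]
    | c₁ + 1, c₂ + 1 =>
      rw [partialFractions] at hm
      have h1 := Finsupp.support_sub (Finsupp.support_smul hm)
      rcases Finset.mem_union.1 h1 with h2 | h2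
      · have := ih (c₁ + 1) c₂ (by omega) m (Finsupp.support_smul h2)
        omega
      · have := ih c₁ (c₂ + 1) (by omega) m (Finsupp.support_smul h2)
        omega

theorem bracket_support (l₁ l₂ : Letter) : ∀ m ∈ (bracket l₁ l₂).support, m.c ≤ l₁.c + l₂.c := by
  intro m hm
  unfold bracket at hm
  split_ifs at hm with h
  · have := Finset.mem_singleton.1 (Finsupp.support_single_subset hm)
    simp [this, Letter.withExp]
  · have := partialFractions_support l₁ l₂ _ _ _ _ le_rfl m hm
    omega

theorem mulWord_mem_weightLE [Algebra ℚ F] (u v : List Letter) :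
    mulWord F u v ∈ weightLE F (weight u + weight v) := by
  match u, v with
  | [], v => rw [mulWord]; exact word_mem_weightLE (by simp)
  | l₁ :: u, [] => rw [mulWord]; exact word_mem_weightLE (by simp)
  | l₁ :: u, l₂ :: v =>
    rw [mulWord]
    have h1 := weight_cons l₁ u
    have h2 := weight_cons l₂ v
    refine sub_mem (add_mem ?_ ?_) ?_
    · exact cons_mem_weightLE _ (mulWord_mem_weightLE u (l₂ :: v)) (by omega)
    · exact cons_mem_weightLE _ (mulWord_mem_weightLE (l₁ :: u) v) (by omega)
    · exact consComb_mem_weightLE (bracket_support _ _) (mulWord_mem_weightLE u v) (by omega)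
termination_by u.length + v.length

theorem word_mul_word [Algebra ℚ F] (u v : List Letter) : word F u * word F v = mulWord F u v :=
  mulLin_word u v

theorem one_eq_word [Algebra ℚ F] : (1 : QuasiShuffle F) = word F [] := rfl

theorem mul_mem_weightLE [Algebra ℚ F] {x y : QuasiShuffle F} {d e : ℕ} (hx : x ∈ weightLE F d)
    (hy : y ∈ weightLE F e) : x * y ∈ weightLE F (d + e) := by
  have h1 : ∀ u, weight u ≤ d → word F u * y ∈ weightLE F (d + e) := by
    intro u hu
    have : weightLE F e ≤ (weightLE F (d + e)).comap (mulLin F (word F u)) :=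
      weightLE_le_of_words fun v hv => by
        rw [Submodule.mem_comap, mulLin_word]
        exact weightLE_mono (by omega) (mulWord_mem_weightLE u v)
    exact this hy
  have : weightLE F d ≤ (weightLE F (d + e)).comap ((mulLin F).flip y) :=
    weightLE_le_of_words fun u hu => h1 u hu
  exact this hx

/-! ### Change of coefficients -/

variable (F) [Algebra ℚ F]

/-- The `ℚ`-linear map that sends each word over `ℚ` to the same word over `F`. -/
def extendScalars : QuasiShuffle ℚ →ₗ[ℚ] QuasiShuffle F :=
  (wordBasis ℚ).constr ℚ (word F)

variable {F}

theorem extendScalars_word (w : List Letter) : extendScalars F (word ℚ w) = word F w := by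
  simp only [extendScalars, word, Module.Basis.constr_basis]

theorem extendScalars_cons (l : Letter) (x : QuasiShuffle ℚ) :
    extendScalars F (cons ℚ l x) = cons F l (extendScalars F x) := by
  have h : (extendScalars F).comp (cons ℚ l)
      = ((cons F l).restrictScalars ℚ).comp (extendScalars F) :=
    hom_ext_word fun w => by
      simp only [LinearMap.comp_apply, cons_word, extendScalars_word,
        LinearMap.restrictScalars_apply]
  exact LinearMap.congr_fun h x

/-- Brackets have rational coefficients, so products of words are defined over ℚ. The combinatorics
can thus be done over ℚ, and K(n)[x] enters only at the end. -/
theorem extendScalars_mulWord (u v : List Letter) :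
    extendScalars F (mulWord ℚ u v) = mulWord F u v := by
  match u, v with
  | [], v => rw [mulWord, mulWord, extendScalars_word]
  | l₁ :: u, [] => rw [mulWord, mulWord, extendScalars_word]
  | l₁ :: u, l₂ :: v =>
    rw [mulWord, mulWord, map_sub, map_add, extendScalars_cons, extendScalars_cons,
      extendScalars_mulWord u (l₂ :: v), extendScalars_mulWord (l₁ :: u) v,
      ← extendScalars_mulWord u v, consComb_eq_sum, consComb_eq_sum]
    simp only [Finsupp.sum, map_sum, map_smul, extendScalars_cons]
termination_by u.length + v.length

theorem map_mul_of_words {F A : Type*} [CommRing F] [Algebra ℚ F] [CommRing A] [Algebra F A]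
    (T : QuasiShuffle F →ₗ[F] A)
    (h : ∀ u v, T (mulWord F u v) = T (word F u) * T (word F v)) (x y : QuasiShuffle F) :
    T (x * y) = T x * T y := by
  have : (mulLin F).compr₂ T = (LinearMap.mul F A).compl₁₂ T T :=
    hom_ext_word fun u => hom_ext_word fun v => by
      simp only [LinearMap.compr₂_apply, LinearMap.compl₁₂_apply, mulLin_word, h,
        LinearMap.mul_apply']
  exact LinearMap.congr_fun (LinearMap.congr_fun this x) y

theorem extendScalars_mul (x y : QuasiShuffle ℚ) :
    extendScalars F (x * y) = extendScalars F x * extendScalars F y := by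
  have : (mulLin ℚ).compr₂ (extendScalars F)
      = (LinearMap.mul ℚ (QuasiShuffle F)).compl₁₂ (extendScalars F) (extendScalars F) :=
    hom_ext_word fun u => hom_ext_word fun v => by
      simp only [LinearMap.compr₂_apply, LinearMap.compl₁₂_apply, mulLin_word,
        extendScalars_mulWord, LinearMap.mul_apply', extendScalars_word, word_mul_word]
  exact LinearMap.congr_fun (LinearMap.congr_fun this x) y

end

/-! ### The graded quasi-shuffle product -/

theorem weightPart_word (d : ℕ) (w : List Letter) :
    weightPart d (word ℚ w) = if weight w = d then word ℚ w else 0 := by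
  simp only [weightPart, word, Module.Basis.constr_basis]

theorem weightPart_of_mem_weightLE {x : QuasiShuffle ℚ} {d e : ℕ} (hx : x ∈ weightLE ℚ d)
    (h : d < e) : weightPart e x = 0 := by
  have : weightLE ℚ d ≤ LinearMap.ker (weightPart e) :=
    weightLE_le_of_words fun w hw => by
      rw [LinearMap.mem_ker, weightPart_word, if_neg (by omega)]
  exact this hx

theorem sub_weightPart_mem {x : QuasiShuffle ℚ} {d : ℕ} (hx : x ∈ weightLE ℚ (d + 1)) :
    x - weightPart (d + 1) x ∈ weightLE ℚ d := by
  have : weightLE ℚ (d + 1) ≤ (weightLE ℚ d).comap (LinearMap.id - weightPart (d + 1)) :=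
    weightLE_le_of_words fun w hw => by
      simp only [Submodule.mem_comap, LinearMap.sub_apply, LinearMap.id_apply, weightPart_word]
      split_ifs with h
      · simp
      · rw [sub_zero]; exact word_mem_weightLE (by omega)
  exact this hx

theorem weightPart_cons (l : Letter) (d : ℕ) (x : QuasiShuffle ℚ) :
    weightPart (l.c + d) (cons ℚ l x) = cons ℚ l (weightPart d x) := by
  have : (weightPart (l.c + d)).comp (cons ℚ l) = (cons ℚ l).comp (weightPart d) :=
    hom_ext_word fun w => by
      simp only [LinearMap.comp_apply, cons_word, weightPart_word, weight_cons, add_right_inj]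
      split_ifs with h
      · rw [cons_word]
      · rw [map_zero]
  exact LinearMap.congr_fun this x

theorem weightPart_weightPart (d e : ℕ) (x : QuasiShuffle ℚ) :
    weightPart d (weightPart e x) = if d = e then weightPart e x else 0 := by
  have : (weightPart d).comp (weightPart e) = if d = e then weightPart e else 0 :=
    hom_ext_word fun w => by
      rw [LinearMap.comp_apply, weightPart_word]
      split_ifs with h1 h2 h2
      · rw [weightPart_word, weightPart_word, if_pos (by omega), if_pos h1]
      · rw [weightPart_word, if_neg (by omega), LinearMap.zero_apply]
      · rw [weightPart_word, if_neg h1, map_zero]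
      · rw [map_zero, LinearMap.zero_apply]
  have h := LinearMap.congr_fun this x
  rw [LinearMap.comp_apply] at h
  rw [h]
  split_ifs <;> rfl

open Classical in
/-- The part of top weight of the bracket. -/
def gradedBracket (l₁ l₂ : Letter) : Letter →₀ ℚ :=
  if l₁.a = l₂.a ∧ l₁.b = l₂.b then
    Finsupp.single (l₁.withExp (l₁.c + l₂.c) (l₁.z * l₂.z) (Nat.add_pos_left l₁.c_pos _)) 1
  else 0

/-- The part of top weight of the quasi-shuffle product of two words. -/
def gradedMul (u v : List Letter) : QuasiShuffle ℚ :=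
  weightPart (weight u + weight v) (mulWord ℚ u v)

theorem gradedMul_nil (v : List Letter) : gradedMul [] v = word ℚ v := by
  rw [gradedMul, mulWord, weightPart_word, if_pos (by simp [weight_nil])]

theorem gradedMul_cons_nil (l : Letter) (u : List Letter) :
    gradedMul (l :: u) [] = word ℚ (l :: u) := by
  rw [gradedMul, mulWord, weightPart_word, if_pos (by simp [weight_nil])]

/-- Partial fractions of two different linear factors have exponents at most `max l₁.c l₂.c`, so
only the merging of letters with the same `(a, b)` survives in top weight. -/
theorem weightPart_consComb_bracket (l₁ l₂ : Letter) {x : QuasiShuffle ℚ} {d : ℕ}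
    (hx : x ∈ weightLE ℚ d) : weightPart (l₁.c + l₂.c + d) (consComb ℚ (bracket l₁ l₂) x)
      = consComb ℚ (gradedBracket l₁ l₂) (weightPart d x) := by
  unfold bracket gradedBracket
  split_ifs with h
  · rw [consComb_single, one_smul, ← weightPart_cons]
    rfl
  · rw [map_zero, LinearMap.zero_apply]
    have h1 := l₁.c_pos
    have h2 := l₂.c_pos
    refine weightPart_of_mem_weightLE (consComb_mem_weightLE (c := max l₁.c l₂.c)
      (partialFractions_support l₁ l₂ _ _ _ _ le_rfl) hx le_rfl) (by omega)

theorem gradedMul_cons_cons (l₁ l₂ : Letter) (u v : List Letter) :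
    gradedMul (l₁ :: u) (l₂ :: v) = cons ℚ l₁ (gradedMul u (l₂ :: v))
      + cons ℚ l₂ (gradedMul (l₁ :: u) v)
      - consComb ℚ (gradedBracket l₁ l₂) (gradedMul u v) := by
  simp only [gradedMul]
  rw [mulWord, map_sub, map_add, ← weightPart_cons, ← weightPart_cons,
    ← weightPart_consComb_bracket _ _ (mulWord_mem_weightLE u v)]
  have e1 : l₁.c + (weight u + weight (l₂ :: v)) = weight (l₁ :: u) + weight (l₂ :: v) := by
    simp only [weight_cons]; ring
  have e2 : l₂.c + (weight (l₁ :: u) + weight v) = weight (l₁ :: u) + weight (l₂ :: v) := by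
    simp only [weight_cons]; ring
  have e3 : l₁.c + l₂.c + (weight u + weight v) = weight (l₁ :: u) + weight (l₂ :: v) := by
    simp only [weight_cons]; ring
  rw [e1, e2, e3]

/-! ### One step of a nested summation is multiplicative -/

/-- `T` and `T'` stand for evaluation before and after one more summand. The product of `T (l₁ u) +
lam l₁ * T' u` and `T (l₂ v) + lam l₂ * T' v` has exactly the shape of the quasi-shuffle recursion,
the bracket accounting for the diagonal term that is counted twice. It serves both for nested sums
and for the graded model. -/
theorem mul_step {V : Type*} [CommRing V] [Algebra ℚ V]
    (br : Letter → Letter → (Letter →₀ ℚ)) (m : List Letter → List Letter → QuasiShuffle ℚ)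
    (nil_m : ∀ v, m [] v = word ℚ v) (m_nil : ∀ l u, m (l :: u) [] = word ℚ (l :: u))
    (m_cons : ∀ l₁ l₂ u v, m (l₁ :: u) (l₂ :: v) = cons ℚ l₁ (m u (l₂ :: v))
      + cons ℚ l₂ (m (l₁ :: u) v) - consComb ℚ (br l₁ l₂) (m u v))
    (lam : Letter → V) (hlam : ∀ l₁ l₂, (br l₁ l₂).sum (fun l q => q • lam l) = lam l₁ * lam l₂)
    (T T' : QuasiShuffle ℚ →ₗ[ℚ] V) (hT' : T' (word ℚ []) = 1)
    (step : ∀ l x, T' (cons ℚ l x) = T (cons ℚ l x) + lam l * T' x)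
    (hmul : ∀ u v, T (m u v) = T (word ℚ u) * T (word ℚ v)) (u v : List Letter) :
    T' (m u v) = T' (word ℚ u) * T' (word ℚ v) := by
  have stepComb : ∀ f x, T' (consComb ℚ f x)
      = T (consComb ℚ f x) + f.sum (fun l q => q • lam l) * T' x := by
    intro f x
    rw [consComb_eq_sum]
    simp only [Finsupp.sum, map_sum, map_smul, step, smul_add, Finset.sum_add_distrib,
      Finset.sum_mul, smul_mul_assoc]
  match u, v with
  | [], v => rw [nil_m, hT', one_mul]
  | l₁ :: u, [] => rw [m_nil, hT', mul_one]
  | l₁ :: u, l₂ :: v =>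
    have h := hmul (l₁ :: u) (l₂ :: v)
    rw [m_cons, map_sub, map_add] at h
    rw [m_cons, map_sub, map_add, step, step, stepComb, hlam,
      mul_step br m nil_m m_nil m_cons lam hlam T T' hT' step hmul u (l₂ :: v),
      mul_step br m nil_m m_nil m_cons lam hlam T T' hT' step hmul (l₁ :: u) v,
      mul_step br m nil_m m_nil m_cons lam hlam T T' hT' step hmul u v]
    simp only [← cons_word, step] at h ⊢
    linear_combination h
termination_by u.length + v.length

end CycSums

/-! ### Formal shifts, and a faithful model of the graded product -/

namespace CycSums

/-! ### Formal shifts of linear combinations of words -/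

section
variable {F : Type*} [CommRing F]

/-- The coefficient of a word. -/
def wordCoeff (w : List Letter) : QuasiShuffle F →ₗ[F] F := (wordBasis F).coord w

open Classical in
theorem wordCoeff_word (u w : List Letter) : wordCoeff u (word F w) = if w = u then 1 else 0 := by
  rw [wordCoeff, Module.Basis.coord_apply, word, Module.Basis.repr_self, Finsupp.single_apply]

theorem ext_wordCoeff {f g : QuasiShuffle F} (h : ∀ w, wordCoeff w f = wordCoeff w g) : f = g :=
  (wordBasis F).ext_elem h

/-- The words that occur in a linear combination. -/
def wordSupport (f : QuasiShuffle F) : Finset (List Letter) := ((wordBasis F).repr f).support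

theorem mem_wordSupport {f : QuasiShuffle F} {w : List Letter} :
    w ∈ wordSupport f ↔ wordCoeff w f ≠ 0 := Finsupp.mem_support_iff

theorem sum_wordSupport (f : QuasiShuffle F) :
    ∑ w ∈ wordSupport f, wordCoeff w f • word F w = f := by
  conv_rhs => rw [← (wordBasis F).linearCombination_repr f]
  rfl

theorem exists_length_le (f : QuasiShuffle F) :
    ∃ m : ℕ, ∀ w, m < w.length → wordCoeff w f = 0 := by
  refine ⟨(wordSupport f).sup List.length, fun w hw => ?_⟩
  by_contra h
  exact absurd (Finset.le_sup (f := List.length) (mem_wordSupport.2 h)) (not_le.2 hw)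

/-- The formal shift of a word, for the values `μ` of the shifted letters. -/
def shiftWordBy (μ : Letter → F) : List Letter → QuasiShuffle F
  | [] => word F []
  | l :: w => word F (l :: w) + μ l • shiftWordBy μ w

/-- The formal shift, semilinear with respect to `σ`. -/
def formalShift (σ : F →+* F) (μ : Letter → F) (f : QuasiShuffle F) : QuasiShuffle F :=
  ∑ w ∈ wordSupport f, σ (wordCoeff w f) • shiftWordBy μ w

/-- The shift of a word adds only proper suffixes of it, which are shorter. -/
theorem wordCoeff_shiftWordBy_of_le (μ : Letter → F) {u : List Letter} : ∀ {w : List Letter},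
    w.length ≤ u.length → wordCoeff u (shiftWordBy μ w) = wordCoeff u (word F w)
  | [], _ => rfl
  | l :: w, h => by
    rw [List.length_cons] at h
    rw [shiftWordBy, map_add, map_smul, wordCoeff_shiftWordBy_of_le μ (by omega),
      wordCoeff_word u w,
      if_neg (by rintro rfl; omega), smul_zero, add_zero]

theorem wordCoeff_formalShift (σ : F →+* F) (μ : Letter → F) (f : QuasiShuffle F)
    (u : List Letter) :
    wordCoeff u (formalShift σ μ f)
      = ∑ w ∈ wordSupport f, σ (wordCoeff w f) * wordCoeff u (shiftWordBy μ w) := by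
  simp only [formalShift, map_sum, map_smul, smul_eq_mul]

theorem sum_wordCoeff_word (σ : F →+* F) (f : QuasiShuffle F) (u : List Letter) :
    ∑ w ∈ wordSupport f, σ (wordCoeff w f) * wordCoeff u (word F w) = σ (wordCoeff u f) := by
  rw [Finset.sum_eq_single u]
  · rw [wordCoeff_word, if_pos rfl, mul_one]
  · intro w _ h
    rw [wordCoeff_word, if_neg h, mul_zero]
  · intro h
    rw [mem_wordSupport, not_not] at h
    rw [h, map_zero, zero_mul]

theorem wordCoeff_formalShift_of_length_le (σ : F →+* F) (μ : Letter → F) {f : QuasiShuffle F}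
    {u : List Letter} (h : ∀ w, u.length < w.length → wordCoeff w f = 0) :
    wordCoeff u (formalShift σ μ f) = σ (wordCoeff u f) := by
  rw [wordCoeff_formalShift, ← sum_wordCoeff_word]
  refine Finset.sum_congr rfl fun w hw => ?_
  rw [wordCoeff_shiftWordBy_of_le]
  by_contra h'
  exact mem_wordSupport.1 hw (h w (by omega))

/-- The coefficients of the words `l :: u`. -/
def headCoeff (u : List Letter) (f : QuasiShuffle F) : Letter →₀ F :=
  Finsupp.comapDomain (fun l => l :: u) ((wordBasis F).repr f)
    (fun _ _ _ _ h => (List.cons.inj h).1)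

theorem headCoeff_apply (u : List Letter) (f : QuasiShuffle F) (l : Letter) :
    headCoeff u f l = wordCoeff (l :: u) f := rfl

/-- Among the words of length `u.length + 1`, only those of the form `l :: u` reach `u`, by losing
their first letter. For an invariant `f` this becomes a telescoping equation for the letters. -/
theorem wordCoeff_formalShift_of_length_le_succ (σ : F →+* F) (μ : Letter → F) {f : QuasiShuffle F}
    {u : List Letter} (h : ∀ w, u.length + 1 < w.length → wordCoeff w f = 0) :
    wordCoeff u (formalShift σ μ f)
      = σ (wordCoeff u f) + (headCoeff u f).sum fun l r => σ r * μ l := by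
  classical
  -- The contribution to the coefficient of `u` that comes from dropping the first letter.
  let η : List Letter → F := fun w => match w with
    | [] => 0
    | l :: v => if v = u then μ l else 0
  have h1 : ∀ w ∈ wordSupport f, σ (wordCoeff w f) * wordCoeff u (shiftWordBy μ w)
      = σ (wordCoeff w f) * wordCoeff u (word F w) + σ (wordCoeff w f) * η w := by
    intro w hw
    rw [← mul_add]
    congr 1
    match w with
    | [] => simp [shiftWordBy, η]
    | l :: v =>
      have hv : v.length ≤ u.length := by
        by_contra h'
        exact mem_wordSupport.1 hw (h _ (by rw [List.length_cons]; omega))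
      simp only [η, shiftWordBy, map_add, map_smul, wordCoeff_shiftWordBy_of_le μ hv,
        wordCoeff_word u v]
      split_ifs <;> simp
  rw [wordCoeff_formalShift, Finset.sum_congr rfl h1, Finset.sum_add_distrib, sum_wordCoeff_word]
  congr 1
  symm
  refine Finset.sum_of_injOn (fun l => l :: u) (fun _ _ _ _ h => (List.cons.inj h).1) ?_ ?_ ?_
  · intro l hl
    have := Finsupp.mem_support_iff.1 hl
    exact mem_wordSupport.2 this
  · intro w hw hne
    match w with
    | [] => simp [η]
    | l :: v =>
      simp only [η]
      split_ifs with hv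
      · subst hv
        exact absurd ⟨l, Finsupp.mem_support_iff.2 (mem_wordSupport.1 hw), rfl⟩ hne
      · rw [mul_zero]
  · intro l _
    simp only [η, if_true, headCoeff_apply]

end

/-! ### A model of the graded quasi-shuffle product by functions -/

/-- The multiplicative character `(y, ζ) ↦ y ^ c ζ ^ ((1 - z) / 2)` of a letter. -/
def letterChar (l : Letter) : ℚ × ℤˣ →* ℚ where
  toFun δ := δ.1 ^ l.c * if l.z = 1 then 1 else ((δ.2 : ℤ) : ℚ)
  map_one' := by simp
  map_mul' δ ε := by
    split_ifs
    · simp [mul_pow]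
    · simp only [Prod.fst_mul, Prod.snd_mul, mul_pow, Units.val_mul, Int.cast_mul]; ring

/-- The points at which the letters of the graded model are evaluated. -/
abbrev Datum : Type := (ℕ × ℕ) × (ℚ × ℤˣ)

/-- The value of a letter in the graded model. -/
def gradedLambda (l : Letter) (δ : Datum) : ℚ :=
  if l.a = δ.1.1 ∧ l.b = δ.1.2 then letterChar l δ.2 else 0

theorem letterChar_injOn {l m : Letter} (ha : l.a = m.a) (hb : l.b = m.b)
    (h : letterChar l = letterChar m) : l = m := by
  -- The point `(2, 1)` detects the exponent and `(1, -1)` detects the sign.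
  have h1 := DFunLike.congr_fun h (2, 1)
  have h2 := DFunLike.congr_fun h (1, -1)
  simp only [letterChar, MonoidHom.coe_mk, OneHom.coe_mk, Units.val_one, Int.cast_one, ite_self,
    mul_one, one_pow, one_mul, Units.val_neg, Int.cast_neg] at h1 h2
  have hc : l.c = m.c := Nat.pow_right_injective le_rfl (by exact_mod_cast h1)
  have hz : l.z = m.z := by
    rcases Int.units_eq_one_or l.z with e1 | e1 <;> rcases Int.units_eq_one_or m.z with e2 | e2 <;>
      rw [e1, e2] <;> rw [e1, e2] at h2 <;> norm_num at h2
  cases l; cases m; simp_all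

/-- The points over a fixed pair `(a, b)` see only the letters with that pair, and these are
distinct multiplicative characters, so Dedekind's independence of characters applies. -/
theorem gradedLambda_independent {c : Letter →₀ ℚ}
    (h : ∀ δ, (c.sum fun l r => r * gradedLambda l δ) = 0) : c = 0 := by
  classical
  ext l₀
  rw [Finsupp.zero_apply]
  by_contra hl
  let P : Letter → Prop := fun l => l.a = l₀.a ∧ l.b = l₀.b
  have hinj : Function.Injective (fun l : {l // P l} => letterChar l.1) := fun l m hlm =>
    Subtype.ext (letterChar_injOn (l.2.1.trans m.2.1.symm) (l.2.2.trans m.2.2.symm) hlm)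
  have hind := (linearIndependent_monoidHom (ℚ × ℤˣ) ℚ).comp _ hinj
  rw [linearIndependent_iff'] at hind
  refine hl (hind (c.support.subtype P) (fun l => c l.1) ?_ ⟨l₀, rfl, rfl⟩ (by simpa using hl))
  funext x
  have h1 := h ((l₀.a, l₀.b), x)
  rw [Finsupp.sum] at h1
  simp only [Finset.sum_apply, Pi.smul_apply, Function.comp_apply, smul_eq_mul, Pi.zero_apply]
  rw [← h1, Finset.sum_subtype_eq_sum_filter (f := fun l => c l * letterChar l x),
    Finset.sum_filter]
  refine Finset.sum_congr rfl fun l _ => ?_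
  simp only [gradedLambda, P]
  split_ifs <;> simp

/-- Letters with the same `(a, b)` multiply as characters; letters with different pairs have
disjoint supports, in accordance with their zero bracket. -/
theorem gradedBracket_sum (δ : Datum) (l₁ l₂ : Letter) :
    ((gradedBracket l₁ l₂).sum fun l q => q • gradedLambda l δ)
      = gradedLambda l₁ δ * gradedLambda l₂ δ := by
  unfold gradedBracket
  split_ifs with h
  · rw [Finsupp.sum_single_index (by simp)]
    simp only [gradedLambda, Letter.withExp, one_smul, ← h.1, ← h.2]
    by_cases h' : l₁.a = δ.1.1 ∧ l₁.b = δ.1.2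
    · simp only [if_pos h', letterChar, MonoidHom.coe_mk, OneHom.coe_mk, pow_add]
      rcases Int.units_eq_one_or l₁.z with e1 | e1 <;>
        rcases Int.units_eq_one_or l₂.z with e2 | e2 <;>
        rcases Int.units_eq_one_or δ.2.2 with e3 | e3 <;> simp [e1, e2, e3]
    · rw [if_neg h', zero_mul]
      exact if_neg h'
  · rw [Finsupp.sum_zero_index]
    simp only [gradedLambda]
    split_ifs with h1 h2 <;> simp
    exact absurd ⟨h1.1.trans h2.1.symm, h1.2.trans h2.2.symm⟩ h

/-- The nested sum of a word over a list of points. -/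
def gradedSum : List Letter → List Datum → ℚ
  | [], _ => 1
  | _ :: _, [] => 0
  | l :: w, δ :: L => gradedSum (l :: w) L + gradedLambda l δ * gradedSum w (δ :: L)
termination_by w L => w.length + L.length

/-- The linear extension of `gradedSum`. -/
def gradedEval : QuasiShuffle ℚ →ₗ[ℚ] (List Datum → ℚ) := (wordBasis ℚ).constr ℚ gradedSum

theorem gradedEval_word (w : List Letter) : gradedEval (word ℚ w) = gradedSum w := by
  simp only [gradedEval, word, Module.Basis.constr_basis]

theorem gradedEval_nil : gradedEval (word ℚ []) = 1 := by
  rw [gradedEval_word]; funext L; rw [gradedSum]; rfl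

theorem gradedEval_cons_nil (l : Letter) (x : QuasiShuffle ℚ) : gradedEval (cons ℚ l x) [] = 0 := by
  have : (LinearMap.proj []).comp (gradedEval.comp (cons ℚ l)) = 0 :=
    hom_ext_word fun w => by
      simp only [LinearMap.comp_apply, cons_word, gradedEval_word, LinearMap.proj_apply,
        LinearMap.zero_apply]
      rw [gradedSum]
  exact LinearMap.congr_fun this x

theorem gradedEval_cons_cons (l : Letter) (x : QuasiShuffle ℚ) (δ : Datum) (L : List Datum) :
    gradedEval (cons ℚ l x) (δ :: L)
      = gradedEval (cons ℚ l x) L + gradedLambda l δ * gradedEval x (δ :: L) := by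
  have : (LinearMap.proj (δ :: L)).comp (gradedEval.comp (cons ℚ l))
      = (LinearMap.proj L).comp (gradedEval.comp (cons ℚ l))
        + gradedLambda l δ • (LinearMap.proj (δ :: L)).comp gradedEval :=
    hom_ext_word fun w => by
      simp only [LinearMap.comp_apply, cons_word, gradedEval_word, LinearMap.proj_apply,
        LinearMap.add_apply, LinearMap.smul_apply, smul_eq_mul]
      rw [gradedSum]
  exact LinearMap.congr_fun this x

/-- Prepending a point to the list is one summation step, so `mul_step` gives the claim by induction
on the list. The graded product thus becomes the pointwise product of functions. -/
theorem gradedEval_gradedMul (u v : List Letter) :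
    gradedEval (gradedMul u v) = gradedEval (word ℚ u) * gradedEval (word ℚ v) := by
  have key : ∀ (L : List Datum) (u v : List Letter), gradedEval (gradedMul u v) L
      = gradedEval (word ℚ u) L * gradedEval (word ℚ v) L := by
    intro L
    induction L with
    | nil =>
      intro u v
      match u, v with
      | [], v => rw [gradedMul_nil, gradedEval_nil]; simp
      | l :: u, [] => rw [gradedMul_cons_nil, gradedEval_nil]; simp
      | l₁ :: u, l₂ :: v =>
        rw [gradedMul_cons_cons, ← cons_word, gradedEval_cons_nil, zero_mul, map_sub, map_add,
          Pi.sub_apply, Pi.add_apply, gradedEval_cons_nil, gradedEval_cons_nil, consComb_eq_sum,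
          Finsupp.sum, map_sum, Finset.sum_apply, Finset.sum_eq_zero]
        · simp
        · intro l _
          rw [map_smul, Pi.smul_apply, gradedEval_cons_nil, smul_zero]
    | cons δ L ih =>
      refine mul_step gradedBracket gradedMul gradedMul_nil gradedMul_cons_nil gradedMul_cons_cons
        (fun l => gradedLambda l δ) (gradedBracket_sum δ) ((LinearMap.proj L).comp gradedEval)
        ((LinearMap.proj (δ :: L)).comp gradedEval) ?_ ?_ ih
      · rw [LinearMap.comp_apply, gradedEval_nil]; rfl
      · intro l x
        exact gradedEval_cons_cons l x δ L
  funext L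
  exact key L u v

theorem gradedEval_weightPart_mul (u : List Letter) {x : QuasiShuffle ℚ} {d : ℕ}
    (hx : x ∈ weightLE ℚ d) : gradedEval (weightPart (weight u + d) (word ℚ u * x))
      = gradedEval (word ℚ u) * gradedEval (weightPart d x) := by
  have : weightLE ℚ d ≤ LinearMap.eqLocus
      (gradedEval.comp ((weightPart (weight u + d)).comp (mulLin ℚ (word ℚ u))))
      ((LinearMap.mul ℚ _ (gradedEval (word ℚ u))).comp (gradedEval.comp (weightPart d))) :=
    weightLE_le_of_words fun v hv => by
      simp only [LinearMap.mem_eqLocus, LinearMap.comp_apply, mulLin_word, LinearMap.mul_apply',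
        weightPart_word]
      split_ifs with h
      · rw [← h, ← gradedEval_gradedMul, gradedMul]
      · rw [weightPart_of_mem_weightLE (mulWord_mem_weightLE u v) (by omega), map_zero, mul_zero]
  exact this hx

theorem prod_word_mem_weightLE {F : Type*} [CommRing F] [Algebra ℚ F] (p : Multiset Word) :
    (p.map fun w => word F w.1).prod ∈ weightLE F (p.map fun w => weight w.1).sum := by
  induction p using Multiset.induction with
  | empty => exact word_mem_weightLE le_rfl
  | cons w p ih =>
    simp only [Multiset.map_cons, Multiset.prod_cons, Multiset.sum_cons]
    exact mul_mem_weightLE (word_mem_weightLE le_rfl) ih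

theorem gradedEval_weightPart_prod (p : Multiset Word) :
    gradedEval (weightPart (p.map fun w => weight w.1).sum (p.map fun w => word ℚ w.1).prod)
      = (p.map fun w => gradedSum w.1).prod := by
  induction p using Multiset.induction with
  | empty =>
    rw [Multiset.map_zero, Multiset.map_zero, Multiset.map_zero, Multiset.prod_zero,
      Multiset.sum_zero, Multiset.prod_zero, one_eq_word, weightPart_word, if_pos weight_nil,
      gradedEval_nil]
  | cons w p ih =>
    simp only [Multiset.map_cons, Multiset.prod_cons, Multiset.sum_cons]
    rw [gradedEval_weightPart_mul _ (prod_word_mem_weightLE p), ih, gradedEval_word]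

theorem gradedEval_shiftWordBy (δ : Datum) (L : List Datum) (w : List Letter) :
    gradedEval (shiftWordBy (fun l => gradedLambda l δ) w) L = gradedSum w (δ :: L) := by
  induction w with
  | nil => rw [shiftWordBy, gradedEval_word, gradedSum, gradedSum]
  | cons l w ih =>
    rw [shiftWordBy, map_add, map_smul, Pi.add_apply, Pi.smul_apply, ih, gradedEval_word,
      smul_eq_mul]
    conv_rhs => rw [gradedSum]

theorem gradedEval_formalShift (δ : Datum) (L : List Datum) (f : QuasiShuffle ℚ) :
    gradedEval (formalShift (RingHom.id ℚ) (fun l => gradedLambda l δ) f) L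
      = gradedEval f (δ :: L) := by
  conv_rhs => rw [← sum_wordSupport f]
  simp only [formalShift, map_sum, map_smul, Finset.sum_apply, Pi.smul_apply,
    gradedEval_shiftWordBy, RingHom.id_apply, gradedEval_word]

/-- Induction on the maximal length of the words. Prepending a point changes `f` only by shorter
words, so the change is zero by induction; its coefficients one length below the top are
combinations of letter values, and independence of the letters kills the top coefficients. -/
theorem gradedEval_eq_zero {f : QuasiShuffle ℚ} (h : gradedEval f = 0) : f = 0 := by
  have key : ∀ (m : ℕ) (f : QuasiShuffle ℚ), (∀ w, m < w.length → wordCoeff w f = 0) →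
      gradedEval f = 0 → f = 0 := by
    intro m
    induction m with
    | zero =>
      intro f hf h
      have h1 : f = wordCoeff [] f • word ℚ [] := ext_wordCoeff fun w => by
        rw [map_smul, wordCoeff_word]
        split_ifs with hw
        · rw [← hw, smul_eq_mul, mul_one]
        · rw [smul_zero]
          exact hf w (List.length_pos_iff.2 (Ne.symm hw))
      rw [h1, map_smul, gradedEval_nil] at h
      have := congrFun h []
      rw [Pi.smul_apply, Pi.one_apply, Pi.zero_apply, smul_eq_mul, mul_one] at this
      rw [h1, this, zero_smul]
    | succ m ih =>
      intro f hf h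
      refine ih f (fun w hw => ?_) h
      rcases Nat.lt_or_ge (m + 1) w.length with h1 | h1
      · exact hf w h1
      obtain ⟨l, u, rfl⟩ := List.exists_cons_of_length_pos (Nat.zero_lt_of_lt hw)
      have hu : u.length = m := by rw [List.length_cons] at *; omega
      rw [← headCoeff_apply, gradedLambda_independent (c := headCoeff u f), Finsupp.zero_apply]
      intro δ
      -- Top-length words cancel in the difference, and it evaluates to zero because `f` does.
      have h2 : formalShift (RingHom.id ℚ) (fun l => gradedLambda l δ) f - f = 0 := by
        refine ih _ (fun v hv => ?_) ?_
        · rw [map_sub, wordCoeff_formalShift_of_length_le, RingHom.id_apply, sub_self]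
          intro v' hv'
          exact hf v' (by omega)
        · funext L
          rw [map_sub, Pi.sub_apply, gradedEval_formalShift, h]
          simp
      have h3 := congrArg (wordCoeff u) h2
      rw [map_sub, wordCoeff_formalShift_of_length_le_succ, map_zero, RingHom.id_apply,
        add_sub_cancel_left] at h3
      · exact h3
      · intro v hv
        exact hf v (by omega)
  obtain ⟨m, hm⟩ := exists_length_le f
  exact key m f hm h

theorem gradedEval_injective : Function.Injective gradedEval :=
  (injective_iff_map_eq_zero _).2 fun _ => gradedEval_eq_zero

end CycSums

/-! ### Independence of the relations from the ambient alphabet; compatible bases -/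

namespace CycSums

/-! ### Relations over subalphabets -/

/-- Points with `a ∉ M` are invisible to words over `M`, and a word with a letter outside `M` finds
no point where that letter is nonzero once they are deleted. -/
theorem gradedSum_filter (M : Set ℕ) [DecidablePred (· ∈ M)] (w : List Letter) (L : List Datum) :
    gradedSum w (L.filter fun δ => δ.1.1 ∈ M)
      = if ∀ l ∈ w, l.a ∈ M then gradedSum w L else 0 := by
  induction w generalizing L with
  | nil => simp [gradedSum]
  | cons l w ih =>
    induction L with
    | nil => simp [gradedSum]
    | cons δ L ihL =>
      have ihw := ih (δ :: L)
      by_cases hδ : δ.1.1 ∈ M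
      · rw [List.filter_cons_of_pos (by simpa using hδ)] at ihw ⊢
        rw [gradedSum, ihL, ihw, gradedSum]
        by_cases hl : l.a ∈ M
        · simp only [List.forall_mem_cons, hl, true_and]
          split_ifs <;> simp
        · have : ¬ (l.a = δ.1.1 ∧ l.b = δ.1.2) := fun h => hl (h.1 ▸ hδ)
          simp [hl, gradedLambda, this]
      · rw [List.filter_cons_of_neg (by simpa using hδ), ihL]
        refine if_ctx_congr Iff.rfl (fun h => ?_) fun _ => rfl
        have : ¬ (l.a = δ.1.1 ∧ l.b = δ.1.2) := fun h' => hδ (h'.1 ▸ h l (by simp))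
        conv_rhs => rw [gradedSum]
        rw [gradedLambda, if_neg this, zero_mul, add_zero]

open Classical in
/-- The projection onto the span of the words over the letters with `a ∈ M`. -/
def alphabetProj (M : Set ℕ) : QuasiShuffle ℚ →ₗ[ℚ] QuasiShuffle ℚ :=
  (wordBasis ℚ).constr ℚ fun w => if ∀ l ∈ w, l.a ∈ M then word ℚ w else 0

open Classical in
theorem alphabetProj_word (M : Set ℕ) (w : List Letter) :
    alphabetProj M (word ℚ w) = if ∀ l ∈ w, l.a ∈ M then word ℚ w else 0 := by
  simp only [alphabetProj, word, Module.Basis.constr_basis]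

/-- The projection becomes precomposition with a map of lists, and so respects pointwise products.
-/
theorem gradedEval_alphabetProj (M : Set ℕ) [DecidablePred (· ∈ M)] (x : QuasiShuffle ℚ)
    (L : List Datum) :
    gradedEval (alphabetProj M x) L = gradedEval x (L.filter fun δ => δ.1.1 ∈ M) := by
  have : (LinearMap.proj L).comp (gradedEval.comp (alphabetProj M))
      = (LinearMap.proj (L.filter fun δ => δ.1.1 ∈ M)).comp gradedEval :=
    hom_ext_word fun w => by
      simp only [LinearMap.comp_apply, alphabetProj_word, LinearMap.proj_apply, gradedEval_word,
        gradedSum_filter]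
      split_ifs
      · rw [gradedEval_word]
      · rw [map_zero, Pi.zero_apply]
  exact LinearMap.congr_fun this x

/-- The total weight of a product of sums. -/
def totalWeight (p : Multiset Word) : ℕ := (p.map fun w => weight w.1).sum

/-- The part of top weight of a product of words. -/
def topProd (p : Multiset Word) : QuasiShuffle ℚ :=
  weightPart (totalWeight p) (p.map fun w => word ℚ w.1).prod

theorem gradedEval_topProd (p : Multiset Word) :
    gradedEval (topProd p) = (p.map fun w => gradedSum w.1).prod :=
  gradedEval_weightPart_prod p

theorem gradedEval_topProd_apply (p : Multiset Word) (L : List Datum) :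
    gradedEval (topProd p) L = (p.map fun w => gradedSum w.1 L).prod := by
  rw [gradedEval_topProd]
  have h := map_multiset_prod (Pi.evalRingHom (fun _ => ℚ) L) (p.map fun w => gradedSum w.1)
  rw [Multiset.map_map] at h
  exact h

theorem alphabetProj_topProd (M : Set ℕ) {p : Multiset Word} (h : ∀ w ∈ p, ∀ l ∈ w.1, l.a ∈ M) :
    alphabetProj M (topProd p) = topProd p := by
  classical
  refine gradedEval_injective (funext fun L => ?_)
  rw [gradedEval_alphabetProj, gradedEval_topProd_apply, gradedEval_topProd_apply]
  congr 1
  refine Multiset.map_congr rfl fun w hw => ?_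
  rw [gradedSum_filter, if_pos (h w hw)]

theorem alphabetProj_topProd_eq_zero (M : Set ℕ) {p : Multiset Word}
    (h : ¬ ∀ w ∈ p, ∀ l ∈ w.1, l.a ∈ M) : alphabetProj M (topProd p) = 0 := by
  classical
  push Not at h
  obtain ⟨w, hw, l, hl, hM⟩ := h
  refine gradedEval_injective (funext fun L => ?_)
  rw [gradedEval_alphabetProj, gradedEval_topProd_apply, map_zero, Pi.zero_apply]
  refine Multiset.prod_eq_zero (Multiset.mem_map.2 ⟨w, hw, ?_⟩)
  rw [gradedSum_filter, if_neg fun h => hM (h l hl)]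

theorem totalWeight_pos {p : Multiset Word} (h : 2 ≤ p.card) : 0 < totalWeight p := by
  obtain ⟨w, hw⟩ := Multiset.card_pos_iff_exists_mem.1 (by omega : 0 < p.card)
  exact (weight_pos w).trans_le (Multiset.le_sum_of_mem
    (Multiset.mem_map_of_mem (fun w : Word => weight w.1) hw))

/-- The span of a set of words. -/
def wordSpan (B : Set Word) : Submodule ℚ (QuasiShuffle ℚ) :=
  Submodule.span ℚ ((fun w : Word => word ℚ w.1) '' B)

theorem wordSpan_mono {B C : Set Word} (h : B ⊆ C) : wordSpan B ≤ wordSpan C :=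
  Submodule.span_mono (Set.image_mono h)

theorem relationRows_le_iff {M : Set ℕ} {d : ℕ} {N : Submodule ℚ (QuasiShuffle ℚ)} :
    relationRows M d ≤ N ↔ ∀ p : Multiset Word, 2 ≤ p.card → (∀ w ∈ p, ∀ l ∈ w.1, l.a ∈ M) →
      totalWeight p = d → topProd p ∈ N := by
  rw [relationRows, Submodule.span_le]
  constructor
  · intro h p h1 h2 h3
    exact h ⟨p, h1, h2, h3, by rw [topProd, h3]⟩
  · rintro h _ ⟨p, h1, h2, h3, rfl⟩
    have := h p h1 h2 h3
    rwa [topProd, show totalWeight p = d from h3] at this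

theorem topProd_mem_relationRows {M : Set ℕ} {p : Multiset Word} (h1 : 2 ≤ p.card)
    (h2 : ∀ w ∈ p, ∀ l ∈ w.1, l.a ∈ M) : topProd p ∈ relationRows M (totalWeight p) :=
  relationRows_le_iff.1 le_rfl p h1 h2 rfl

theorem relationRows_mono {M N : Set ℕ} (h : M ⊆ N) (d : ℕ) :
    relationRows M d ≤ relationRows N d :=
  relationRows_le_iff.2 fun p h1 h2 h3 => by
    subst h3
    exact topProd_mem_relationRows h1 fun w hw l hl => h (h2 w hw l hl)

theorem wordsEq_mono {M N : Set ℕ} (h : M ⊆ N) (d : ℕ) : wordsEq M d ⊆ wordsEq N d :=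
  fun _ hw => ⟨fun l hl => h (hw.1 l hl), hw.2⟩

theorem alphabetProj_weightPart_mem (M : Set ℕ) {d : ℕ} (hd : 0 < d) (x : QuasiShuffle ℚ) :
    alphabetProj M (weightPart d x) ∈ wordSpan (wordsEq M d) := by
  have : (⊤ : Submodule ℚ (QuasiShuffle ℚ))
      ≤ (wordSpan (wordsEq M d)).comap ((alphabetProj M).comp (weightPart d)) := by
    rw [← (wordBasis ℚ).span_eq, Submodule.span_le]
    rintro _ ⟨w, rfl⟩
    change alphabetProj M (weightPart d (word ℚ w)) ∈ wordSpan (wordsEq M d)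
    rw [weightPart_word]
    split_ifs with h
    · rw [alphabetProj_word]
      split_ifs with h'
      · refine Submodule.subset_span ⟨⟨w, ?_⟩, ⟨h', h⟩, rfl⟩
        rintro rfl
        rw [weight_nil] at h
        omega
      · exact zero_mem _
    · rw [map_zero]; exact zero_mem _
  exact this (Submodule.mem_top (x := x))

theorem relationRows_le_wordSpan (M : Set ℕ) (d : ℕ) :
    relationRows M d ≤ wordSpan (wordsEq M d) :=
  relationRows_le_iff.2 fun p h1 h2 h3 => by
    rw [← alphabetProj_topProd M h2, topProd, h3]
    exact alphabetProj_weightPart_mem M (h3 ▸ totalWeight_pos h1) _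

/-- The projection onto words over `M` fixes `x`, while it sends each row for `N` to itself, now a
row for `M`, or to zero. So enlarging the alphabet imposes no new relations on old words. -/
theorem mem_relationRows_of_mem_wordSpan {M N : Set ℕ} {d : ℕ} {x : QuasiShuffle ℚ}
    (hx : x ∈ relationRows N d) (hM : x ∈ wordSpan (wordsEq M d)) : x ∈ relationRows M d := by
  have h1 : wordSpan (wordsEq M d) ≤ LinearMap.eqLocus (alphabetProj M) LinearMap.id := by
    rw [wordSpan, Submodule.span_le]
    rintro _ ⟨w, hw, rfl⟩
    change alphabetProj M (word ℚ w.1) = word ℚ w.1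
    rw [alphabetProj_word, if_pos hw.1]
  have h2 : relationRows N d ≤ (relationRows M d).comap (alphabetProj M) :=
    relationRows_le_iff.2 fun p hp h2 h3 => by
      subst h3
      rw [Submodule.mem_comap]
      by_cases h : ∀ w ∈ p, ∀ l ∈ w.1, l.a ∈ M
      · rw [alphabetProj_topProd M h]
        exact topProd_mem_relationRows hp h
      · rw [alphabetProj_topProd_eq_zero M h]
        exact zero_mem _
  have h3 : alphabetProj M x = x := h1 hM
  have h4 : alphabetProj M x ∈ relationRows M d := h2 hx
  rwa [h3] at h4

/-! ### Existence of basis sums -/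

theorem linearIndependent_word (F : Type*) [CommRing F] (B : Set Word) :
    LinearIndependent F fun w : B => word F w.1.1 :=
  (wordBasis F).linearIndependent.comp (fun w : B => w.1.1)
    (Subtype.val_injective.comp Subtype.val_injective)

theorem wordSpan_eq_span_range (B : Set Word) :
    wordSpan B = Submodule.span ℚ (Set.range fun w : B => word ℚ w.1.1) := by
  rw [wordSpan, Set.image_eq_range]

/-- Modulo the row space, `B₀` stays linearly independent and extends to a basis consisting of
classes of words. -/
theorem exists_isBasisSums_extension {N : Set ℕ} {d : ℕ} {B₀ : Set Word} (h₀ : B₀ ⊆ wordsEq N d)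
    (hdis : Disjoint (wordSpan B₀) (relationRows N d)) :
    ∃ B, B₀ ⊆ B ∧ IsBasisSums N d B := by
  let q := (relationRows N d).mkQ
  let v : Word → QuasiShuffle ℚ ⧸ relationRows N d := fun w => q (word ℚ w.1)
  have hv : LinearIndepOn ℚ v B₀ := by
    refine (linearIndependent_word ℚ B₀).map (f := q) ?_
    rwa [← wordSpan_eq_span_range, Submodule.ker_mkQ]
  obtain ⟨B, hB, hB₀, hspan, hind⟩ := exists_linearIndepOn_extension hv h₀
  refine ⟨B, hB₀, hB, ?_, le_antisymm ?_ ?_⟩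
  · have := Submodule.range_ker_disjoint (f := q) (v := fun w : B => word ℚ w.1.1) hind
    rwa [Submodule.ker_mkQ, ← wordSpan_eq_span_range] at this
  · exact sup_le (wordSpan_mono hB) (relationRows_le_wordSpan N d)
  · rw [Submodule.span_le]
    rintro _ ⟨w, hw, rfl⟩
    have h1 : v w ∈ Submodule.span ℚ (v '' B) := hspan ⟨w, hw, rfl⟩
    have h2 : v '' B = q '' ((fun w : Word => word ℚ w.1) '' B) := by
      rw [Set.image_image]
    rw [h2, Submodule.span_image] at h1
    have h3 : word ℚ w.1 ∈ Submodule.comap q (Submodule.map q (wordSpan B)) := h1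
    rw [Submodule.comap_map_mkQ, sup_comm] at h3
    exact h3

theorem IsBasisSums.disjoint_of_subset {M N : Set ℕ} {d : ℕ} {B : Set Word}
    (hB : IsBasisSums M d B) : Disjoint (wordSpan B) (relationRows N d) := by
  rw [Submodule.disjoint_def]
  intro x h1 h2
  exact Submodule.disjoint_def.1 hB.disjoint x h1
    (mem_relationRows_of_mem_wordSpan h2 (wordSpan_mono hB.subset h1))

/-- By `IsBasisSums.disjoint_of_subset`, a basis set for one alphabet is still independent modulo
the rows of the next, so it can be extended step by step. -/
theorem exists_isBasisChoice : ∃ B : ℕ → ℕ → Set Word, IsBasisChoice B := by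
  have init : ∀ d, ∃ B, IsBasisSums (Set.Icc 1 0) d B := fun d => by
    obtain ⟨B, -, hB⟩ := exists_isBasisSums_extension (N := Set.Icc 1 0) (d := d) (B₀ := ∅)
      (Set.empty_subset _) (by simp [wordSpan])
    exact ⟨B, hB⟩
  have step : ∀ d k (B : {B // IsBasisSums (Set.Icc 1 k) d B}),
      ∃ B' : {B' // IsBasisSums (Set.Icc 1 (k + 1)) d B'}, B.1 ⊆ B'.1 := fun d k B => by
    obtain ⟨B', h1, h2⟩ := exists_isBasisSums_extension
      (B.2.subset.trans (wordsEq_mono (Set.Icc_subset_Icc_right k.le_succ) d))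
      B.2.disjoint_of_subset
    exact ⟨⟨B', h2⟩, h1⟩
  choose B₀ hB₀ using init
  choose next hnext using step
  let B : ∀ d k : ℕ, {B // IsBasisSums (Set.Icc 1 k) d B} := fun d k =>
    Nat.rec ⟨B₀ d, hB₀ d⟩ (fun k B => next d k B) k
  exact ⟨fun k d => (B d k).1, fun k d => (B d k).2, fun k d => hnext d k (B d k)⟩

/-! ### Basis sums for the full alphabet -/

theorem Letter.a_pos (l : Letter) : 0 < l.a := Nat.zero_lt_of_lt l.b_lt

theorem exists_alphabet (w : List Letter) : ∃ k, ∀ l ∈ w, l.a ∈ Set.Icc 1 k :=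
  ⟨(w.map Letter.a).sum, fun l hl =>
    ⟨l.a_pos, List.single_le_sum (fun _ _ => Nat.zero_le _) _ (List.mem_map_of_mem hl)⟩⟩

theorem IsBasisChoice.monotone {B : ℕ → ℕ → Set Word} (hB : IsBasisChoice B) (d : ℕ) :
    Monotone fun k => B k d :=
  monotone_nat_of_le_succ fun k => hB.mono k d

/-- Each word uses finitely many letters and each combination of basis words finitely many words, so
both conditions are decided at a finite stage. -/
theorem IsBasisChoice.isBasisSums_iUnion {B : ℕ → ℕ → Set Word} (hB : IsBasisChoice B) (d : ℕ) :
    IsBasisSums Set.univ d (⋃ k, B k d) := by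
  have hle : ∀ k, wordSpan (B k d) ≤ wordSpan (⋃ k, B k d) := fun k =>
    wordSpan_mono (Set.subset_iUnion (fun k => B k d) k)
  have hsub : (⋃ k, B k d) ⊆ wordsEq Set.univ d :=
    Set.iUnion_subset fun k => ((hB.isBasisSums k d).subset).trans
      (wordsEq_mono (Set.subset_univ _) d)
  refine ⟨hsub, ?_, le_antisymm (sup_le (wordSpan_mono hsub) (relationRows_le_wordSpan _ d)) ?_⟩
  · rw [Submodule.disjoint_def]
    intro x h1 h2
    have h3 : x ∈ ⨆ k, wordSpan (B k d) := by
      have : wordSpan (⋃ k, B k d) = ⨆ k, wordSpan (B k d) := by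
        simp only [wordSpan, Set.image_iUnion, Submodule.span_iUnion]
      rw [← this]
      exact h1
    rw [Submodule.mem_iSup_of_directed _ (Monotone.directed_le fun k j h =>
      wordSpan_mono (hB.monotone d h))] at h3
    obtain ⟨k, hk⟩ := h3
    exact Submodule.disjoint_def.1 (hB.isBasisSums k d).disjoint_of_subset x hk h2
  · rw [Submodule.span_le]
    rintro _ ⟨w, hw, rfl⟩
    obtain ⟨k, hk⟩ := exists_alphabet w.1
    have h1 : word ℚ w.1 ∈ wordSpan (wordsEq (Set.Icc 1 k) d) :=
      Submodule.subset_span ⟨w, ⟨hk, hw.2⟩, rfl⟩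
    rw [wordSpan, ← (hB.isBasisSums k d).sup_eq] at h1
    exact sup_le_sup (hle k) (relationRows_mono (Set.subset_univ _) d) h1

end CycSums

/-! ### Weighted polynomials and generation by basis words -/

namespace CycSums

open MvPolynomial

/-! ### Polynomials of bounded weighted degree -/

section
variable {ι : Type*}

/-- The polynomials all of whose monomials have weighted degree less than `D`. -/
def polyLT (R : Type*) [CommRing R] (wt : ι → ℕ) (D : ℕ) : Submodule R (MvPolynomial ι R) where
  carrier := {P | ∀ s, coeff s P ≠ 0 → Finsupp.weight wt s < D}
  add_mem' {P Q} hP hQ s hs := by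
    by_contra h
    apply hs
    rw [coeff_add, not_not.1 (mt (hP s) h), not_not.1 (mt (hQ s) h), add_zero]
  zero_mem' s hs := absurd (coeff_zero s) hs
  smul_mem' r P hP s hs := hP s fun h => hs (by rw [coeff_smul, h, smul_zero])

variable {R : Type*} [CommRing R] {wt : ι → ℕ}

theorem polyLT_mono {D E : ℕ} (h : D ≤ E) : polyLT R wt D ≤ polyLT R wt E :=
  fun _ hP s hs => (hP s hs).trans_le h

theorem monomial_mem_polyLT {s : ι →₀ ℕ} {D : ℕ} (h : Finsupp.weight wt s < D) (r : R) :
    monomial s r ∈ polyLT R wt D := by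
  classical
  intro t ht
  rw [coeff_monomial] at ht
  split_ifs at ht with hst
  · rwa [← hst]
  · exact absurd rfl ht

theorem C_mem_polyLT {D : ℕ} (h : 0 < D) (r : R) : C r ∈ polyLT R wt D :=
  monomial_mem_polyLT (by simpa using h) r

theorem X_mem_polyLT {i : ι} {D : ℕ} (h : wt i < D) : X i ∈ polyLT R wt D :=
  monomial_mem_polyLT (by simpa [Finsupp.weight_single] using h) 1

/-- The bounds are strict: `P` has degree below `D` and `Q` degree at most `E`. With strict bounds,
level `0` contains only the zero polynomial and can start inductions. -/
theorem mul_mem_polyLT {D E : ℕ} {P Q : MvPolynomial ι R} (hP : P ∈ polyLT R wt D)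
    (hQ : Q ∈ polyLT R wt (E + 1)) : P * Q ∈ polyLT R wt (D + E) := by
  classical
  intro s hs
  obtain ⟨t, ht, u, hu, rfl⟩ := Finset.mem_add.1 (support_mul P Q (mem_support_iff.2 hs))
  have h1 := hP t (mem_support_iff.1 ht)
  have h2 := hQ u (mem_support_iff.1 hu)
  rw [map_add]
  omega

theorem polyLT_zero {P : MvPolynomial ι R} (hP : P ∈ polyLT R wt 0) : P = 0 := by
  ext s
  by_contra h
  exact absurd (hP s (by simpa using h)) (Nat.not_lt_zero _)

theorem exists_mem_polyLT (wt : ι → ℕ) (P : MvPolynomial ι R) : ∃ D, P ∈ polyLT R wt D :=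
  ⟨P.support.sup (Finsupp.weight wt) + 1, fun _ hs =>
    Nat.lt_succ_of_le (Finset.le_sup (f := Finsupp.weight wt) (mem_support_iff.2 hs))⟩

theorem aeval_eq_sum_support {A : Type*} [CommRing A] [Algebra R A] (x : ι → A)
    (P : MvPolynomial ι R) :
    aeval x P = ∑ s ∈ P.support, coeff s P • s.prod fun i n => x i ^ n := by
  conv_lhs => rw [← support_sum_monomial_coeff P]
  simp only [map_sum, aeval_monomial, Algebra.smul_def]

/-- A substitution that changes each variable by terms of smaller weight changes each polynomial by
terms of smaller weight. -/
theorem aeval_sub_self_mem_polyLT {f : ι → MvPolynomial ι R}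
    (hf : ∀ i, f i - X i ∈ polyLT R wt (wt i)) {D : ℕ} {P : MvPolynomial ι R}
    (hP : P ∈ polyLT R wt (D + 1)) : aeval f P - P ∈ polyLT R wt D := by
  have hmul : ∀ s t : ι →₀ ℕ,
      aeval f (monomial s (1 : R)) - monomial s 1 ∈ polyLT R wt (Finsupp.weight wt s) →
      aeval f (monomial t (1 : R)) - monomial t 1 ∈ polyLT R wt (Finsupp.weight wt t) →
      aeval f (monomial (s + t) (1 : R)) - monomial (s + t) 1
        ∈ polyLT R wt (Finsupp.weight wt (s + t)) := by
    intro s t hs ht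
    have e : aeval f (monomial (s + t) (1 : R)) - monomial (s + t) 1
        = (aeval f (monomial s (1 : R)) - monomial s 1)
            * (aeval f (monomial t (1 : R)) - monomial t 1)
          + (aeval f (monomial s (1 : R)) - monomial s 1) * monomial t 1
          + (aeval f (monomial t (1 : R)) - monomial t 1) * monomial s 1 := by
      rw [← one_mul (1 : R), ← monomial_mul, map_mul, one_mul]
      ring
    rw [e, map_add]
    refine add_mem (add_mem ?_ ?_) ?_
    · exact mul_mem_polyLT hs (polyLT_mono (Nat.le_succ _) ht)
    · exact mul_mem_polyLT hs (monomial_mem_polyLT (Nat.lt_succ_self _) 1)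
    · rw [add_comm]
      exact mul_mem_polyLT ht (monomial_mem_polyLT (Nat.lt_succ_self _) 1)
  have hmon : ∀ s : ι →₀ ℕ,
      aeval f (monomial s (1 : R)) - monomial s 1 ∈ polyLT R wt (Finsupp.weight wt s) := by
    have h0 : aeval f (monomial (0 : ι →₀ ℕ) (1 : R)) - monomial 0 1
        ∈ polyLT R wt (Finsupp.weight wt (0 : ι →₀ ℕ)) := by
      change aeval f (C (1 : R)) - C 1 ∈ _
      simp
    intro s
    induction s using Finsupp.induction_linear with
    | zero => exact h0
    | add s t hs ht => exact hmul s t hs ht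
    | single i n =>
      induction n with
      | zero => rw [Finsupp.single_zero]; exact h0
      | succ n ih =>
        rw [Finsupp.single_add]
        refine hmul _ _ ih ?_
        have := hf i
        change aeval f (X i) - X i ∈ _
        rwa [aeval_X, Finsupp.weight_single, one_smul]
  have e : aeval f P - P = ∑ s ∈ P.support,
      coeff s P • (aeval f (monomial s (1 : R)) - monomial s 1) := by
    conv_lhs => rw [← support_sum_monomial_coeff P]
    rw [map_sum, ← Finset.sum_sub_distrib]
    refine Finset.sum_congr rfl fun s _ => ?_
    rw [smul_sub, ← map_smul, smul_monomial, smul_eq_mul, mul_one]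
  rw [e]
  refine Submodule.sum_mem _ fun s hs => Submodule.smul_mem _ _ (polyLT_mono ?_ (hmon s))
  have := hP s (mem_support_iff.1 hs)
  omega

end

/-! ### Basis sums generate -/

theorem weight_lt_totalWeight {p : Multiset Word} (hp : 2 ≤ p.card) {w : Word} (hw : w ∈ p) :
    weight w.1 < totalWeight p := by
  obtain ⟨q, rfl⟩ := Multiset.exists_cons_of_mem hw
  rw [Multiset.card_cons] at hp
  obtain ⟨v, hv⟩ := Multiset.card_pos_iff_exists_mem.1 (by omega : 0 < q.card)
  have h1 : weight v.1 ≤ totalWeight q :=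
    Multiset.le_sum_of_mem (Multiset.mem_map_of_mem (fun w : Word => weight w.1) hv)
  have h2 := weight_pos v
  have h3 : totalWeight (w ::ₘ q) = weight w.1 + totalWeight q := by
    simp only [totalWeight, Multiset.map_cons, Multiset.sum_cons]
  omega

/-- The weight of a basis word. -/
def genWeight (G : Set Word) (g : G) : ℕ := weight g.1.1

/-- If the top parts of products of words are products up to terms of lower weight, then each word
is a polynomial in the basis sums, of at most its weight. -/
theorem exists_polynomial {A : Type*} [CommRing A] [Algebra ℚ A] (Θ : QuasiShuffle ℚ →ₗ[ℚ] A)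
    (h1 : Θ (word ℚ []) = 1)
    (hprod : ∀ (p : Multiset Word) (n : ℕ), totalWeight p = n + 1 →
      ∃ x ∈ weightLE ℚ n, Θ (topProd p) + Θ x = (p.map fun w => Θ (word ℚ w.1)).prod)
    {B : ℕ → Set Word} (hB : ∀ d, IsBasisSums Set.univ d (B d)) (u : List Letter) :
    ∃ P ∈ polyLT ℚ (genWeight (⋃ d, B d)) (weight u + 1),
      aeval (fun g : ⋃ d, B d => Θ (word ℚ g.1.1)) P = Θ (word ℚ u) := by
  let ev : MvPolynomial (⋃ d, B d : Set Word) ℚ →ₐ[ℚ] A :=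
    aeval fun g : ⋃ d, B d => Θ (word ℚ g.1.1)
  let V : ℕ → Submodule ℚ A := fun n =>
    (polyLT ℚ (genWeight (⋃ d, B d)) (n + 1)).map ev.toLinearMap
  have Vmono : ∀ {m n}, m ≤ n → V m ≤ V n := fun h =>
    Submodule.map_mono (polyLT_mono (by omega))
  have Vmul : ∀ {m n x y}, x ∈ V m → y ∈ V n → x * y ∈ V (m + n) := by
    rintro m n _ _ ⟨P, hP, rfl⟩ ⟨Q, hQ, rfl⟩
    refine ⟨P * Q, ?_, map_mul ev P Q⟩
    have := mul_mem_polyLT hP hQ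
    rwa [add_right_comm] at this
  have Vone : ∀ n, (1 : A) ∈ V n := fun n =>
    ⟨1, C_mem_polyLT (Nat.succ_pos n) 1, map_one ev⟩
  have key : ∀ n, weightLE ℚ n ≤ (V n).comap Θ := by
    intro n
    induction n using Nat.strong_induction_on with
    | _ n ih =>
    refine weightLE_le_of_words fun u hu => ?_
    rw [Submodule.mem_comap]
    rcases hu.lt_or_eq with hu | hu
    · exact Vmono hu.le (ih _ hu (word_mem_weightLE le_rfl))
    match n, u with
    | _, [] => rw [h1]; exact Vone _
    | 0, l :: u =>
      rw [weight_cons] at hu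
      have := l.c_pos
      omega
    | n + 1, l :: u =>
      have h2 : word ℚ (l :: u) ∈ wordSpan (wordsEq Set.univ (n + 1)) :=
        Submodule.subset_span ⟨⟨l :: u, List.cons_ne_nil _ _⟩, ⟨fun _ _ => trivial, hu⟩, rfl⟩
      -- A word of weight `n + 1` is a combination of basis words, which are variables, and of rows.
      -- Up to terms of weight at most `n`, a row is a product of words of smaller weight, so
      -- induction covers it.
      rw [wordSpan, ← (hB (n + 1)).sup_eq] at h2
      refine (sup_le (c := (V (n + 1)).comap Θ) ?_ ?_ : _) h2
      · rw [Submodule.span_le]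
        rintro _ ⟨w, hw, rfl⟩
        let g : (⋃ d, B d : Set Word) := ⟨w, Set.mem_iUnion.2 ⟨_, hw⟩⟩
        refine ⟨X g, X_mem_polyLT ?_, aeval_X _ g⟩
        have := ((hB (n + 1)).subset hw).2
        change weight w.1 < _
        omega
      · refine relationRows_le_iff.2 fun p hp _ hn => ?_
        obtain ⟨x, hx, hpx⟩ := hprod p n hn
        rw [Submodule.mem_comap, eq_sub_of_add_eq hpx]
        refine sub_mem ?_ (Vmono n.le_succ (ih n (Nat.lt_succ_self n) hx))
        have : ∀ q : Multiset Word, (∀ w ∈ q, Θ (word ℚ w.1) ∈ V (weight w.1)) →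
            (q.map fun w => Θ (word ℚ w.1)).prod ∈ V (totalWeight q) := by
          intro q
          induction q using Multiset.induction with
          | empty => intro _; exact Vone _
          | cons w q ihq =>
            intro h
            simp only [totalWeight, Multiset.map_cons, Multiset.prod_cons, Multiset.sum_cons]
            exact Vmul (h w (Multiset.mem_cons_self _ _))
              (ihq fun v hv => h v (Multiset.mem_cons_of_mem hv))
        rw [← hn]
        exact this p fun w hw => ih _ (by
          have := weight_lt_totalWeight hp hw
          omega) (word_mem_weightLE le_rfl)
  obtain ⟨P, hP, h⟩ := key (weight u) (word_mem_weightLE le_rfl)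
  exact ⟨P, hP, h⟩

/-! ### Basis sums are independent in the graded model -/

/-- The product of words that a monomial stands for. -/
def monomialWords {G : Set Word} (s : G →₀ ℕ) : Multiset Word :=
  (Finsupp.toMultiset s).map Subtype.val

theorem prod_monomialWords {G : Set Word} {A : Type*} [CommMonoid A] (f : Word → A)
    (s : G →₀ ℕ) : ((monomialWords s).map f).prod = s.prod fun g n => f g.1 ^ n := by
  rw [monomialWords, Multiset.map_map, Finsupp.toMultiset_map, Finsupp.prod_toMultiset,
    Finsupp.prod_mapDomain_index (fun _ => pow_zero _) (fun _ _ _ => pow_add _ _ _)]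
  rfl

theorem totalWeight_monomialWords {G : Set Word} (s : G →₀ ℕ) :
    totalWeight (monomialWords s) = Finsupp.weight (genWeight G) s := by
  induction s using Finsupp.induction_linear with
  | zero => simp [monomialWords, totalWeight]
  | add s t hs ht =>
    rw [map_add, ← hs, ← ht]
    simp [monomialWords, totalWeight]
  | single g n =>
    simp [monomialWords, totalWeight, Finsupp.weight_single, genWeight, Finsupp.toMultiset_single,
      Multiset.map_nsmul, Multiset.sum_nsmul]

theorem gradedEval_aeval_eq {G : Set Word} (P : MvPolynomial G ℚ) :
    gradedEval (∑ s ∈ P.support, coeff s P • topProd (monomialWords s))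
      = aeval (fun g : G => gradedSum g.1.1) P := by
  simp only [map_sum, map_smul, gradedEval_topProd, aeval_eq_sum_support]
  refine Finset.sum_congr rfl fun s _ => ?_
  rw [prod_monomialWords fun w => gradedSum w.1]

theorem weightPart_topProd (d : ℕ) (p : Multiset Word) :
    weightPart d (topProd p) = if totalWeight p = d then topProd p else 0 := by
  rw [topProd, weightPart_weightPart]
  simp only [eq_comm]

end CycSums

/-! ### Algebraic independence of basis words -/

namespace CycSums

open MvPolynomial

theorem shiftWordBy_mem_weightLE {F : Type*} [CommRing F] (μ : Letter → F) (w : List Letter) :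
    shiftWordBy μ w ∈ weightLE F (weight w) := by
  induction w with
  | nil => exact word_mem_weightLE le_rfl
  | cons l w ih =>
    rw [shiftWordBy]
    refine add_mem (word_mem_weightLE le_rfl) (Submodule.smul_mem _ _ (weightLE_mono ?_ ih))
    rw [weight_cons]
    omega

section
variable {B : ℕ → Set Word}

/-- The substitution that corresponds to prepending a point to the lists of the graded model. -/
theorem exists_gradedShift (hB : ∀ d, IsBasisSums Set.univ d (B d)) (δ : Datum) :
    ∃ f : (⋃ d, B d : Set Word) →
    MvPolynomial (⋃ d, B d : Set Word) ℚ,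
    (∀ g, f g - X g ∈ polyLT ℚ (genWeight (⋃ d, B d)) (genWeight _ g)) ∧
    ∀ P L, aeval (fun g : ⋃ d, B d => gradedSum g.1.1) (aeval (R := ℚ) f P) L
      = aeval (fun g : ⋃ d, B d => gradedSum g.1.1) P (δ :: L) := by
  let ev : MvPolynomial (⋃ d, B d : Set Word) ℚ →ₐ[ℚ] (List Datum → ℚ) :=
    aeval fun g : ⋃ d, B d => gradedSum g.1.1
  have hgen : ∀ (n : ℕ), weightLE ℚ n
      ≤ ((polyLT ℚ (genWeight (⋃ d, B d)) (n + 1)).map ev.toLinearMap).comap gradedEval := by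
    refine fun n => weightLE_le_of_words fun u hu => ?_
    obtain ⟨P, hP, h⟩ := exists_polynomial gradedEval gradedEval_nil
      (fun p n _ => ⟨0, zero_mem _, by
        simp only [map_zero, add_zero, gradedEval_topProd, gradedEval_word]⟩) hB u
    simp only [gradedEval_word] at h
    exact ⟨P, polyLT_mono (by omega) hP, by rw [gradedEval_word]; exact h⟩
  -- Prepending `δ` changes the sum of `l :: w` by `gradedLambda l δ` times the shifted sum of `w`.
  -- The latter has weight at most `weight w`, and `q` writes the change as a polynomial in the
  -- generators.
  have hq : ∀ g : (⋃ d, B d : Set Word), ∃ q ∈ polyLT ℚ (genWeight (⋃ d, B d)) (genWeight _ g),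
      ∀ L, gradedSum g.1.1 L + ev q L = gradedSum g.1.1 (δ :: L) := by
    rintro ⟨⟨w, hw⟩, hg⟩
    match w, hw with
    | l :: w, hw =>
      have h1 := hgen _ (Submodule.smul_mem _ (gradedLambda l δ)
        (shiftWordBy_mem_weightLE (fun l => gradedLambda l δ) w))
      obtain ⟨q, hq, h2⟩ := h1
      refine ⟨q, polyLT_mono ?_ hq, fun L => ?_⟩
      · have := l.c_pos
        change weight w + 1 ≤ weight (l :: w)
        rw [weight_cons]
        omega
      · have h3 := congrFun h2 L
        rw [map_smul, Pi.smul_apply, gradedEval_shiftWordBy] at h3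
        change ev q L = _ at h3
        rw [h3]
        conv_rhs => rw [gradedSum]
        rfl
  choose q hq1 hq2 using hq
  refine ⟨fun g => X g + q g, fun g => by rw [add_sub_cancel_left]; exact hq1 g, fun P L => ?_⟩
  have h : ((Pi.evalAlgHom ℚ (fun _ : List Datum => ℚ) L).comp ev).comp
      (aeval fun g => X g + q g)
      = (Pi.evalAlgHom ℚ (fun _ : List Datum => ℚ) (δ :: L)).comp ev := by
    refine MvPolynomial.algHom_ext fun g => ?_
    simp only [AlgHom.comp_apply, aeval_X, map_add, ev]
    exact hq2 g L
  exact DFunLike.congr_fun h P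

theorem mem_of_genWeight_eq (hB : ∀ d, IsBasisSums Set.univ d (B d))
    {g : (⋃ d, B d : Set Word)} {d : ℕ} (h : genWeight _ g = d) :
    g.1 ∈ B d := by
  obtain ⟨e, he⟩ := Set.mem_iUnion.1 g.2
  have : genWeight _ g = e := ((hB e).subset he).2
  rwa [← h, this]

/-- For a variable of weight at most `wt g`, the correction `f i - X i` has smaller weight and
cannot contain `g`. Hence `f i` and `X i` have the same derivative by `g`. -/
theorem pderiv_comm_of_lower {ι : Type*} {wt : ι → ℕ} {f : ι → MvPolynomial ι ℚ}
    (hf : ∀ i, f i - X i ∈ polyLT ℚ wt (wt i)) {g : ι} {P : MvPolynomial ι ℚ}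
    (hP : ∀ i ∈ P.vars, wt i ≤ wt g) : pderiv g (aeval f P) = aeval f (pderiv g P) := by
  classical
  have hmem : P ∈ supported ℚ {i | wt i ≤ wt g} :=
    mem_supported.2 fun i hi => hP i hi
  refine Algebra.adjoin_induction
    (p := fun P _ => pderiv g (aeval f P) = aeval f (pderiv g P)) ?_ ?_ ?_ ?_ hmem
  · rintro _ ⟨i, hi, rfl⟩
    have h0 : pderiv g (f i - X i) = 0 := by
      ext s
      rw [coeff_pderiv, coeff_zero]
      by_contra h
      have h1 := hf i _ (left_ne_zero_of_mul h)
      rw [map_add, Finsupp.weight_single, one_smul] at h1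
      have : wt i ≤ wt g := hi
      omega
    rw [map_sub, sub_eq_zero] at h0
    rw [aeval_X, h0, pderiv_X, Pi.single_apply]
    split_ifs <;> simp
  · intro r
    rw [MvPolynomial.algebraMap_eq, aeval_C, MvPolynomial.algebraMap_eq, pderiv_C, map_zero]
  · intro P Q _ _ h1 h2
    simp only [map_add, h1, h2]
  · intro P Q _ _ h1 h2
    simp only [map_mul, pderiv_mul, map_add, h1, h2]

/-- A relation whose derivatives by all generators of maximal weight `d` are constant is zero in
these generators. -/
theorem coeff_single_eq_zero (hB : ∀ d, IsBasisSums Set.univ d (B d))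
    {P : MvPolynomial (⋃ d, B d : Set Word) ℚ}
    (hP : aeval (fun g : ⋃ d, B d => gradedSum g.1.1) P = 0) (g₀ : (⋃ d, B d : Set Word)) :
    coeff (Finsupp.single g₀ 1) P = 0 := by
  classical
  set d := genWeight _ g₀ with hd
  have hdpos : 0 < d := weight_pos g₀.1
  rw [← gradedEval_aeval_eq] at hP
  have h1 := congrArg (weightPart d) (gradedEval_eq_zero hP)
  simp only [map_sum, map_smul, weightPart_topProd, map_zero, totalWeight_monomialWords,
    smul_ite, smul_zero] at h1
  rw [← Finset.sum_filter] at h1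
  set T := P.support.filter fun s => Finsupp.weight (genWeight (⋃ d, B d)) s = d with hT
  rw [← Finset.sum_filter_add_sum_filter_not T fun s => (monomialWords s).card = 1] at h1
  -- The part of weight `d` of the relation splits into the linear terms `y` and products of at
  -- least two words. Thus `y` lies in the span of the basis words and in the row space, which meet
  -- only in zero.
  set y := ∑ s ∈ T with (monomialWords s).card = 1, coeff s P • topProd (monomialWords s) with hy
  have hsingle : ∀ s ∈ T, (monomialWords s).card = 1 →
      ∃ g : (⋃ d, B d : Set Word), s = Finsupp.single g 1 ∧ genWeight _ g = d := by
    intro s hs hc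
    rw [monomialWords, Multiset.card_map, Multiset.card_eq_one] at hc
    obtain ⟨g, hg⟩ := hc
    have hs' : s = Finsupp.single g 1 := by
      rw [← Finsupp.toMultiset_toFinsupp s, hg, Multiset.toFinsupp_singleton]
    refine ⟨g, hs', ?_⟩
    have := (Finset.mem_filter.1 hs).2
    rwa [hs', Finsupp.weight_single, one_smul] at this
  have htop : ∀ g : (⋃ d, B d : Set Word),
      topProd (monomialWords (Finsupp.single g 1)) = word ℚ g.1.1 := by
    intro g
    refine gradedEval_injective ?_
    rw [gradedEval_topProd, prod_monomialWords fun w => gradedSum w.1, gradedEval_word,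
      Finsupp.prod_single_index (by simp), pow_one]
  have hy1 : y ∈ wordSpan (B d) := by
    refine Submodule.sum_mem _ fun s hs => Submodule.smul_mem _ _ ?_
    obtain ⟨hs1, hs2⟩ := Finset.mem_filter.1 hs
    obtain ⟨g, rfl, hg⟩ := hsingle s hs1 hs2
    rw [htop]
    exact Submodule.subset_span ⟨g.1, mem_of_genWeight_eq hB hg, rfl⟩
  have hy2 : y ∈ relationRows Set.univ d := by
    rw [eq_neg_of_add_eq_zero_left h1]
    refine neg_mem (Submodule.sum_mem _ fun s hs => Submodule.smul_mem _ _ ?_)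
    obtain ⟨hs1, hs2⟩ := Finset.mem_filter.1 hs
    have hw := (Finset.mem_filter.1 hs1).2
    rw [← totalWeight_monomialWords] at hw
    rw [← hw]
    refine topProd_mem_relationRows ?_ fun _ _ _ _ => trivial
    have h0 : (monomialWords s).card ≠ 0 := by
      intro h0
      rw [Multiset.card_eq_zero] at h0
      rw [h0] at hw
      simp only [totalWeight, Multiset.map_zero, Multiset.sum_zero] at hw
      omega
    omega
  have hy0 : y = 0 := Submodule.disjoint_def.1 (hB d).disjoint y hy1 hy2
  by_contra hne
  have h2 := congrArg (wordCoeff g₀.1.1) hy0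
  have hmem : Finsupp.single g₀ 1 ∈ T.filter fun s => (monomialWords s).card = 1 := by
    simp [hT, hne, Finsupp.weight_single, monomialWords, hd]
  rw [hy, map_sum, map_zero, Finset.sum_eq_single_of_mem _ hmem, map_smul, htop, wordCoeff_word,
    if_pos rfl, smul_eq_mul, mul_one] at h2
  · exact hne h2
  · intro s hs hsne
    obtain ⟨hs1, hs2⟩ := Finset.mem_filter.1 hs
    obtain ⟨g, rfl, hg⟩ := hsingle s hs1 hs2
    rw [map_smul, htop, wordCoeff_word, if_neg, smul_zero]
    intro h
    exact hsne (by rw [Subtype.ext (Subtype.ext h)])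

/-- Induction on the weighted degree of a relation. Since the substitutions of `exists_gradedShift`
alter only lower terms, a shortest relation is invariant, and differentiation by a generator of
maximal weight leaves only a constant to exclude. -/
theorem algebraicIndependent_gradedSum (hB : ∀ d, IsBasisSums Set.univ d (B d)) :
    AlgebraicIndependent ℚ fun g : ⋃ d, B d => gradedSum g.1.1 := by
  classical
  rw [algebraicIndependent_iff]
  choose f hf hfev using exists_gradedShift hB
  set ev := aeval (R := ℚ) fun g : ⋃ d, B d => gradedSum g.1.1 with hev
  set wt := genWeight (⋃ d, B d) with hwt
  have key : ∀ D, ∀ P ∈ polyLT ℚ wt D, ev P = 0 → P = 0 := by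
    intro D
    induction D with
    | zero => exact fun P hP _ => polyLT_zero hP
    | succ D ih =>
      intro P hP h0
      -- invariant polynomials of smaller weight are constant
      have hconst : ∀ Q ∈ polyLT ℚ wt D, (∀ δ, aeval (f δ) Q = Q) → ∃ c, Q = C c := by
        intro Q hQ hinv
        rcases Nat.eq_zero_or_pos D with rfl | hD
        · exact ⟨0, by rw [polyLT_zero hQ, C_0]⟩
        refine ⟨ev Q [], sub_eq_zero.1 (ih _ (sub_mem hQ (C_mem_polyLT hD _)) ?_)⟩
        -- Invariance under prepending any point makes the function constant on lists.
        have hL : ∀ L, ev Q L = ev Q [] := by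
          intro L
          induction L with
          | nil => rfl
          | cons δ L ihL => rw [← hfev, hinv, ihL]
        funext L
        rw [map_sub, Pi.sub_apply, hL, hev, aeval_C]
        simp
      have hinv : ∀ δ, aeval (f δ) P = P := by
        intro δ
        refine sub_eq_zero.1 (ih _ (aeval_sub_self_mem_polyLT (hf δ) hP) ?_)
        funext L
        rw [map_sub, Pi.sub_apply, hfev, h0]
        simp
      by_contra hne
      rcases P.vars.eq_empty_or_nonempty with hv | hv
      · obtain ⟨c, hc⟩ : ∃ c, P = C c := ⟨_, vars_eq_empty_iff_eq_C.1 hv⟩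
        rw [hc, hev, aeval_C] at h0
        have := congrFun h0 []
        simp only [Pi.algebraMap_apply, Algebra.algebraMap_self, RingHom.id_apply,
          Pi.zero_apply] at this
        rw [this, C_0] at hc
        exact hne hc
      obtain ⟨g₀, hg₀, hmax⟩ := Finset.exists_max_image P.vars wt hv
      have hwpos : 0 < wt g₀ := weight_pos g₀.1
      have hd : pderiv g₀ P ∈ polyLT ℚ wt D := by
        intro s hs
        rw [coeff_pderiv] at hs
        have := hP _ (left_ne_zero_of_mul hs)
        rw [map_add, Finsupp.weight_single, one_smul] at this
        omega
      obtain ⟨c, hc⟩ := hconst _ hd fun δ => by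
        rw [← pderiv_comm_of_lower (hf δ) hmax, hinv]
      obtain ⟨s, hs, hsg⟩ := (mem_vars_iff_mem_support g₀).1 hg₀
      have hsg' : s g₀ ≠ 0 := Finsupp.mem_support_iff.1 hsg
      have hs1 : s - Finsupp.single g₀ 1 + Finsupp.single g₀ 1 = s :=
        tsub_add_cancel_of_le (Finsupp.single_le_iff.2 (Nat.one_le_iff_ne_zero.2 hsg'))
      have h2 := coeff_pderiv (i := g₀) P (s - Finsupp.single g₀ 1)
      rw [hs1, hc, coeff_C] at h2
      -- Either `s` is the linear monomial in `g₀`, excluded by `coeff_single_eq_zero`, or the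
      -- coefficient of `s` times a positive integer is zero.
      split_ifs at h2 with h3
      · rw [← h3, zero_add] at hs1
        exact mem_support_iff.1 hs (hs1 ▸ coeff_single_eq_zero hB h0 g₀)
      · rcases mul_eq_zero.1 h2.symm with h4 | h4
        · exact mem_support_iff.1 hs h4
        · exact absurd h4 (by positivity)
  intro P hP
  obtain ⟨D, hD⟩ := exists_mem_polyLT wt P
  exact key D P hD hP

/-! ### Basis sums are free generators of the quasi-shuffle algebra -/

/-- The component of highest weight of a relation is a relation for the graded product, since lower
monomials do not reach that weight. -/
theorem algebraicIndependent_word (hB : ∀ d, IsBasisSums Set.univ d (B d)) :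
    AlgebraicIndependent ℚ fun g : ⋃ d, B d => word ℚ g.1.1 := by
  classical
  rw [algebraicIndependent_iff]
  intro P hP
  by_contra hne
  obtain ⟨s₀, hs₀, hmax⟩ := Finset.exists_max_image P.support
    (Finsupp.weight (genWeight (⋃ d, B d))) (support_nonempty.2 hne)
  set D := Finsupp.weight (genWeight (⋃ d, B d)) s₀ with hD
  let Q := weightedHomogeneousComponent (genWeight (⋃ d, B d)) D P
  have hQ : aeval (fun g : ⋃ d, B d => gradedSum g.1.1) Q = 0 := by
    have hQs : Q.support = P.support.filter
        fun s => Finsupp.weight (genWeight (⋃ d, B d)) s = D := by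
      ext s
      simp only [Finset.mem_filter, mem_support_iff, Q, coeff_weightedHomogeneousComponent]
      split_ifs with h <;> simp [h]
    rw [← gradedEval_aeval_eq, hQs, Finset.sum_filter]
    have h1 : weightPart D (aeval (fun g : ⋃ d, B d => word ℚ g.1.1) P) = 0 := by
      rw [hP, map_zero]
    rw [aeval_eq_sum_support, map_sum] at h1
    refine (congrArg gradedEval ((Finset.sum_congr rfl fun s hs => ?_).trans h1)).trans
      (map_zero _)
    have h2 := prod_monomialWords (fun w : Word => word ℚ w.1) s
    rw [map_smul, ← h2]
    have h3 := totalWeight_monomialWords s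
    split_ifs with h
    · have h4 : coeff s Q = coeff s P := by
        rw [coeff_weightedHomogeneousComponent, if_pos h]
      rw [h4, topProd, h3, h]
    · have h5 : totalWeight (monomialWords s) < D := by
        rw [h3]
        exact lt_of_le_of_ne (hmax s hs) h
      rw [weightPart_of_mem_weightLE (prod_word_mem_weightLE _) h5, smul_zero]
  have h6 := (algebraicIndependent_iff.1 (algebraicIndependent_gradedSum hB)) Q hQ
  have h7 := congrArg (coeff s₀) h6
  rw [coeff_weightedHomogeneousComponent, if_pos rfl, coeff_zero] at h7
  exact mem_support_iff.1 hs₀ h7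

theorem word_mem_range_aeval (hB : ∀ d, IsBasisSums Set.univ d (B d)) (u : List Letter) :
    ∃ P : MvPolynomial (⋃ d, B d : Set Word) ℚ,
      aeval (fun g : ⋃ d, B d => word ℚ g.1.1) P = word ℚ u := by
  obtain ⟨P, -, h⟩ := exists_polynomial LinearMap.id one_eq_word.symm (fun p n hn =>
    ⟨(p.map fun w => word ℚ w.1).prod - topProd p, by
      rw [topProd, hn]
      exact sub_weightPart_mem (hn ▸ prod_word_mem_weightLE p), by
      exact add_sub_cancel (topProd p) _⟩) hB u
  exact ⟨P, h⟩

/-- The basis sums stay independent after an extension of scalars. -/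
theorem eq_zero_of_aeval_word_eq_zero (hB : ∀ d, IsBasisSums Set.univ d (B d))
    {F : Type*} [CommRing F] [Algebra ℚ F]
    (P : MvPolynomial (⋃ d, B d : Set Word) F)
    (h : aeval (fun g : ⋃ d, B d => word F g.1.1) P = 0) : P = 0 := by
  classical
  ext s₀
  rw [coeff_zero]
  refine (Module.forall_dual_apply_eq_zero_iff ℚ _).1 fun φ => ?_
  -- apply the functional to all coefficients
  let h_s : ((⋃ d, B d : Set Word) →₀ ℕ) → QuasiShuffle ℚ := fun s =>
    s.prod fun g n => word ℚ g.1.1 ^ n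
  let Q : MvPolynomial (⋃ d, B d : Set Word) ℚ := ∑ s ∈ P.support, monomial s (φ (coeff s P))
  have hmap : ∀ s, (s.prod fun g n => word F g.1.1 ^ n) = extendScalars F (h_s s) := by
    intro s
    let E : QuasiShuffle ℚ →* QuasiShuffle F :=
      { toFun := extendScalars F, map_one' := extendScalars_word [], map_mul' := extendScalars_mul }
    change _ = E (h_s s)
    rw [map_finsuppProd]
    refine Finsupp.prod_congr fun g _ => ?_
    rw [map_pow]
    congr 1
    exact (extendScalars_word g.1.1).symm
  -- Monomials in words have rational coordinates, so applying `φ` to the coefficients of a relation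
  -- over `F` gives a relation over ℚ.
  have hcoeff : ∀ (x : QuasiShuffle ℚ) (u : List Letter),
      wordCoeff u (extendScalars F x) = algebraMap ℚ F (wordCoeff u x) := by
    intro x u
    have : ((wordCoeff u).restrictScalars ℚ).comp (extendScalars F)
        = (Algebra.linearMap ℚ F).comp (wordCoeff u) :=
      hom_ext_word fun w => by
        simp only [LinearMap.comp_apply, extendScalars_word, LinearMap.restrictScalars_apply,
          wordCoeff_word]
        split_ifs <;> simp
    exact LinearMap.congr_fun this x
  have hQ : aeval (fun g : ⋃ d, B d => word ℚ g.1.1) Q = 0 := by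
    refine ext_wordCoeff fun u => ?_
    have h1 := congrArg (fun x => φ (wordCoeff u x)) h
    rw [aeval_eq_sum_support] at h1
    simp only [map_sum, map_smul, hmap, hcoeff, map_zero, smul_eq_mul] at h1
    simp only [Q, map_sum, aeval_monomial, map_zero]
    rw [← h1]
    refine Finset.sum_congr rfl fun s _ => ?_
    rw [← Algebra.smul_def, map_smul, smul_eq_mul, mul_comm (coeff s P), ← Algebra.smul_def,
      map_smul, smul_eq_mul, mul_comm]
  have h2 := (algebraicIndependent_iff.1 (algebraicIndependent_word hB)) Q hQ
  have h3 := congrArg (coeff s₀) h2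
  simp only [Q, coeff_sum, coeff_monomial, coeff_zero, Finset.sum_ite_eq'] at h3
  split_ifs at h3 with h4
  · exact h3
  · rw [notMem_support_iff.1 h4, map_zero]

end

end CycSums

/-! ### K(n)[x] as a simple difference ring of sequences -/

namespace CycSums

/-! ### Evaluation of `K(n)[x]` on sequences -/

theorem seqClass_eq_iff (K : Type*) {f g : ℕ → K} :
    seqClass K f = seqClass K g ↔ ∀ᶠ n in Filter.atTop, f n = g n := Filter.Germ.coe_eq

theorem exists_seqClass (K : Type*) (s : SeqRing K) : ∃ f, seqClass K f = s :=
  Filter.Germ.inductionOn s fun f => ⟨f, rfl⟩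

section
variable (K : Type*) [Field K]

theorem seqClass_mul (f g : ℕ → K) :
    seqClass K (fun n => f n * g n) = seqClass K f * seqClass K g := rfl

theorem seqClass_add (f g : ℕ → K) :
    seqClass K (fun n => f n + g n) = seqClass K f + seqClass K g := rfl

theorem seqShift_seqClass (f : ℕ → K) :
    seqShift K (seqClass K f) = seqClass K fun n => f (n + 1) := rfl

theorem exists_const_of_seqShift_eq {s : SeqRing K} (h : seqShift K s = s) :
    ∃ c, s = seqClass K fun _ => c := by
  obtain ⟨f, rfl⟩ := exists_seqClass K s
  rw [seqShift_seqClass, seqClass_eq_iff, Filter.eventually_atTop] at h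
  obtain ⟨N, hN⟩ := h
  refine ⟨f N, (seqClass_eq_iff K).2 (Filter.eventually_atTop.2 ⟨N, fun n hn => ?_⟩)⟩
  induction n, hn using Nat.le_induction with
  | base => rfl
  | succ n hn ih => rw [hN n hn, ih]

theorem ratShift_algebraMap (p : Polynomial K) :
    ratShift K (algebraMap (Polynomial K) (RatFunc K) p)
      = algebraMap (Polynomial K) (RatFunc K) (p.comp (Polynomial.X + 1)) := by
  have h := RatFunc.map_apply_div (Polynomial.compRingHom (Polynomial.X + 1 : Polynomial K))
    (by
      intro p hp
      rw [mem_nonZeroDivisors_iff_ne_zero] at hp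
      rw [Submonoid.mem_comap, mem_nonZeroDivisors_iff_ne_zero]
      intro h
      apply hp
      have h' : p.comp (Polynomial.X + Polynomial.C 1) = 0 := by simpa using h
      exact (Polynomial.comp_X_add_C_eq_zero_iff).1 h') p 1
  simp only [map_one, div_one] at h
  exact h

theorem baseShift_ofRat (f : RatFunc K) : baseShift K (ofRat K f) = ofRat K (ratShift K f) :=
  AdjoinRoot.lift_of _

theorem baseShift_altSign : baseShift K (altSign K) = -altSign K :=
  AdjoinRoot.lift_root _

theorem exists_eq_ofRat_add (r : BaseRing K) :
    ∃ p q : RatFunc K, r = ofRat K p + ofRat K q * altSign K := by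
  refine AdjoinRoot.induction_on _ r fun f => ?_
  induction f using Polynomial.induction_on' with
  | add f g hf hg =>
    obtain ⟨p, q, h⟩ := hf
    obtain ⟨p', q', h'⟩ := hg
    refine ⟨p + p', q + q', ?_⟩
    rw [map_add, h, h', map_add, map_add]
    ring
  | monomial n a =>
    have h : AdjoinRoot.mk (Polynomial.X ^ 2 - 1) (Polynomial.monomial n a)
        = ofRat K a * altSign K ^ n := by
      rw [← Polynomial.C_mul_X_pow_eq_monomial, map_mul, map_pow]
      rfl
    rw [h]
    have h2 : altSign K ^ 2 = 1 := (pow_two _).trans (altSign_mul_self K)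
    rcases Nat.even_or_odd' n with ⟨m, rfl | rfl⟩
    · exact ⟨a, 0, by rw [pow_mul (altSign K), h2, one_pow, map_zero]; ring⟩
    · exact ⟨0, a, by rw [pow_succ (altSign K), pow_mul (altSign K), h2, one_pow, map_zero]; ring⟩

/-- The specialization `x ↦ e` for a sign `e`. -/
def signHom (e : RatFunc K) (he : e * e = 1) : BaseRing K →+* RatFunc K :=
  AdjoinRoot.lift (RingHom.id _) e (by simp [pow_two, he])

theorem signHom_apply (e : RatFunc K) (he : e * e = 1) (p q : RatFunc K) :
    signHom K e he (ofRat K p + ofRat K q * altSign K) = p + q * e := by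
  have h1 : ∀ p, signHom K e he (ofRat K p) = p := fun p => AdjoinRoot.lift_of _
  have h2 : signHom K e he (altSign K) = e := AdjoinRoot.lift_root _
  rw [map_add, map_mul, h1, h1, h2]

theorem ratShift_surjective : Function.Surjective (ratShift K) := by
  intro f
  have h : ∀ p : Polynomial K, ∃ g,
      ratShift K g = algebraMap (Polynomial K) (RatFunc K) p := fun p =>
    ⟨algebraMap _ _ (p.comp (Polynomial.X - 1)), by
      rw [ratShift_algebraMap, Polynomial.comp_assoc]
      simp⟩
  obtain ⟨a, ha⟩ := h f.num
  obtain ⟨b, hb⟩ := h f.denom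
  exact ⟨a / b, by rw [map_div₀, ha, hb, RatFunc.num_div_denom]⟩

variable [CharZero K]

theorem ofRat_add_eq_zero {p q : RatFunc K} (h : ofRat K p + ofRat K q * altSign K = 0) :
    p = 0 ∧ q = 0 := by
  have h1 := signHom_apply K 1 (by ring) p q
  have h2 := signHom_apply K (-1) (by ring) p q
  rw [h, map_zero] at h1 h2
  constructor
  · linear_combination (exp := 1) (-1 / 2 : RatFunc K) * h1 - (1 / 2 : RatFunc K) * h2
  · linear_combination (exp := 1) (-1 / 2 : RatFunc K) * h1 + (1 / 2 : RatFunc K) * h2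

/-- The ring `K(n)[x]` is a simple difference ring. -/
theorem exists_mul_add_shift_eq_one {r : BaseRing K} (hr : r ≠ 0) :
    ∃ s, s * r + baseShift K (s * r) = 1 := by
  have key : ∀ (p q e : RatFunc K), (e = 1 ∨ e = -1) → ratShift K e = e → p + q * e ≠ 0 →
      ∃ s, s * (ofRat K p + ofRat K q * altSign K)
        + baseShift K (s * (ofRat K p + ofRat K q * altSign K)) = 1 := by
    intro p q e he hse hne
    -- The idempotent `(1 + e x) / 2` is the projection to `x = e`, where `r` takes the invertible
    -- value `p + q e`. So `s r` is this idempotent, and `σ` turns it into the complementary one `(1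
    -- - e x) / 2`.
    refine ⟨ofRat K (p + q * e)⁻¹ * ofRat K (1 / 2) * (1 + ofRat K e * altSign K), ?_⟩
    have hx := altSign_mul_self K
    have he2 : e * e = 1 := by rcases he with rfl | rfl <;> ring
    have he3 : ofRat K e * ofRat K e = 1 := by rw [← map_mul, he2, map_one]
    have h1 : ofRat K (p + q * e)⁻¹ * ofRat K (p + q * e) = 1 := by
      rw [← map_mul, inv_mul_cancel₀ hne, map_one]
    have h2 : ofRat K (1 / 2) * 2 = 1 := by
      have : (2 : BaseRing K) = ofRat K 2 := by rw [map_ofNat]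
      rw [this, ← map_mul]
      norm_num
    have h3 : ofRat K (p + q * e)⁻¹ * ofRat K (1 / 2) * (1 + ofRat K e * altSign K)
        * (ofRat K p + ofRat K q * altSign K)
        = ofRat K (1 / 2) * (1 + ofRat K e * altSign K) := by
      rw [map_add, map_mul] at h1
      linear_combination ofRat K (1 / 2) * (1 + ofRat K e * altSign K) * h1
        + ofRat K (p + q * e)⁻¹ * ofRat K (1 / 2) * ofRat K q * ofRat K e * hx
        - ofRat K (p + q * e)⁻¹ * ofRat K (1 / 2) * ofRat K q * altSign K * he3
    have h4 : ratShift K (1 / 2) = 1 / 2 := by rw [map_div₀, map_one, map_ofNat]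
    rw [h3, map_mul, map_add, map_one, map_mul, baseShift_ofRat, baseShift_ofRat,
      baseShift_altSign, hse, h4]
    linear_combination h2
  obtain ⟨p, q, rfl⟩ := exists_eq_ofRat_add K r
  -- A nonzero `r` is nonzero at `x = 1` or at `x = -1`.
  by_cases h1 : p + q * 1 = 0
  · refine key p q (-1) (Or.inr rfl) (by rw [map_neg, map_one]) fun h2 => hr ?_
    have hp : p = 0 := by linear_combination (1 / 2 : RatFunc K) * h1 + (1 / 2 : RatFunc K) * h2
    have hq : q = 0 := by linear_combination (1 / 2 : RatFunc K) * h1 - (1 / 2 : RatFunc K) * h2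
    rw [hp, hq, map_zero, zero_mul, add_zero]
  · exact key p q 1 (Or.inl rfl) (map_one _) h1

theorem eventually_eval_ne_zero {q : Polynomial K} (hq : q ≠ 0) :
    ∀ᶠ n : ℕ in Filter.atTop, q.eval (n : K) ≠ 0 := by
  have hfin : {n : ℕ | q.eval (n : K) = 0}.Finite := by
    refine Set.Finite.preimage (f := fun n : ℕ => (n : K)) (Nat.cast_injective.injOn)
      (Polynomial.finite_setOfPred_isRoot hq)
  have := hfin.eventually_cofinite_notMem
  rw [Nat.cofinite_eq_atTop] at this
  exact this

theorem eventually_denom_ne_zero (f : RatFunc K) :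
    ∀ᶠ n : ℕ in Filter.atTop, Polynomial.eval₂ (RingHom.id K) (n : K) f.denom ≠ 0 := by
  filter_upwards [eventually_eval_ne_zero K f.denom_ne_zero] with n hn
  rwa [Polynomial.eval₂_id]

/-- Evaluation of rational functions at the natural numbers. -/
def ratToSeq : RatFunc K →+* SeqRing K where
  toFun f := seqClass K fun n => RatFunc.eval (RingHom.id K) (n : K) f
  map_one' := by simp only [RatFunc.eval_one]; rfl
  map_zero' := by simp only [RatFunc.eval_zero]; rfl
  -- At a zero of the denominator `RatFunc.eval` has the default value 0 and need not be
  -- multiplicative; only finitely many `n` are affected, and germs ignore them.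
  map_mul' f g := by
    rw [← seqClass_mul, seqClass_eq_iff]
    filter_upwards [eventually_denom_ne_zero K f, eventually_denom_ne_zero K g] with n h1 h2
    exact RatFunc.eval_mul _ _ h1 h2
  map_add' f g := by
    rw [← seqClass_add, seqClass_eq_iff]
    filter_upwards [eventually_denom_ne_zero K f, eventually_denom_ne_zero K g] with n h1 h2
    exact RatFunc.eval_add _ _ h1 h2

theorem ratToSeq_algebraMap (p : Polynomial K) :
    ratToSeq K (algebraMap (Polynomial K) (RatFunc K) p) = seqClass K fun n => p.eval (n : K) := by
  change seqClass K _ = _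
  congr 1
  funext n
  rw [RatFunc.eval_algebraMap]
  simp

/-- Evaluation of `K(n)[x]` at the natural numbers. -/
def baseToSeq : BaseRing K →+* SeqRing K :=
  AdjoinRoot.lift (ratToSeq K) (seqClass K fun n => (-1) ^ n) (by
    have h : seqClass K (fun n => (-1) ^ n) ^ 2 = 1 := by
      rw [pow_two, ← seqClass_mul]
      simp only [← mul_pow, mul_neg, mul_one, neg_neg, one_pow]
      rfl
    simp [h])

theorem baseToSeq_ofRat (f : RatFunc K) : baseToSeq K (ofRat K f) = ratToSeq K f :=
  AdjoinRoot.lift_of _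

theorem baseToSeq_altSign : baseToSeq K (altSign K) = seqClass K fun n => (-1) ^ n :=
  AdjoinRoot.lift_root _

theorem ratToSeq_ratShift (f : RatFunc K) :
    ratToSeq K (ratShift K f) = seqShift K (ratToSeq K f) := by
  have h : (ratToSeq K).comp (ratShift K)
      = (seqShift K : SeqRing K →+* SeqRing K).comp (ratToSeq K) := by
    refine IsLocalization.ringHom_ext (nonZeroDivisors (Polynomial K)) (RingHom.ext fun p => ?_)
    simp only [RingHom.comp_apply, ratShift_algebraMap, ratToSeq_algebraMap, RingHom.coe_coe,
      seqShift_seqClass]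
    simp [Polynomial.eval_comp]
  exact DFunLike.congr_fun h f

theorem baseToSeq_baseShift (r : BaseRing K) :
    baseToSeq K (baseShift K r) = seqShift K (baseToSeq K r) := by
  have h : (baseToSeq K).comp (baseShift K)
      = (seqShift K : SeqRing K →+* SeqRing K).comp (baseToSeq K) := by
    refine AdjoinRoot.ringHom_ext (RingHom.ext fun f => ?_) ?_
    · change baseToSeq K (baseShift K (ofRat K f)) = seqShift K (baseToSeq K (ofRat K f))
      rw [baseShift_ofRat, baseToSeq_ofRat, baseToSeq_ofRat, ratToSeq_ratShift]
    · change baseToSeq K (baseShift K (altSign K)) = seqShift K (baseToSeq K (altSign K))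
      rw [baseShift_altSign, map_neg, baseToSeq_altSign, seqShift_seqClass]
      simp only [pow_succ, mul_neg, mul_one]
      rfl
  exact DFunLike.congr_fun h r

theorem baseToSeq_algebraMap (c : K) :
    baseToSeq K (algebraMap K (BaseRing K) c) = seqClass K fun _ => c := by
  have : algebraMap K (BaseRing K) c
      = ofRat K (algebraMap (Polynomial K) (RatFunc K) (Polynomial.C c)) := by
    rw [IsScalarTower.algebraMap_apply K (RatFunc K) (BaseRing K)]
    rfl
  rw [this, baseToSeq_ofRat, ratToSeq_algebraMap]
  simp

/-- The kernel is a shift-stable ideal, so a nonzero element in it would put 1 into it. -/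
theorem baseToSeq_injective : Function.Injective (baseToSeq K) := by
  refine (injective_iff_map_eq_zero _).2 fun r hr => ?_
  by_contra hne
  obtain ⟨s, hs⟩ := exists_mul_add_shift_eq_one K hne
  have h := congrArg (baseToSeq K) hs
  rw [map_add, baseToSeq_baseShift, map_mul, hr, mul_zero, map_zero, add_zero, map_one] at h
  exact zero_ne_one h

theorem exists_const_of_baseShift_eq {r : BaseRing K} (h : baseShift K r = r) :
    ∃ c : K, r = algebraMap K (BaseRing K) c := by
  obtain ⟨c, hc⟩ := exists_const_of_seqShift_eq K
    ((baseToSeq_baseShift K r).symm.trans (congrArg _ h))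
  exact ⟨c, baseToSeq_injective K (by rw [hc, baseToSeq_algebraMap])⟩

theorem baseShift_algebraMap (c : K) :
    baseShift K (algebraMap K (BaseRing K) c) = algebraMap K (BaseRing K) c :=
  baseToSeq_injective K (by
    rw [baseToSeq_baseShift, baseToSeq_algebraMap, seqShift_seqClass])

theorem baseShift_surjective : Function.Surjective (baseShift K) := by
  intro r
  obtain ⟨p, q, rfl⟩ := exists_eq_ofRat_add K r
  obtain ⟨a, rfl⟩ := ratShift_surjective K p
  obtain ⟨b, rfl⟩ := ratShift_surjective K q
  refine ⟨ofRat K a + ofRat K (-b) * altSign K, ?_⟩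
  rw [map_add, map_mul, baseShift_ofRat, baseShift_ofRat, baseShift_altSign, map_neg, map_neg]
  ring

/-- The value `n = 0` must be excluded because `b` may be 0. -/
theorem linear_ne_zero (l : Letter) {n : ℕ} (hn : 1 ≤ n) : (l.a : K) * n + l.b ≠ 0 := by
  have h : l.a * n + l.b ≠ 0 := by
    have := Nat.mul_pos (Nat.zero_lt_of_lt l.b_lt) hn
    omega
  exact_mod_cast h

theorem baseToSeq_lambdaBar (l : Letter) :
    baseToSeq K (lambdaBar K l) = seqClass K (lambda K l) := by
  set u : RatFunc K := ((l.a : RatFunc K) * RatFunc.X + (l.b : RatFunc K)) ^ l.c with hu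
  set p : Polynomial K := ((l.a : Polynomial K) * Polynomial.X + (l.b : Polynomial K)) ^ l.c with hp
  have hup : u = algebraMap (Polynomial K) (RatFunc K) p := by
    rw [hu, hp]
    simp
  have hpn : ∀ n : ℕ, p.eval (n : K) = ((l.a : K) * n + l.b) ^ l.c := by
    intro n
    rw [hp]
    simp
  have hseq : ratToSeq K u * (seqClass K fun n => (((l.a : K) * n + l.b) ^ l.c)⁻¹) = 1 := by
    rw [hup, ratToSeq_algebraMap, ← seqClass_mul]
    refine (seqClass_eq_iff K).2 (Filter.eventually_atTop.2 ⟨1, fun n hn => ?_⟩)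
    rw [hpn]
    exact mul_inv_cancel₀ (pow_ne_zero _ (linear_ne_zero K l hn))
  have hu0 : u ≠ 0 := by
    intro h
    rw [h, map_zero, zero_mul] at hseq
    exact zero_ne_one hseq
  have hinv : ratToSeq K u⁻¹ = seqClass K fun n => (((l.a : K) * n + l.b) ^ l.c)⁻¹ := by
    have h : ratToSeq K u⁻¹ * ratToSeq K u = 1 := by
      rw [← map_mul, inv_mul_cancel₀ hu0, map_one]
    calc ratToSeq K u⁻¹ = ratToSeq K u⁻¹ * (ratToSeq K u
          * (seqClass K fun n => (((l.a : K) * n + l.b) ^ l.c)⁻¹)) := by rw [hseq, mul_one]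
      _ = _ := by rw [← mul_assoc, h, one_mul]
  have hz : baseToSeq K (if l.z = 1 then 1 else altSign K)
      = seqClass K fun n => ((l.z : ℤ) : K) ^ n := by
    rcases Int.units_eq_one_or l.z with h | h
    · rw [h, if_pos rfl, map_one]
      simp only [Units.val_one, Int.cast_one, one_pow]
      rfl
    · rw [h, if_neg (by decide), baseToSeq_altSign]
      simp
  have hl : lambdaBar K l = (if l.z = 1 then 1 else altSign K) * ofRat K u⁻¹ := by
    rw [lambdaBar]
  rw [hl, map_mul, hz, baseToSeq_ofRat, hinv, ← seqClass_mul]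
  congr 1
  funext n
  exact (div_eq_mul_inv _ _).symm

end

end CycSums

/-! ### Poles of rational functions and the absence of telescoping -/

namespace CycSums

section
variable {K : Type*} [Field K]

/-! ### Values of rational functions at regular points -/

/-- The rational function `f` is regular at `α`, with the value `v`. -/
def HasValueAt (α : K) (f : RatFunc K) (v : K) : Prop :=
  ∃ P Q : Polynomial K, Q.eval α ≠ 0 ∧ v * Q.eval α = P.eval α ∧
    f * algebraMap (Polynomial K) (RatFunc K) Q = algebraMap (Polynomial K) (RatFunc K) P

theorem HasValueAt.unique {α : K} {f : RatFunc K} {v w : K} (hv : HasValueAt α f v)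
    (hw : HasValueAt α f w) : v = w := by
  obtain ⟨P, Q, hQ, h1, h2⟩ := hv
  obtain ⟨P', Q', hQ', h1', h2'⟩ := hw
  have h : P * Q' = P' * Q := by
    apply IsFractionRing.injective (Polynomial K) (RatFunc K)
    rw [map_mul, map_mul, ← h2, ← h2']
    ring
  have h3 := congrArg (Polynomial.eval α) h
  rw [Polynomial.eval_mul, Polynomial.eval_mul, ← h1, ← h1'] at h3
  refine mul_right_cancel₀ (mul_ne_zero hQ hQ') ?_
  linear_combination h3

theorem HasValueAt.add {α : K} {f g : RatFunc K} {v w : K} (hf : HasValueAt α f v)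
    (hg : HasValueAt α g w) : HasValueAt α (f + g) (v + w) := by
  obtain ⟨P, Q, hQ, h1, h2⟩ := hf
  obtain ⟨P', Q', hQ', h1', h2'⟩ := hg
  refine ⟨P * Q' + P' * Q, Q * Q', ?_, ?_, ?_⟩
  · rw [Polynomial.eval_mul]; exact mul_ne_zero hQ hQ'
  · rw [Polynomial.eval_mul, Polynomial.eval_add, Polynomial.eval_mul, Polynomial.eval_mul,
      ← h1, ← h1']
    ring
  · rw [map_mul, map_add, map_mul, map_mul, ← h2, ← h2']
    ring

theorem HasValueAt.mul {α : K} {f g : RatFunc K} {v w : K} (hf : HasValueAt α f v)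
    (hg : HasValueAt α g w) : HasValueAt α (f * g) (v * w) := by
  obtain ⟨P, Q, hQ, h1, h2⟩ := hf
  obtain ⟨P', Q', hQ', h1', h2'⟩ := hg
  refine ⟨P * P', Q * Q', ?_, ?_, ?_⟩
  · rw [Polynomial.eval_mul]; exact mul_ne_zero hQ hQ'
  · rw [Polynomial.eval_mul, Polynomial.eval_mul, ← h1, ← h1']
    ring
  · rw [map_mul, map_mul, ← h2, ← h2']
    ring

theorem hasValueAt_algebraMap (α : K) (P : Polynomial K) :
    HasValueAt α (algebraMap (Polynomial K) (RatFunc K) P) (P.eval α) :=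
  ⟨P, 1, by simp, by simp, by simp⟩

theorem hasValueAt_C (α c : K) : HasValueAt α (RatFunc.C c) c := by
  have := hasValueAt_algebraMap α (Polynomial.C c)
  rwa [Polynomial.eval_C] at this

theorem HasValueAt.pow {α : K} {f : RatFunc K} {v : K} (hf : HasValueAt α f v) (n : ℕ) :
    HasValueAt α (f ^ n) (v ^ n) := by
  induction n with
  | zero => simpa using hasValueAt_C α 1
  | succ n ih => rw [pow_succ, pow_succ]; exact ih.mul hf

theorem HasValueAt.inv {α : K} {f : RatFunc K} {v : K} (hf : HasValueAt α f v) (hv : v ≠ 0) :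
    HasValueAt α f⁻¹ v⁻¹ := by
  obtain ⟨P, Q, hQ, h1, h2⟩ := hf
  have hP : P.eval α ≠ 0 := h1 ▸ mul_ne_zero hv hQ
  refine ⟨Q, P, hP, by rw [← h1]; field_simp, ?_⟩
  have hP0 : algebraMap (Polynomial K) (RatFunc K) P ≠ 0 := RatFunc.algebraMap_ne_zero (by
    rintro rfl
    exact hP Polynomial.eval_zero)
  have hf0 : f ≠ 0 := by
    rintro rfl
    exact hP0 (by rw [← h2, zero_mul])
  rw [← h2, inv_mul_cancel_left₀ hf0]

theorem HasValueAt.sum {α : K} {ι : Type*} (s : Finset ι) {f : ι → RatFunc K} {v : ι → K}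
    (h : ∀ i ∈ s, HasValueAt α (f i) (v i)) : HasValueAt α (∑ i ∈ s, f i) (∑ i ∈ s, v i) := by
  classical
  induction s using Finset.induction_on with
  | empty =>
    rw [Finset.sum_empty, Finset.sum_empty]
    simpa using hasValueAt_C α 0
  | insert i s hi ih =>
    rw [Finset.sum_insert hi, Finset.sum_insert hi]
    exact (h i (Finset.mem_insert_self i s)).add
      (ih fun j hj => h j (Finset.mem_insert_of_mem hj))

theorem hasValueAt_ratShift_iff {α : K} {f : RatFunc K} {v : K} :
    HasValueAt α (ratShift K f) v ↔ HasValueAt (α + 1) f v := by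
  constructor
  · rintro ⟨P, Q, hQ, h1, h2⟩
    have hcomp : ∀ P : Polynomial K,
        (P.comp (Polynomial.X - 1)).comp (Polynomial.X + 1) = P := fun P => by
      rw [Polynomial.comp_assoc]
      simp
    refine ⟨P.comp (Polynomial.X - 1), Q.comp (Polynomial.X - 1), ?_, ?_, ?_⟩
    · simpa [Polynomial.eval_comp] using hQ
    · simpa [Polynomial.eval_comp] using h1
    · apply (ratShift K).injective
      rw [map_mul, ratShift_algebraMap, ratShift_algebraMap, hcomp, hcomp, h2]
  · rintro ⟨P, Q, hQ, h1, h2⟩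
    refine ⟨P.comp (Polynomial.X + 1), Q.comp (Polynomial.X + 1), ?_, ?_, ?_⟩
    · simpa [Polynomial.eval_comp] using hQ
    · simpa [Polynomial.eval_comp] using h1
    · rw [← ratShift_algebraMap, ← ratShift_algebraMap, ← map_mul, h2]

/-- The rational function `f` is regular at `α`. -/
def RegularAt (α : K) (f : RatFunc K) : Prop := ∃ v, HasValueAt α f v

theorem RegularAt.add {α : K} {f g : RatFunc K} : RegularAt α f → RegularAt α g →
    RegularAt α (f + g) :=
  fun ⟨_, hf⟩ ⟨_, hg⟩ => ⟨_, hf.add hg⟩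

theorem RegularAt.mul {α : K} {f g : RatFunc K} : RegularAt α f → RegularAt α g →
    RegularAt α (f * g) :=
  fun ⟨_, hf⟩ ⟨_, hg⟩ => ⟨_, hf.mul hg⟩

theorem regularAt_ratShift_iff {α : K} {f : RatFunc K} :
    RegularAt α (ratShift K f) ↔ RegularAt (α + 1) f :=
  exists_congr fun _ => hasValueAt_ratShift_iff

/-- The function `a n + b` of a letter. -/
def letterLinear (K : Type*) [Field K] (l : Letter) : RatFunc K :=
  (l.a : RatFunc K) * RatFunc.X + (l.b : RatFunc K)

theorem hasValueAt_letterLinear (l : Letter) (α : K) :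
    HasValueAt α (letterLinear K l) (l.a * α + l.b) := by
  have := hasValueAt_algebraMap α ((l.a : Polynomial K) * Polynomial.X + (l.b : Polynomial K))
  simpa [letterLinear] using this

theorem baseShift_lambdaBar (l : Letter) : baseShift K (lambdaBar K l)
    = (if l.z = 1 then 1 else -altSign K) * ofRat K (ratShift K (letterLinear K l ^ l.c)⁻¹) := by
  rw [lambdaBar, map_mul, baseShift_ofRat]
  split_ifs
  · rw [map_one]; rfl
  · rw [baseShift_altSign]; rfl

variable [CharZero K]

/-- With `ε = 1` and `ε = -1` this supplies regular points far to the right and far to the left of a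
pole. -/
theorem eventually_regularAt (f : RatFunc K) (α ε : K) (hε : ε ≠ 0) :
    ∀ᶠ n : ℕ in Filter.atTop, RegularAt (α + ε * n) f := by
  have hfin : {n : ℕ | f.denom.eval (α + ε * n) = 0}.Finite := by
    refine Set.Finite.preimage (f := fun n : ℕ => α + ε * n) (fun m _ n _ h => ?_)
      (Polynomial.finite_setOfPred_isRoot f.denom_ne_zero)
    exact Nat.cast_injective (mul_left_cancel₀ hε (add_left_cancel h))
  have h := hfin.eventually_cofinite_notMem
  rw [Nat.cofinite_eq_atTop] at h
  filter_upwards [h] with n hn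
  refine ⟨_, f.num, f.denom, hn, div_mul_cancel₀ _ hn, ?_⟩
  exact ((div_eq_iff (RatFunc.algebraMap_ne_zero f.denom_ne_zero)).1 f.num_div_denom).symm

/-! ### Linear combinations of letters do not telescope -/

theorem letterLinear_ne_zero (l : Letter) : letterLinear K l ≠ 0 := by
  intro h
  have h1 := hasValueAt_letterLinear l (1 : K)
  have h2 : HasValueAt (1 : K) 0 0 := by simpa using hasValueAt_C (1 : K) 0
  rw [h] at h1
  have h3 := h1.unique h2
  have := linear_ne_zero K l le_rfl
  rw [Nat.cast_one] at this
  exact this h3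

/-- The zeros `-b / a` lie in `(-1, 0]`, so they cannot differ by a nonzero integer; equal fractions
in lowest terms have equal numerators and denominators. -/
theorem eq_of_letterLinear_eq_zero {l m : Letter} {α : K} (hl : (l.a : K) * α + l.b = 0)
    {j : ℤ} (hm : (m.a : K) * (α + j) + m.b = 0) : j = 0 ∧ l.a = m.a ∧ l.b = m.b := by
  have h : (l.b * m.a : K) - m.b * l.a = j * (l.a * m.a) := by
    linear_combination (m.a : K) * hl - (l.a : K) * hm
  have h' : (l.b * m.a : ℤ) - m.b * l.a = j * (l.a * m.a) := by exact_mod_cast h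
  have h1 : (l.b : ℤ) * m.a < l.a * m.a := by
    exact_mod_cast Nat.mul_lt_mul_of_pos_right l.b_lt (Nat.zero_lt_of_lt m.b_lt)
  have h2 : (m.b : ℤ) * l.a < l.a * m.a := by
    rw [mul_comm (l.a : ℤ)]
    exact_mod_cast Nat.mul_lt_mul_of_pos_right m.b_lt (Nat.zero_lt_of_lt l.b_lt)
  have h3 : (0 : ℤ) ≤ l.b * m.a := by positivity
  have h4 : (0 : ℤ) ≤ m.b * l.a := by positivity
  have hj : j = 0 := by
    by_contra hj
    rcases lt_or_gt_of_ne hj with hj | hj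
    · nlinarith
    · nlinarith
  refine ⟨hj, ?_⟩
  by_contra hne
  refine det_ne hne ?_
  rw [hj, zero_mul] at h'
  have h5 : (l.b : ℚ) * m.a - m.b * l.a = 0 := by exact_mod_cast h'
  linear_combination -h5

/-- A linear combination of functions `1 / (a n + b) ^ c` that is regular at the pole `-b / a` of
one of them does not involve the latter. -/
theorem coeff_eq_zero_of_regularAt {s : Finset Letter} {k : Letter → K} {l₀ : Letter}
    (hs : ∀ l ∈ s, l.z = l₀.z) (hl₀ : l₀ ∈ s)
    (hmax : ∀ l ∈ s, l.a = l₀.a → l.b = l₀.b → k l ≠ 0 → l.c ≤ l₀.c) {α : K}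
    (hα : (l₀.a : K) * α + l₀.b = 0)
    (hreg : RegularAt α (∑ l ∈ s, RatFunc.C (k l) * (letterLinear K l ^ l.c)⁻¹)) :
    k l₀ = 0 := by
  classical
  obtain ⟨v, hv⟩ := hreg
  have hzero : HasValueAt α (letterLinear K l₀) 0 := hα ▸ hasValueAt_letterLinear l₀ α
  -- Multiply by the power of the linear factor that cancels the pole of `l₀` and evaluate at `α`:
  -- every other term becomes 0, by maximality of `l₀.c` for the same factor.
  have h1 := hv.mul (hzero.pow l₀.c)
  rw [zero_pow l₀.c_pos.ne', mul_zero, Finset.sum_mul] at h1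
  have h2 : HasValueAt α
      (∑ l ∈ s, RatFunc.C (k l) * (letterLinear K l ^ l.c)⁻¹ * letterLinear K l₀ ^ l₀.c)
      (∑ l ∈ s, if l = l₀ then k l₀ else 0) := by
    refine HasValueAt.sum s fun l hl => ?_
    have hl₀0 := pow_ne_zero l₀.c (letterLinear_ne_zero (K := K) l₀)
    by_cases hll : l = l₀
    · subst hll
      rw [if_pos rfl, inv_mul_cancel_right₀ hl₀0]
      exact hasValueAt_C α _
    rw [if_neg hll]
    by_cases hk : k l = 0
    · rw [hk, map_zero, zero_mul, zero_mul]
      simpa using hasValueAt_C α 0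
    by_cases hab : l.a = l₀.a ∧ l.b = l₀.b
    · have hle := hmax l hl hab.1 hab.2 hk
      have hlt : l.c < l₀.c := by
        refine lt_of_le_of_ne hle fun hc => hll ?_
        have hz := hs l hl
        cases l; cases l₀; simp_all
      have he : letterLinear K l = letterLinear K l₀ := by
        rw [letterLinear, letterLinear, hab.1, hab.2]
      have : RatFunc.C (k l) * (letterLinear K l ^ l.c)⁻¹ * letterLinear K l₀ ^ l₀.c
          = RatFunc.C (k l) * letterLinear K l₀ ^ (l₀.c - l.c) := by
        rw [he, ← pow_sub_mul_pow (letterLinear K l₀) hle]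
        have := pow_ne_zero l.c (letterLinear_ne_zero (K := K) l₀)
        field_simp
      rw [this]
      have h3 := (hasValueAt_C α (k l)).mul (hzero.pow (l₀.c - l.c))
      rwa [zero_pow (by omega), mul_zero] at h3
    · have hne : (l.a : K) * α + l.b ≠ 0 := by
        intro h0
        have := (eq_of_letterLinear_eq_zero hα (j := 0) (m := l)
          (by rw [Int.cast_zero, add_zero]; exact h0)).2
        exact hab ⟨this.1.symm, this.2.symm⟩
      have h3 := ((hasValueAt_C α (k l)).mul (((hasValueAt_letterLinear l α).pow l.c).inv
        (pow_ne_zero _ hne))).mul (hzero.pow l₀.c)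
      rwa [zero_pow l₀.c_pos.ne', mul_zero] at h3
  rw [Finset.sum_ite_eq' s l₀, if_pos hl₀] at h2
  exact h2.unique h1

/-- On the orbit `β + ℤ` of a pole of the left-hand side there is no other pole of it. A pole of `g`
on this orbit would propagate indefinitely to the left or to the right, so `g` is regular at `β` and
`β + 1`, and the left-hand side would be regular at `β`. -/
theorem ratFunc_not_telescoping {s : Finset Letter} {k : Letter → K} {z : ℤˣ}
    (hs : ∀ l ∈ s, l.z = z) {g : RatFunc K} {ε : K} (hε : ε ≠ 0)
    (h : ∑ l ∈ s, RatFunc.C (k l) * ratShift K (letterLinear K l ^ l.c)⁻¹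
      = g + RatFunc.C ε * ratShift K g) : ∀ l ∈ s, k l = 0 := by
  classical
  by_contra hne
  push Not at hne
  obtain ⟨l₁, hl₁, hk₁⟩ := hne
  obtain ⟨l₀, hl₀, hmax⟩ := Finset.exists_max_image (s.filter fun l => k l ≠ 0) (fun l => l.c)
    ⟨l₁, Finset.mem_filter.2 ⟨hl₁, hk₁⟩⟩
  obtain ⟨hl₀s, hk₀⟩ := Finset.mem_filter.1 hl₀
  have ha : (l₀.a : K) ≠ 0 := Nat.cast_ne_zero.2 l₀.a_pos.ne'
  -- the pole of the shifted sum
  set β : K := -l₀.b / l₀.a - 1 with hβ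
  have hroot : (l₀.a : K) * (β + 1) + l₀.b = 0 := by rw [hβ]; field_simp; ring
  set H := ∑ l ∈ s, RatFunc.C (k l) * ratShift K (letterLinear K l ^ l.c)⁻¹ with hH
  have hHshift : H = ratShift K (∑ l ∈ s, RatFunc.C (k l) * (letterLinear K l ^ l.c)⁻¹) := by
    rw [hH, map_sum]
    refine Finset.sum_congr rfl fun l _ => ?_
    rw [map_mul]
    congr 1
    have := ratShift_algebraMap K (Polynomial.C (k l))
    rw [Polynomial.C_comp] at this
    exact this.symm
  have hHreg : ∀ j : ℤ, j ≠ 0 → RegularAt (β + j) H := by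
    intro j hj
    rw [hHshift, regularAt_ratShift_iff]
    refine ⟨_, HasValueAt.sum s fun l _ => (hasValueAt_C _ (k l)).mul
      (((hasValueAt_letterLinear l _).pow l.c).inv (pow_ne_zero _ fun h0 => hj ?_))⟩
    refine (eq_of_letterLinear_eq_zero hroot (j := j) (m := l) ?_).1
    rw [← h0]
    ring
  have hCreg : ∀ (α c : K), RegularAt α (RatFunc.C c) := fun α c => ⟨_, hasValueAt_C α c⟩
  -- For `j ≠ 0` the sum `H` is regular at `β + j`, so regularity of `g` passes between neighbouring
  -- points; the only gap in the chain is between `β` and `β + 1`.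
  have hiff : ∀ j : ℤ, j ≠ 0 → (RegularAt (β + j) g ↔ RegularAt (β + j + 1) g) := by
    intro j hj
    rw [← regularAt_ratShift_iff]
    constructor
    · intro hg
      have : ratShift K g = RatFunc.C ε⁻¹ * (H + RatFunc.C (-1) * g) := by
        have hC : RatFunc.C ε⁻¹ * RatFunc.C ε = 1 := by
          rw [← map_mul, inv_mul_cancel₀ hε, map_one]
        rw [h, map_neg, map_one]
        linear_combination -ratShift K g * hC
      rw [this]
      exact (hCreg _ _).mul ((hHreg j hj).add ((hCreg _ _).mul hg))
    · intro hg
      have : g = H + RatFunc.C (-ε) * ratShift K g := by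
        rw [h, map_neg]
        ring
      rw [this]
      exact (hHreg j hj).add ((hCreg _ _).mul hg)
  have hup : RegularAt (β + 1) g := by
    obtain ⟨n, hn⟩ := (eventually_regularAt g (β + 1) 1 one_ne_zero).exists
    rw [one_mul] at hn
    induction n with
    | zero => simpa using hn
    | succ n ih =>
      refine ih ?_
      have := (hiff (n + 1) (by omega)).2
      push_cast at this hn
      convert! this (by convert! hn using 1; ring) using 1
      ring
  have hdown : RegularAt β g := by
    obtain ⟨n, hn⟩ := (eventually_regularAt g β (-1) (neg_ne_zero.2 one_ne_zero)).exists
    induction n with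
    | zero => simpa using hn
    | succ n ih =>
      refine ih ?_
      have := (hiff (-(n + 1)) (by omega)).1
      push_cast at this hn
      convert! this (by convert! hn using 1; ring) using 1
      ring
  have hHβ : RegularAt β H := by
    rw [h]
    exact hdown.add ((hCreg _ _).mul (regularAt_ratShift_iff.2 hup))
  rw [hHshift, regularAt_ratShift_iff] at hHβ
  refine hk₀ (coeff_eq_zero_of_regularAt (fun l hl => (hs l hl).trans (hs l₀ hl₀s).symm) hl₀s
    (fun l hl _ _ hk => hmax l (Finset.mem_filter.2 ⟨hl, hk⟩)) hroot hHβ)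

/-- A linear combination of letters over `K` is not a difference of elements of `K(n)[x]`. -/
theorem not_telescoping {s : Finset Letter} {k : Letter → K} {g : BaseRing K}
    (h : ∑ l ∈ s, algebraMap K (BaseRing K) (k l) * baseShift K (lambdaBar K l)
      = g - baseShift K g) : ∀ l ∈ s, k l = 0 := by
  classical
  obtain ⟨p, q, rfl⟩ := exists_eq_ofRat_add K g
  have hC : ∀ c : K, algebraMap K (BaseRing K) c = ofRat K (RatFunc.C c) := fun c => by
    rw [IsScalarTower.algebraMap_apply K (RatFunc K) (BaseRing K)]
    rfl
  have hsum : ∑ l ∈ s, algebraMap K (BaseRing K) (k l) * baseShift K (lambdaBar K l)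
      = ofRat K (∑ l ∈ s with l.z = 1,
          RatFunc.C (k l) * ratShift K (letterLinear K l ^ l.c)⁻¹)
        + ofRat K (∑ l ∈ s with ¬ l.z = 1,
          RatFunc.C (-k l) * ratShift K (letterLinear K l ^ l.c)⁻¹) * altSign K := by
    rw [map_sum, map_sum, Finset.sum_mul, ← Finset.sum_filter_add_sum_filter_not s fun l => l.z = 1]
    congr 1
    · refine Finset.sum_congr rfl fun l hl => ?_
      rw [baseShift_lambdaBar, if_pos (Finset.mem_filter.1 hl).2, one_mul, hC, map_mul]
    · refine Finset.sum_congr rfl fun l hl => ?_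
      rw [baseShift_lambdaBar, if_neg (Finset.mem_filter.1 hl).2, hC, map_mul, map_neg, map_neg]
      ring
  rw [hsum, map_add, map_mul, baseShift_ofRat, baseShift_ofRat, baseShift_altSign] at h
  set A := ∑ l ∈ s with l.z = 1, RatFunc.C (k l) * ratShift K (letterLinear K l ^ l.c)⁻¹ with hA
  set D := ∑ l ∈ s with ¬ l.z = 1,
    RatFunc.C (-k l) * ratShift K (letterLinear K l ^ l.c)⁻¹ with hD
  -- Because `σ(x) = -x`, the `x`-component satisfies `D = q + σ(q)` while the other one satisfies
  -- `A = p - σ(p)`; hence the two values of `ε` below.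
  have h0 : ofRat K (A - (p - ratShift K p))
      + ofRat K (D - (q + ratShift K q)) * altSign K = 0 := by
    simp only [map_sub, map_add]
    linear_combination h
  obtain ⟨h1, h2⟩ := ofRat_add_eq_zero K h0
  intro l hl
  by_cases hz : l.z = 1
  · refine ratFunc_not_telescoping (s := s.filter fun l => l.z = 1) (z := 1) (g := p) (ε := -1)
      (fun m hm => (Finset.mem_filter.1 hm).2) (neg_ne_zero.2 one_ne_zero) ?_ l
      (Finset.mem_filter.2 ⟨hl, hz⟩)
    rw [map_neg, map_one]
    linear_combination h1
  · refine neg_eq_zero.1 (ratFunc_not_telescoping (s := s.filter fun l => ¬ l.z = 1)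
      (k := fun l => -k l) (z := -1) (g := q) (ε := 1)
      (fun m hm => (Int.units_eq_one_or m.z).resolve_left (Finset.mem_filter.1 hm).2)
      one_ne_zero ?_ l (Finset.mem_filter.2 ⟨hl, hz⟩))
    rw [map_one]
    linear_combination h2

end

end CycSums

/-! ### Linear independence of nested sums over K(n)[x] -/

namespace CycSums

section
variable (K : Type*) [Field K]

/-! ### Products of nested sums -/

theorem nestedSum_cons_zero (l : Letter) (w : List Letter) : nestedSum K (l :: w) 0 = 0 := rfl

theorem nestedSum_cons_succ (l : Letter) (w : List Letter) (n : ℕ) :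
    nestedSum K (l :: w) (n + 1)
      = nestedSum K (l :: w) n + lambda K l (n + 1) * nestedSum K w (n + 1) := by
  rw [nestedSum, nestedSum, Finset.sum_Icc_succ_top (by omega)]

variable [CharZero K]

theorem lambda_partialFractions {l₁ l₂ : Letter} (h : ¬ (l₁.a = l₂.a ∧ l₁.b = l₂.b)) (z : ℤˣ)
    {i : ℕ} (hi : 1 ≤ i) : ∀ (n c₁ c₂ : ℕ), c₁ + c₂ ≤ n → 0 < c₁ + c₂ →
      Finsupp.linearCombination ℚ (fun l => lambda K l i) (partialFractions l₁ l₂ z c₁ c₂)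
        = ((z : ℤ) : K) ^ i
          * ((((l₁.a : K) * i + l₁.b) ^ c₁)⁻¹ * (((l₂.a : K) * i + l₂.b) ^ c₂)⁻¹) := by
  intro n
  induction n with
  | zero => intro c₁ c₂ h1 h2; omega
  | succ n ih =>
    intro c₁ c₂ h1 h2
    match c₁, c₂ with
    | 0, 0 => omega
    | c₁ + 1, 0 =>
      simp [partialFractions, lambda, Letter.withExp, div_eq_mul_inv]
    | 0, c₂ + 1 =>
      simp [partialFractions, lambda, Letter.withExp, div_eq_mul_inv]
    | c₁ + 1, c₂ + 1 =>
      rw [partialFractions, map_smul, map_sub, map_smul, map_smul,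
        ih (c₁ + 1) c₂ (by omega) (by omega), ih c₁ (c₂ + 1) (by omega) (by omega)]
      have e1 := linear_ne_zero K l₁ hi
      have e2 := linear_ne_zero K l₂ hi
      have e3 : ((l₁.a : K) * l₂.b - l₂.a * l₁.b) ≠ 0 := by exact_mod_cast det_ne h
      simp only [Rat.smul_def]
      push_cast
      field_simp
      ring

theorem lambda_bracket (l₁ l₂ : Letter) {i : ℕ} (hi : 1 ≤ i) :
    ((bracket l₁ l₂).sum fun l q => q • lambda K l i) = lambda K l₁ i * lambda K l₂ i := by
  change Finsupp.linearCombination ℚ (fun l => lambda K l i) (bracket l₁ l₂) = _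
  unfold bracket
  split_ifs with h
  · rw [Finsupp.linearCombination_single, one_smul]
    simp only [lambda, Letter.withExp, ← h.1, ← h.2, Units.val_mul, Int.cast_mul, mul_pow, pow_add]
    rw [div_mul_div_comm]
  · rw [lambda_partialFractions K h _ hi _ _ _ le_rfl (Nat.add_pos_left l₁.c_pos _)]
    simp only [lambda, Units.val_mul, Int.cast_mul, mul_pow, div_eq_mul_inv]
    ring

/-- The linear extension of `w ↦ S_w(n)`. -/
def sumAt (n : ℕ) : QuasiShuffle ℚ →ₗ[ℚ] K :=
  (wordBasis ℚ).constr ℚ fun w => nestedSum K w n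

theorem sumAt_word (n : ℕ) (w : List Letter) : sumAt K n (word ℚ w) = nestedSum K w n := by
  simp only [sumAt, word, Module.Basis.constr_basis]

/-- At `n = 0` all sums of nonempty words vanish; the passage from `n` to `n + 1` is `mul_step`. -/
theorem sumAt_mulWord (n : ℕ) : ∀ u v : List Letter, sumAt K n (mulWord ℚ u v)
    = sumAt K n (word ℚ u) * sumAt K n (word ℚ v) := by
  induction n with
  | zero =>
    have h0 : ∀ l x, sumAt K 0 (cons ℚ l x) = 0 := by
      intro l x
      have : (sumAt K 0).comp (cons ℚ l) = 0 :=
        hom_ext_word fun w => by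
          rw [LinearMap.comp_apply, cons_word, sumAt_word, LinearMap.zero_apply,
            nestedSum_cons_zero]
      exact LinearMap.congr_fun this x
    intro u v
    match u, v with
    | [], v => rw [mulWord, sumAt_word K 0 [], nestedSum, one_mul]
    | l :: u, [] => rw [mulWord, sumAt_word K 0 [], nestedSum, mul_one]
    | l₁ :: u, l₂ :: v =>
      rw [mulWord, map_sub, map_add, h0, h0, ← cons_word, h0, consComb_eq_sum, Finsupp.sum,
        map_sum, Finset.sum_eq_zero]
      · simp
      · intro l _
        rw [map_smul, h0, smul_zero]
  | succ n ih =>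
    intro u v
    refine mul_step bracket (mulWord ℚ) (fun v => by rw [mulWord]) (fun l u => by rw [mulWord])
      (fun l₁ l₂ u v => by rw [mulWord]) (fun l => lambda K l (n + 1))
      (fun l₁ l₂ => lambda_bracket K l₁ l₂ (by omega)) (sumAt K n) (sumAt K (n + 1))
      (by rw [sumAt_word, nestedSum]) (fun l x => ?_) ih u v
    have : (sumAt K (n + 1)).comp (cons ℚ l)
        = (sumAt K n).comp (cons ℚ l) + lambda K l (n + 1) • sumAt K (n + 1) :=
      hom_ext_word fun w => by
        simp only [LinearMap.comp_apply, LinearMap.add_apply, LinearMap.smul_apply, cons_word,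
          sumAt_word, smul_eq_mul, nestedSum_cons_succ]
    exact LinearMap.congr_fun this x

/-! ### The quasi-shuffle algebra as a ring of sequences -/

instance : Algebra (BaseRing K) (SeqRing K) := (baseToSeq K).toAlgebra

instance : Nontrivial (BaseRing K) := (baseToSeq K).domain_nontrivial

theorem base_smul_eq (r : BaseRing K) (s : SeqRing K) : r • s = baseToSeq K r * s := rfl

/-- The linear map that sends each word to the sequence of its nested sum. -/
def wordsToSeq : QuasiShuffle (BaseRing K) →ₗ[BaseRing K] SeqRing K :=
  (wordBasis (BaseRing K)).constr (BaseRing K) fun w => seqClass K (nestedSum K w)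

theorem wordsToSeq_word (w : List Letter) :
    wordsToSeq K (word (BaseRing K) w) = seqClass K (nestedSum K w) := by
  simp only [wordsToSeq, word, Module.Basis.constr_basis]

theorem baseToSeq_algebraMap_rat (q : ℚ) :
    baseToSeq K (algebraMap ℚ (BaseRing K) q) = seqClass K fun _ => (q : K) := by
  have h : (algebraMap ℚ (BaseRing K))
      = (algebraMap K (BaseRing K)).comp (algebraMap ℚ K) := Subsingleton.elim _ _
  rw [h, RingHom.comp_apply, baseToSeq_algebraMap, eq_ratCast]

theorem wordsToSeq_extendScalars (x : QuasiShuffle ℚ) :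
    wordsToSeq K (extendScalars (BaseRing K) x) = seqClass K fun n => sumAt K n x := by
  have h1 : (fun n => sumAt K n x)
      = ∑ w ∈ wordSupport x, fun n => ((wordCoeff w x : ℚ) : K) * nestedSum K w n := by
    funext n
    conv_lhs => rw [← sum_wordSupport x]
    simp only [map_sum, map_smul, sumAt_word, Finset.sum_apply, Rat.smul_def]
  have h2 : ∀ f : ℕ → K, seqClass K f = Filter.Germ.coeRingHom Filter.atTop f := fun _ => rfl
  rw [h1, h2, map_sum]
  conv_lhs => rw [← sum_wordSupport x]
  rw [map_sum, map_sum]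
  refine Finset.sum_congr rfl fun w _ => ?_
  rw [map_smul, extendScalars_word, ← algebraMap_smul (BaseRing K), map_smul, wordsToSeq_word,
    base_smul_eq, baseToSeq_algebraMap_rat]
  rfl

theorem wordsToSeq_mul (x y : QuasiShuffle (BaseRing K)) :
    wordsToSeq K (x * y) = wordsToSeq K x * wordsToSeq K y := by
  refine map_mul_of_words (wordsToSeq K) (fun u v => ?_) x y
  rw [← extendScalars_mulWord, wordsToSeq_extendScalars, wordsToSeq_word, wordsToSeq_word,
    ← seqClass_mul]
  simp only [sumAt_mulWord, sumAt_word]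

theorem wordsToSeq_one : wordsToSeq K 1 = 1 := wordsToSeq_word K []

theorem wordsToSeq_shiftWordBy (w : List Letter) :
    wordsToSeq K (shiftWordBy (fun l => baseShift K (lambdaBar K l)) w)
      = seqShift K (seqClass K (nestedSum K w)) := by
  induction w with
  | nil => rw [shiftWordBy, wordsToSeq_word]; rfl
  | cons l w ih =>
    rw [shiftWordBy, map_add, map_smul, ih, wordsToSeq_word, base_smul_eq, baseToSeq_baseShift,
      baseToSeq_lambdaBar, seqShift_seqClass, seqShift_seqClass, seqShift_seqClass,
      ← seqClass_mul, ← seqClass_add]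
    simp only [nestedSum_cons_succ]

/-- The formal shift with respect to the shift of `K(n)[x]`. -/
abbrev wordShift (f : QuasiShuffle (BaseRing K)) : QuasiShuffle (BaseRing K) :=
  formalShift (baseShift K) (fun l => baseShift K (lambdaBar K l)) f

theorem wordsToSeq_wordShift (f : QuasiShuffle (BaseRing K)) :
    wordsToSeq K (wordShift K f) = seqShift K (wordsToSeq K f) := by
  conv_rhs => rw [← sum_wordSupport f]
  simp only [wordShift, formalShift, map_sum, map_smul, wordsToSeq_shiftWordBy, wordsToSeq_word,
    base_smul_eq, map_mul, baseToSeq_baseShift]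

/-- Invariance makes the coefficients of the longest words constants in `K`. Writing `w₀ = l₀ :: u`,
the coefficient of `u` then says that a combination of letters telescopes, although `l₀` occurs in
it with coefficient 1. Only the empty word is left, where the value is 1. -/
theorem wordsToSeq_ne_zero_of_invariant {m : ℕ} {f : QuasiShuffle (BaseRing K)}
    (hf : ∀ w, m < w.length → wordCoeff w f = 0) (hinv : wordShift K f = f) {w₀ : List Letter}
    (hw₀ : w₀.length = m) (h1 : wordCoeff w₀ f = 1) : wordsToSeq K f ≠ 0 := by
  intro h0
  match w₀, m with
  | [], m =>
    rw [List.length_nil] at hw₀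
    have hf1 : f = 1 := ext_wordCoeff fun w => by
      rw [one_eq_word, wordCoeff_word]
      split_ifs with hw
      · rw [← hw, h1]
      · exact hf w (hw₀ ▸ List.length_pos_iff.2 (Ne.symm hw))
    rw [hf1, wordsToSeq_one] at h0
    exact one_ne_zero h0
  | l₀ :: u, m =>
    rw [List.length_cons] at hw₀
    have hconst : ∀ l, ∃ c : K, wordCoeff (l :: u) f = algebraMap K (BaseRing K) c := by
      intro l
      refine exists_const_of_baseShift_eq K ?_
      rw [← wordCoeff_formalShift_of_length_le (baseShift K)
        (fun l => baseShift K (lambdaBar K l)) (f := f)]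
      · exact congrArg (wordCoeff (l :: u)) hinv
      intro w hw
      exact hf w (by rw [List.length_cons] at hw; omega)
    choose k hk using hconst
    have h2 := wordCoeff_formalShift_of_length_le_succ (baseShift K)
      (fun l => baseShift K (lambdaBar K l)) (f := f) (u := u)
      fun w hw => hf w (by omega)
    change wordCoeff u (wordShift K f) = _ at h2
    rw [hinv, Finsupp.sum] at h2
    simp only [headCoeff_apply, hk, baseShift_algebraMap] at h2
    have h3 := not_telescoping (eq_sub_of_add_eq' h2.symm)
    have h4 : k l₀ = 0 := h3 l₀ (Finsupp.mem_support_iff.2 (by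
      rw [headCoeff_apply, h1]
      exact one_ne_zero))
    rw [hk, h4, map_zero] at h1
    exact zero_ne_one h1

/-- Nested sums are linearly independent over `K(n)[x]`. -/
theorem wordsToSeq_injective : Function.Injective (wordsToSeq K) := by
  classical
  refine (injective_iff_map_eq_zero _).2 fun f hf => ?_
  have key : ∀ m, ∀ f : QuasiShuffle (BaseRing K), (∀ w, m ≤ w.length → wordCoeff w f = 0) →
      wordsToSeq K f = 0 → f = 0 := by
    intro m
    induction m with
    | zero => exact fun f hf _ => ext_wordCoeff fun w => by rw [hf w (Nat.zero_le _), map_zero]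
    | succ m ih =>
      -- Inner induction on a finite set `T` of words that contains all words of length `m` with
      -- nonzero coefficient.
      have key2 : ∀ (T : Finset (List Letter)) (f : QuasiShuffle (BaseRing K)),
          (∀ w, m < w.length → wordCoeff w f = 0) →
          (∀ w, w.length = m → w ∉ T → wordCoeff w f = 0) → wordsToSeq K f = 0 → f = 0 := by
        intro T
        induction T using Finset.induction_on with
        | empty =>
          intro f h1 h2 h3
          refine ih f (fun w hw => ?_) h3
          rcases hw.lt_or_eq with hw | hw
          · exact h1 w hw
          · exact h2 w hw.symm (Finset.notMem_empty w)
        | insert w₀ T hw₀ ihT =>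
          intro f h1 h2 h3
          by_cases hr : w₀.length = m ∧ wordCoeff w₀ f ≠ 0
          · exfalso
            obtain ⟨hm, hr⟩ := hr
            obtain ⟨s, hs⟩ := exists_mul_add_shift_eq_one K hr
            have hlen : ∀ w, m < w.length → wordCoeff w (s • f) = 0 := fun w hw => by
              rw [map_smul, h1 w hw, smul_zero]
            -- This is again a relation; its coefficient at `w₀` is 1, and no top-length word
            -- outside `insert w₀ T` appears.
            set f' := s • f + wordShift K (s • f) with hf'
            have hcoeff : ∀ w, m ≤ w.length → wordCoeff w f'
                = s * wordCoeff w f + baseShift K (s * wordCoeff w f) := fun w hw => by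
              rw [hf', map_add, wordCoeff_formalShift_of_length_le _ _
                (fun v hv => hlen v (by omega)), map_smul, smul_eq_mul]
            have hlen' : ∀ w, m < w.length → wordCoeff w f' = 0 := fun w hw => by
              rw [hcoeff w hw.le, h1 w hw, mul_zero, map_zero, add_zero]
            have h0' : wordsToSeq K f' = 0 := by
              rw [hf', map_add, wordsToSeq_wordShift, map_smul, h3, smul_zero, map_zero, add_zero]
            have h1' : wordCoeff w₀ f' = 1 := by rw [hcoeff w₀ hm.ge, hs]
            have hshift : ∀ w, m ≤ w.length → wordCoeff w (wordShift K f' - f')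
                = baseShift K (wordCoeff w f') - wordCoeff w f' := fun w hw => by
              rw [map_sub, wordCoeff_formalShift_of_length_le _ _
                (fun v hv => hlen' v (by omega))]
            -- The coefficient 1 at `w₀` cancels in `wordShift K f' - f'`, so the inner induction
            -- makes this difference zero and `f'` invariant.
            refine wordsToSeq_ne_zero_of_invariant K hlen'
              (sub_eq_zero.1 (ihT _ ?_ ?_ ?_)) hm h1' h0'
            · intro w hw
              rw [hshift w hw.le, hlen' w hw, map_zero, sub_zero]
            · intro w hw hwT
              rw [hshift w hw.ge]
              by_cases hww : w = w₀
              · rw [hww, h1', map_one, sub_self]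
              · rw [hcoeff w hw.ge, h2 w hw (by simp [hww, hwT])]
                simp
            · rw [map_sub, wordsToSeq_wordShift, h0', map_zero, sub_zero]
          · refine ihT f h1 (fun w hw hwT => ?_) h3
            by_cases hww : w = w₀
            · subst hww
              by_contra h
              exact hr ⟨hw, h⟩
            · exact h2 w hw (by simp [hww, hwT])
      intro f h1 h3
      refine key2 (wordSupport f) f (fun w hw => h1 w hw) (fun w _ hw => ?_) h3
      by_contra h
      exact hw (mem_wordSupport.2 h)
  obtain ⟨m, hm⟩ := exists_length_le f
  exact key (m + 1) f (fun w hw => hm w hw) hf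

end

end CycSums

/-! ### The difference rings inside the ring of sequences -/

namespace CycSums

section
variable (K : Type*) [Field K]

/-! ### Evaluation of the difference rings on sequences -/

theorem sumShift_C (r : BaseRing K) :
    sumShift K (MvPolynomial.C r) = MvPolynomial.C (baseShift K r) :=
  MvPolynomial.eval₂_C _ _ r

theorem sumShift_X (w : Word) : sumShift K (MvPolynomial.X w) = shiftWord K w.1 :=
  MvPolynomial.eval₂_X _ _ w

theorem exists_sumShift_eq_shiftWord (M : Set ℕ) (d : ℕ) (w : List Letter)
    (hw : ∀ l ∈ w, l.a ∈ M) (hd : weight w ≤ d) :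
    ∃ g ∈ sumRingLE K M d, sumShift K g = shiftWord K w := by
  match w with
  | [] => exact ⟨1, one_mem _, by rw [map_one, shiftWord]⟩
  | m :: w => exact ⟨MvPolynomial.X ⟨m :: w, List.cons_ne_nil _ _⟩,
      Algebra.subset_adjoin ⟨_, ⟨hw, hd⟩, rfl⟩, sumShift_X K _⟩

/-- The backward shift of `S_{l w}(n)` removes the last summand: the preimage is `S_{l w} - λ(l)
S_w`, with coefficients at `n` itself. -/
theorem exists_sumShift_eq_X (M : Set ℕ) (d : ℕ) (w : Word) (hw : w ∈ wordsLE M d) :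
    ∃ g ∈ sumRingLE K M d, sumShift K g = MvPolynomial.X w := by
  have hX : MvPolynomial.X w ∈ sumRingLE K M d := Algebra.subset_adjoin ⟨_, hw, rfl⟩
  obtain ⟨w, hne⟩ := w
  match w, hne with
  | l :: w, hne =>
    have hd : weight (l :: w) ≤ d := hw.2
    rw [weight_cons] at hd
    obtain ⟨g, hg, hgs⟩ := exists_sumShift_eq_shiftWord K M d w
      (fun m hm => hw.1 m (List.mem_cons_of_mem _ hm)) (le_of_add_le_right hd)
    have hg' : MvPolynomial.X ⟨l :: w, hne⟩ - MvPolynomial.C (lambdaBar K l) * g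
        ∈ sumRingLE K M d :=
      Subalgebra.sub_mem _ hX (Subalgebra.mul_mem _ ((sumRingLE K M d).algebraMap_mem _) hg)
    refine ⟨_, hg', ?_⟩
    rw [map_sub, map_mul, hgs, sumShift_X, sumShift_C, shiftWord, add_sub_cancel_right]

variable [CharZero K]

/-- Evaluation of the polynomial ring in all sums on sequences. -/
def evalSums : SumRing K →ₐ[BaseRing K] SeqRing K :=
  MvPolynomial.aeval fun w : Word => seqClass K (nestedSum K w.1)

theorem evalSums_X (w : Word) :
    evalSums K (MvPolynomial.X w) = seqClass K (nestedSum K w.1) :=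
  MvPolynomial.aeval_X _ w

theorem evalSums_C (r : BaseRing K) : evalSums K (MvPolynomial.C r) = baseToSeq K r :=
  MvPolynomial.aeval_C _ r

/-- `wordsToSeq` as a homomorphism of algebras. -/
def wordsToSeqHom : QuasiShuffle (BaseRing K) →ₐ[BaseRing K] SeqRing K :=
  AlgHom.ofLinearMap (wordsToSeq K) (wordsToSeq_one K) (wordsToSeq_mul K)

theorem wordsToSeq_linearize (f : SumRing K) : wordsToSeq K (linearize K f) = evalSums K f := by
  have h : (wordsToSeqHom K).comp (linearize K) = evalSums K :=
    MvPolynomial.algHom_ext fun w => by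
      rw [AlgHom.comp_apply, linearize, MvPolynomial.aeval_X, evalSums_X]
      exact wordsToSeq_word K w.1
  exact DFunLike.congr_fun h f

/-- Evaluation factors through linearization, and `wordsToSeq_injective` says that nothing is lost
after it. So the formal quasi-shuffle relations are all the relations between sequences. -/
theorem mem_relIdeal_iff {f : SumRing K} : f ∈ relIdeal K ↔ evalSums K f = 0 := by
  rw [relIdeal, RingHom.mem_ker, ← wordsToSeq_linearize]
  exact (map_eq_zero_iff _ (wordsToSeq_injective K)).symm

theorem evalSums_shiftWord (w : List Letter) :
    evalSums K (shiftWord K w) = seqShift K (seqClass K (nestedSum K w)) := by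
  induction w with
  | nil => rw [shiftWord, map_one]; rfl
  | cons l w ih =>
    rw [shiftWord, map_add, map_mul, ih, evalSums_X, evalSums_C, baseToSeq_baseShift,
      baseToSeq_lambdaBar, seqShift_seqClass, seqShift_seqClass, seqShift_seqClass,
      ← seqClass_mul, ← seqClass_add]
    simp only [nestedSum_cons_succ]

theorem evalSums_sumShift (f : SumRing K) :
    evalSums K (sumShift K f) = seqShift K (evalSums K f) := by
  have h : (evalSums K : SumRing K →+* SeqRing K).comp (sumShift K)
      = (seqShift K : SeqRing K →+* SeqRing K).comp (evalSums K : SumRing K →+* SeqRing K) := by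
    refine MvPolynomial.ringHom_ext (fun r => ?_) fun w => ?_
    · change evalSums K (sumShift K (MvPolynomial.C r)) = seqShift K (evalSums K (MvPolynomial.C r))
      rw [sumShift_C, evalSums_C, evalSums_C, baseToSeq_baseShift]
    · change evalSums K (sumShift K (MvPolynomial.X w)) = seqShift K (evalSums K (MvPolynomial.X w))
      rw [sumShift_X, evalSums_X, evalSums_shiftWord]
  exact DFunLike.congr_fun h f

/-- Evaluation of a stage of the chain on sequences. -/
def stageToSeq (k : ℕ) : Stage K k →+* SeqRing K :=
  Ideal.Quotient.lift _ ((evalSums K : SumRing K →+* SeqRing K).comp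
    (sumRingLE K (Set.Icc 1 k) k).val.toRingHom) fun _ hf => (mem_relIdeal_iff K).1 hf

theorem stageToSeq_mk (k : ℕ) (f : sumRingLE K (Set.Icc 1 k) k) :
    stageToSeq K k (Ideal.Quotient.mk _ f) = evalSums K f.1 :=
  Ideal.Quotient.lift_mk _ _ _

theorem stageToSeq_injective (k : ℕ) : Function.Injective (stageToSeq K k) := by
  intro f g h
  obtain ⟨f, rfl⟩ := Ideal.Quotient.mk_surjective f
  obtain ⟨g, rfl⟩ := Ideal.Quotient.mk_surjective g
  rw [stageToSeq_mk, stageToSeq_mk] at h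
  refine Ideal.Quotient.eq.2 ((mem_relIdeal_iff K).2 ?_)
  change evalSums K (f.1 - g.1) = 0
  rw [map_sub, h, sub_self]

theorem stageToSeq_incl {i j : ℕ} (h : i ≤ j) (f : Stage K i) :
    stageToSeq K j (ReducedLE.incl K (Set.Icc_subset_Icc_right h) h f) = stageToSeq K i f := by
  obtain ⟨f, rfl⟩ := Ideal.Quotient.mk_surjective f
  exact (stageToSeq_mk K j (Subalgebra.inclusion (sumRingLE_mono K (Set.Icc_subset_Icc_right h) h)
    f)).trans (stageToSeq_mk K i f).symm

/-! ### The shift is an automorphism -/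

theorem relIdealLE_le_comap_sumShiftLE (M : Set ℕ) (d : ℕ) :
    relIdealLE K M d ≤ (relIdealLE K M d).comap (sumShiftLE K M d) := by
  intro f hf
  have h : evalSums K f.1 = 0 := (mem_relIdeal_iff K).1 hf
  refine (mem_relIdeal_iff K).2 ?_
  change evalSums K (sumShift K f.1) = 0
  rw [evalSums_sumShift, h, map_zero]

/-- The shift of a stage of the chain. -/
def stageShift (k : ℕ) : Stage K k →+* Stage K k :=
  Ideal.quotientMap _ (sumShiftLE K (Set.Icc 1 k) k) (relIdealLE_le_comap_sumShiftLE K _ k)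

theorem stageShift_mk (k : ℕ) (f : sumRingLE K (Set.Icc 1 k) k) :
    stageShift K k (Ideal.Quotient.mk _ f)
      = Ideal.Quotient.mk _ (sumShiftLE K (Set.Icc 1 k) k f) :=
  Ideal.quotientMap_mk

theorem stageToSeq_stageShift (k : ℕ) (f : Stage K k) :
    stageToSeq K k (stageShift K k f) = seqShift K (stageToSeq K k f) := by
  obtain ⟨f, rfl⟩ := Ideal.Quotient.mk_surjective f
  rw [stageShift_mk, stageToSeq_mk, stageToSeq_mk, ← evalSums_sumShift]
  rfl

theorem exists_sumShift_eq (M : Set ℕ) (d : ℕ) {f : SumRing K} (hf : f ∈ sumRingLE K M d) :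
    ∃ g ∈ sumRingLE K M d, sumShift K g = f := by
  refine Algebra.adjoin_induction
    (p := fun f _ => ∃ g ∈ sumRingLE K M d, sumShift K g = f) ?_ ?_ ?_ ?_ hf
  · rintro _ ⟨w, hw, rfl⟩
    exact exists_sumShift_eq_X K M d w hw
  · intro r
    obtain ⟨s, rfl⟩ := baseShift_surjective K r
    exact ⟨MvPolynomial.C s, (sumRingLE K M d).algebraMap_mem _, sumShift_C K s⟩
  · rintro x y _ _ ⟨g, hg, rfl⟩ ⟨g', hg', rfl⟩
    exact ⟨g + g', Subalgebra.add_mem _ hg hg', map_add (sumShift K) g g'⟩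
  · rintro x y _ _ ⟨g, hg, rfl⟩ ⟨g', hg', rfl⟩
    exact ⟨g * g', Subalgebra.mul_mem _ hg hg', map_mul (sumShift K) g g'⟩

/-- Injectivity is inherited from the shift of sequences; surjectivity already holds in the
polynomial ring, stage by stage. -/
theorem stageShift_bijective (k : ℕ) : Function.Bijective (stageShift K k) := by
  refine ⟨fun f g h => stageToSeq_injective K k ((seqShift K).injective ?_), fun f => ?_⟩
  · rw [← stageToSeq_stageShift, ← stageToSeq_stageShift, h]
  · obtain ⟨⟨f, hf⟩, rfl⟩ := Ideal.Quotient.mk_surjective f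
    obtain ⟨g, hg, rfl⟩ := exists_sumShift_eq K _ _ hf
    exact ⟨Ideal.Quotient.mk _ ⟨g, hg⟩, stageShift_mk K k _⟩

/-- The automorphism of a stage of the chain. -/
def stageAut (k : ℕ) : Stage K k ≃+* Stage K k :=
  RingEquiv.ofBijective (stageShift K k) (stageShift_bijective K k)

/-- The automorphism of the union of the chain. -/
def cycAut : CycRing K ≃+* CycRing K :=
  Ring.DirectLimit.congr (stageAut K) fun i j h => RingHom.ext fun f =>
    stageToSeq_injective K j (by
      change stageToSeq K j (stageShift K j (ReducedLE.incl K (Set.Icc_subset_Icc_right h) h f))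
        = stageToSeq K j (ReducedLE.incl K (Set.Icc_subset_Icc_right h) h (stageShift K i f))
      rw [stageToSeq_stageShift, stageToSeq_incl, stageToSeq_incl, stageToSeq_stageShift])

theorem cycAut_of (k : ℕ) (f : Stage K k) :
    cycAut K (Ring.DirectLimit.of (Stage K) _ k f)
      = Ring.DirectLimit.of (Stage K) _ k (stageAut K k f) :=
  Ring.DirectLimit.congr_apply_of _ _ f

/-- The embedding of the union of the chain into the ring of sequences. -/
def cycToSeq : CycRing K →+* SeqRing K :=
  Ring.DirectLimit.lift (Stage K) _ (SeqRing K) (stageToSeq K) fun _ _ h f => stageToSeq_incl K h f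

theorem cycToSeq_of (k : ℕ) (f : Stage K k) :
    cycToSeq K (Ring.DirectLimit.of (Stage K) _ k f) = stageToSeq K k f :=
  Ring.DirectLimit.lift_of _ _ _ _ _

theorem cycToSeq_injective : Function.Injective (cycToSeq K) :=
  Ring.DirectLimit.lift_injective _ _ _ (stageToSeq_injective K)

theorem cycToSeq_cycAut (f : CycRing K) : cycToSeq K (cycAut K f) = seqShift K (cycToSeq K f) := by
  obtain ⟨k, f, rfl⟩ := Ring.DirectLimit.exists_of f
  rw [cycAut_of, cycToSeq_of, cycToSeq_of]
  exact stageToSeq_stageShift K k f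

theorem cycToSeq_ofBase (r : BaseRing K) : cycToSeq K (ofBase K r) = baseToSeq K r := by
  rw [ofBase, RingHom.comp_apply, cycToSeq_of]
  exact (stageToSeq_mk K 0 _).trans (evalSums_C K r)

theorem cycAut_eq_self_iff (f : CycRing K) :
    cycAut K f = f ↔ f ∈ Set.range fun c : K => ofBase K (algebraMap K (BaseRing K) c) := by
  constructor
  · intro h
    obtain ⟨c, hc⟩ := exists_const_of_seqShift_eq K
      ((cycToSeq_cycAut K f).symm.trans (congrArg _ h))
    refine ⟨c, cycToSeq_injective K ?_⟩
    rw [hc, cycToSeq_ofBase, baseToSeq_algebraMap]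
  · rintro ⟨c, rfl⟩
    apply cycToSeq_injective K
    rw [cycToSeq_cycAut, cycToSeq_ofBase, baseToSeq_algebraMap, seqShift_seqClass]

/-! ### Basis sums generate the ring of sums freely -/

/-- Since `b < a`, bounds on `a` and `c` leave finitely many letters; since exponents are positive,
the length of a word is at most its weight. -/
theorem finite_wordsLE (k d : ℕ) : (wordsLE (Set.Icc 1 k) d).Finite := by
  let S : Set Letter := {l | l.a ≤ k ∧ l.c ≤ d}
  have hS : S.Finite := by
    let φ : Letter → ℕ × ℕ × ℕ × ℤˣ := fun l => (l.a, l.b, l.c, l.z)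
    have hφ : Function.Injective φ := fun l m h => by
      cases l; cases m; simp_all [φ]
    refine Set.Finite.of_finite_image (f := φ) (Set.Finite.subset
      ((Set.finite_Iic k).prod ((Set.finite_Iic k).prod ((Set.finite_Iic d).prod Set.finite_univ)))
      ?_) hφ.injOn
    rintro _ ⟨l, hl, rfl⟩
    exact ⟨hl.1, l.b_lt.le.trans hl.1, hl.2, trivial⟩
  have : Finite S := hS
  have hfin := (List.finite_length_le S d).image (List.map Subtype.val)
  refine Set.Finite.of_finite_image (f := Subtype.val) (hfin.subset ?_) Subtype.val_injective.injOn
  rintro _ ⟨⟨w, hne⟩, ⟨hw, hd⟩, rfl⟩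
  have hc : ∀ l ∈ w, l.c ≤ d := fun l hl =>
    (List.single_le_sum (fun _ _ => Nat.zero_le _) _ (List.mem_map_of_mem hl)).trans hd
  lift w to List S using fun l hl => ⟨(hw l hl).2, hc l hl⟩
  refine ⟨w, ?_, rfl⟩
  have hlen : ∀ v : List Letter, v.length ≤ weight v := by
    intro v
    induction v with
    | nil => exact le_rfl
    | cons l v ih =>
      have := l.c_pos
      rw [weight_cons, List.length_cons]
      omega
  have h1 := hlen (w.map Subtype.val)
  rw [List.length_map] at h1
  exact h1.trans hd

variable {B : ℕ → ℕ → Set Word}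

theorem stageGens_mono (hB : IsBasisChoice B) : Monotone (stageGens B) := by
  intro j k h
  exact Set.iUnion₂_subset fun d hd => (hB.monotone d h).trans
    (Set.subset_iUnion₂_of_subset d (hd.trans h) subset_rfl)

theorem finite_newGens (hB : IsBasisChoice B) (k : ℕ) : (newGens B k).Finite := by
  refine (finite_wordsLE k k).subset
    (Set.sdiff_subset.trans (Set.iUnion₂_subset fun d hd w hw => ?_))
  obtain ⟨h1, h2⟩ := (hB.isBasisSums k d).subset hw
  exact ⟨h1, h2.trans_le hd⟩

theorem newGens_subset (k : ℕ) : newGens B k ⊆ ⋃ d, ⋃ k, B k d := by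
  intro w hw
  obtain ⟨d, _, hwd⟩ := Set.mem_iUnion₂.1 hw.1
  exact Set.mem_iUnion.2 ⟨d, Set.mem_iUnion.2 ⟨k, hwd⟩⟩

/-- The generators, listed by the step in which they are new. -/
def gensEquiv (hB : IsBasisChoice B) : (Σ k : ℕ, newGens B k) ≃ (⋃ d, ⋃ k, B k d : Set Word) :=
  Equiv.ofBijective (fun g => ⟨g.2.1, newGens_subset g.1 g.2.2⟩) (by
    constructor
    · have hlt : ∀ {j k : ℕ} {w : Word}, j < k → w ∈ newGens B j → w ∉ newGens B k :=
        fun h hj hk => hk.2 (stageGens_mono hB (Nat.le_sub_one_of_lt h) hj.1)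
      rintro ⟨j, v, hv⟩ ⟨k, w, hw⟩ h
      obtain rfl : v = w := congrArg Subtype.val h
      obtain rfl : j = k := by
        rcases lt_trichotomy j k with h | h | h
        · exact absurd hw (hlt h hv)
        · exact h
        · exact absurd hv (hlt h hw)
      rfl
    · classical
      rintro ⟨w, hw⟩
      obtain ⟨d, hw⟩ := Set.mem_iUnion.1 hw
      obtain ⟨k, hw⟩ := Set.mem_iUnion.1 hw
      have hex : ∃ k, w ∈ stageGens B k :=
        ⟨max k d, Set.mem_iUnion₂.2 ⟨d, le_max_right _ _, hB.monotone d (le_max_left _ _) hw⟩⟩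
      -- The word is new in the first stage containing it. That stage is not 0, where `k - 1 = k`,
      -- because stage 0 admits only weight 0 and words here have positive weight.
      refine ⟨⟨Nat.find hex, w, Nat.find_spec hex, Nat.find_min hex (Nat.sub_one_lt fun h0 => ?_)⟩,
        rfl⟩
      have h1 := Nat.find_spec hex
      rw [h0] at h1
      obtain ⟨e, he, h2⟩ := Set.mem_iUnion₂.1 h1
      have h3 := ((hB.isBasisSums 0 e).subset h2).2
      have h4 := weight_pos w
      omega)

theorem algebraicIndependent_seqClass (hB : IsBasisChoice B) :
    AlgebraicIndependent (BaseRing K) fun g : Σ k : ℕ, newGens B k =>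
      seqClass K (nestedSum K g.2.1.1) := by
  have h1 : AlgebraicIndependent (BaseRing K) fun g : (⋃ d, ⋃ k, B k d : Set Word) =>
      word (BaseRing K) g.1.1 :=
    algebraicIndependent_iff.2 fun P hP =>
      eq_zero_of_aeval_word_eq_zero hB.isBasisSums_iUnion P hP
  have h2 := h1.map' (f := wordsToSeqHom K) (wordsToSeq_injective K)
  have h3 := (algebraicIndependent_equiv (gensEquiv hB)).2 h2
  convert! h3 using 1
  funext g
  exact (wordsToSeq_word K g.2.1.1).symm

theorem seqClass_nestedSum_mem {S : Subring (SeqRing K)} (hS : ∀ r, baseToSeq K r ∈ S)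
    (hB : IsBasisChoice B) (hgens : ∀ k, ∀ g ∈ newGens B k, seqClass K (nestedSum K g.1) ∈ S)
    (w : List Letter) : seqClass K (nestedSum K w) ∈ S := by
  have hmem : ∀ P : MvPolynomial (⋃ d, ⋃ k, B k d : Set Word) ℚ, wordsToSeq K (extendScalars
      (BaseRing K) (MvPolynomial.aeval (fun g : ⋃ d, ⋃ k, B k d => word ℚ g.1.1) P)) ∈ S := by
    intro P
    induction P using MvPolynomial.induction_on with
    | C q =>
      rw [MvPolynomial.aeval_C, Algebra.algebraMap_eq_smul_one, one_eq_word, map_smul,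
        extendScalars_word, ← algebraMap_smul (BaseRing K), map_smul, wordsToSeq_word,
        base_smul_eq]
      exact mul_mem (hS _) (one_mem S)
    | add P Q hP hQ =>
      rw [map_add, map_add, map_add]
      exact add_mem hP hQ
    | mul_X P g hP =>
      rw [map_mul, extendScalars_mul, wordsToSeq_mul, MvPolynomial.aeval_X, extendScalars_word,
        wordsToSeq_word]
      refine mul_mem hP ?_
      obtain ⟨g', rfl⟩ := (gensEquiv hB).surjective g
      exact hgens g'.1 g'.2.1 g'.2.2
  obtain ⟨P, hP⟩ := word_mem_range_aeval hB.isBasisSums_iUnion w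
  have := hmem P
  rwa [hP, extendScalars_word, wordsToSeq_word] at this

theorem seqClass_nestedSum_mem_range (w : Word) :
    seqClass K (nestedSum K w.1) ∈ (cycToSeq K).range := by
  obtain ⟨m, hm⟩ := exists_alphabet w.1
  have hw : MvPolynomial.X w ∈ sumRingLE K (Set.Icc 1 (max m (weight w.1))) (max m (weight w.1)) :=
    Algebra.subset_adjoin ⟨w, ⟨fun l hl => Set.Icc_subset_Icc_right (le_max_left _ _) (hm l hl),
      le_max_right _ _⟩, rfl⟩
  refine ⟨Ring.DirectLimit.of (Stage K) _ _ (Ideal.Quotient.mk _ ⟨_, hw⟩), ?_⟩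
  rw [cycToSeq_of, stageToSeq_mk, evalSums_X]

theorem cycToSeq_mem {S : Subring (SeqRing K)} (hS : ∀ r, baseToSeq K r ∈ S)
    (hB : IsBasisChoice B) (hgens : ∀ k, ∀ g ∈ newGens B k, seqClass K (nestedSum K g.1) ∈ S)
    (f : CycRing K) : cycToSeq K f ∈ S := by
  obtain ⟨k, f, rfl⟩ := Ring.DirectLimit.exists_of f
  obtain ⟨⟨p, hp⟩, rfl⟩ := Ideal.Quotient.mk_surjective f
  rw [cycToSeq_of, stageToSeq_mk]
  change evalSums K p ∈ S
  -- All nested sums evaluate into `S`, so the induction may run over the whole polynomial ring.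
  clear hp
  induction p using MvPolynomial.induction_on with
  | C r =>
    rw [evalSums_C]
    exact hS r
  | add p q hp hq =>
    rw [map_add]
    exact add_mem hp hq
  | mul_X p w hp =>
    rw [map_mul, evalSums_X]
    exact mul_mem hp (seqClass_nestedSum_mem K hS hB hgens w.1)

end

end CycSums

end

/-! ### Assembly of the theorem -/

theorem mainTheorem3 (K : Type*) [Field K] [CharZero K] :
    (∃ B : ℕ → ℕ → Set CycSums.Word, CycSums.IsBasisChoice B) ∧
    ∃ (σk : ∀ k : ℕ, CycSums.Stage K k ≃+* CycSums.Stage K k)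
      (σ : CycSums.CycRing K ≃+* CycSums.CycRing K)
      (τ : CycSums.CycRing K →+* CycSums.SeqRing K),
      -- `σk k` is the automorphism of the `k`-th ring of the chain that the shift induces
      (∀ (k : ℕ) (f : CycSums.sumRingLE K (Set.Icc 1 k) k),
        σk k (Ideal.Quotient.mk (CycSums.relIdealLE K (Set.Icc 1 k) k) f)
          = Ideal.Quotient.mk (CycSums.relIdealLE K (Set.Icc 1 k) k)
              (CycSums.sumShiftLE K (Set.Icc 1 k) k f)) ∧
      -- each ring of the chain is embedded, and `σ` extends all `σk k`
      (∀ k : ℕ, Function.Injective (Ring.DirectLimit.of (CycSums.Stage K) _ k :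
        CycSums.Stage K k → CycSums.CycRing K)) ∧
      (∀ (k : ℕ) (f : CycSums.Stage K k),
        σ (Ring.DirectLimit.of (CycSums.Stage K) _ k f)
          = Ring.DirectLimit.of (CycSums.Stage K) _ k (σk k f)) ∧
      -- the constants are the elements of `K`
      {f : CycSums.CycRing K | σ f = f}
        = Set.range (fun c : K => CycSums.ofBase K (algebraMap K (CycSums.BaseRing K) c)) ∧
      -- `τ` is a difference ring embedding
      Function.Injective τ ∧
      (∀ f : CycSums.CycRing K, τ (σ f) = CycSums.seqShift K (τ f)) ∧
      -- `τ` is evaluation on `K(n)`, on `x` and on all sums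
      (∀ f : RatFunc K, τ (CycSums.ofBase K (CycSums.ofRat K f))
        = CycSums.seqClass K fun n => RatFunc.eval (RingHom.id K) (n : K) f) ∧
      τ (CycSums.ofBase K (CycSums.altSign K)) = CycSums.seqClass K (fun n => (-1) ^ n) ∧
      (∀ (k : ℕ) (w : CycSums.Word)
        (hw : MvPolynomial.X w ∈ CycSums.sumRingLE K (Set.Icc 1 k) k),
        τ (Ring.DirectLimit.of (CycSums.Stage K) _ k
            (Ideal.Quotient.mk (CycSums.relIdealLE K (Set.Icc 1 k) k) ⟨MvPolynomial.X w, hw⟩))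
          = CycSums.seqClass K (CycSums.nestedSum K w.1)) ∧
      -- the image is a polynomial ring in the sequences of the basis sums
      ∀ B : ℕ → ℕ → Set CycSums.Word, CycSums.IsBasisChoice B →
        (∀ k : ℕ, (CycSums.newGens B k).Finite) ∧
        AlgebraicIndependent (τ.comp (CycSums.ofBase K)).range
          (fun g : Σ k : ℕ, CycSums.newGens B k =>
            CycSums.seqClass K (CycSums.nestedSum K g.2.1.1)) ∧
        (Algebra.adjoin (τ.comp (CycSums.ofBase K)).range
          (Set.range fun g : Σ k : ℕ, CycSums.newGens B k =>
            CycSums.seqClass K (CycSums.nestedSum K g.2.1.1)) : Set (CycSums.SeqRing K))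
          = Set.range τ := by
  refine ⟨CycSums.exists_isBasisChoice, CycSums.stageAut K, CycSums.cycAut K, CycSums.cycToSeq K,
    CycSums.stageShift_mk K, fun k => ?_, CycSums.cycAut_of K,
    Set.ext (CycSums.cycAut_eq_self_iff K),
    CycSums.cycToSeq_injective K, CycSums.cycToSeq_cycAut K, fun f => ?_, ?_, fun k w hw => ?_,
    fun B hB => ⟨CycSums.finite_newGens hB, ?_, ?_⟩⟩
  · refine Function.Injective.of_comp (f := CycSums.cycToSeq K) ?_
    convert! CycSums.stageToSeq_injective K k using 1
    funext f
    exact CycSums.cycToSeq_of K k f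
  · rw [CycSums.cycToSeq_ofBase, CycSums.baseToSeq_ofRat]
    rfl
  · rw [CycSums.cycToSeq_ofBase, CycSums.baseToSeq_altSign]
  · rw [CycSums.cycToSeq_of, CycSums.stageToSeq_mk, CycSums.evalSums_X]
  -- The scalars change from K(n)[x] to its image under `τ`, along the surjection onto the range.
  · refine (CycSums.algebraicIndependent_seqClass K hB).ringHom_of_comp_eq
      (((CycSums.cycToSeq K).comp (CycSums.ofBase K)).rangeRestrict) (RingHom.id _)
      (RingHom.rangeRestrict_surjective _) Function.injective_id ?_
    exact RingHom.ext fun r => CycSums.cycToSeq_ofBase K r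
  · refine Set.Subset.antisymm (fun s hs => ?_) ?_
    · change s ∈ (CycSums.cycToSeq K).range
      refine Algebra.adjoin_induction (p := fun s _ => s ∈ (CycSums.cycToSeq K).range)
        ?_ ?_ ?_ ?_ hs
      · rintro _ ⟨g, rfl⟩
        exact CycSums.seqClass_nestedSum_mem_range K g.2.1
      · rintro ⟨_, r, rfl⟩
        exact ⟨CycSums.ofBase K r, rfl⟩
      · intro x y _ _ hx hy
        exact add_mem hx hy
      · intro x y _ _ hx hy
        exact mul_mem hx hy
    · rintro _ ⟨f, rfl⟩
      exact CycSums.cycToSeq_mem K (S := Subalgebra.toSubring (Algebra.adjoin _ _))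
        (fun r => Subalgebra.algebraMap_mem _
          (⟨_, ⟨r, CycSums.cycToSeq_ofBase K r⟩⟩ :
            ((CycSums.cycToSeq K).comp (CycSums.ofBase K)).range))
        hB (fun k g hg => Algebra.subset_adjoin (Set.mem_range_self
          (⟨k, g, hg⟩ : Σ k : ℕ, CycSums.newGens B k))) f
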